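/- Consider a real RAM: a machine with integer variables and arrays (with addition, truncated subtraction, comparison and indirect addressing) and real variables and arrays (with rational constants, exact $+,-,\times,/$, $\exp$, $\log$, comparison and conversion of integers to reals, but no rounding), where each elementary operation takes one step. Assume moreover that it has access to a constant-time fully random hash function: a family $(U_\kappa)$ of independent random variables, uniform on $[0,1)$ and indexed by the finite tuples $\kappa$ of nonnegative integers, such that from a computed key $\kappa$ (and a computed integer $m$) the values $U_\kappa$ and $\lfloor m U_\kappa\rfloor$ are each obtained in one step. Then there are a single program, an integer $w$ and a constant $C$ such that the following holds for all integers $k \ge 1$ and $d \ge 0$. There are $k$ random functions $h_1,\dots,h_k$ (random through the hash function only), defined on the nonzero weighted sets $x \in \mathbb{R}_{\ge 0}^d \setminus \{0\}$ and with values in $\mathbb{Z}_{\ge 0}^w$, such that 1. the random functions $h_1, \dots, h_k$ are independent; 2. each $h_j$ is a weighted minhash: for all nonzero $x, y \in \mathbb{R}_{\ge 0}^d$, $$\Pr[h_j(x) = h_j(y)] = J(x,y) = \frac{\sum_i \min(x_i,y_i)}{\sum_i \max(x_i,y_i)};$$ 3. for every nonzero $x \in \mathbb{R}_{\ge 0}^d$,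 given $k$ and the list of the pairs $(i, x_i)$ with $x_i > 0$ in any order, the program almost surely halts with output $h_1(x), \dots, h_k(x)$, and its expected number of steps is at most $$C\,\bigl(k \log k + \|x\|_0 \log(\|x\|_1 + 1/\|x\|_1)\bigr),$$ where $\|x\|_0$ is the number of nonzero weights and $\|x\|_1$ is the sum of the weights. -/

import Mathlib

open MeasureTheory ProbabilityTheory
open scoped NNReal ENNReal

/-! A real RAM with access to a random hash function: a structured imperative language over
integer and real variables and arrays, with a big-step semantics that counts elementary steps. -/

namespace RealRAM

/-- Memory: integer and real variables, and integer and real arrays (array number, position). -/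
structure State where
  nvar : ℕ → ℕ
  rvar : ℕ → ℝ
  narr : ℕ → ℕ → ℕ
  rarr : ℕ → ℕ → ℝ

/-- Integer expressions. There is no multiplication, and `sub` is truncated. -/
inductive NExp where
  | const (c : ℕ)
  | var (v : ℕ)
  | get (a : ℕ) (i : NExp)
  | add (e f : NExp)
  | sub (e f : NExp)

def NExp.eval (s : State) : NExp → ℕ
  | .const c => c
  | .var v => s.nvar v
  | .get a i => s.narr a (i.eval s)
  | .add e f => e.eval s + f.eval s
  | .sub e f => e.eval s - f.eval s

/-- Number of elementary steps needed to evaluate the expression. -/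
def NExp.size : NExp → ℕ
  | .const _ => 1
  | .var _ => 1
  | .get _ i => i.size + 1
  | .add e f => e.size + f.size + 1
  | .sub e f => e.size + f.size + 1

/-- Real expressions: rational constants, exact arithmetic, `exp` and natural `log`.
There is no rounding of reals to integers. -/
inductive RExp where
  | const (q : ℚ)
  | var (v : ℕ)
  | get (a : ℕ) (i : NExp)
  | ofNat (e : NExp)
  | add (e f : RExp)
  | sub (e f : RExp)
  | mul (e f : RExp)
  | div (e f : RExp)
  | exp (e : RExp)
  | log (e : RExp)

noncomputable def RExp.eval (s : State) : RExp → ℝ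
  | .const q => (q : ℝ)
  | .var v => s.rvar v
  | .get a i => s.rarr a (i.eval s)
  | .ofNat e => (e.eval s : ℝ)
  | .add e f => e.eval s + f.eval s
  | .sub e f => e.eval s - f.eval s
  | .mul e f => e.eval s * f.eval s
  | .div e f => e.eval s / f.eval s
  | .exp e => Real.exp (e.eval s)
  | .log e => Real.log (e.eval s)

def RExp.size : RExp → ℕ
  | .const _ => 1
  | .var _ => 1
  | .get _ i => i.size + 1
  | .ofNat e => e.size + 1
  | .add e f => e.size + f.size + 1
  | .sub e f => e.size + f.size + 1
  | .mul e f => e.size + f.size + 1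
  | .div e f => e.size + f.size + 1
  | .exp e => e.size + 1
  | .log e => e.size + 1

/-- Tests. -/
inductive BExp where
  | leN (e f : NExp)
  | leR (e f : RExp)
  | not (b : BExp)
  | and (b c : BExp)

def BExp.holds (s : State) : BExp → Prop
  | .leN e f => e.eval s ≤ f.eval s
  | .leR e f => e.eval s ≤ f.eval s
  | .not b => ¬ b.holds s
  | .and b c => b.holds s ∧ c.holds s

def BExp.size : BExp → ℕ
  | .leN e f => e.size + f.size + 1
  | .leR e f => e.size + f.size + 1
  | .not b => b.size + 1
  | .and b c => b.size + c.size + 1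

/-- Programs. `hashR v key` stores the hash value in `[0, 1)` of the tuple `key` in the real
variable `v`; `hashN v m key` stores the hash value of `key` scaled to the range
`{0, ..., m - 1}` in the integer variable `v`. -/
inductive Prog where
  | skip
  | setN (v : ℕ) (e : NExp)
  | setR (v : ℕ) (e : RExp)
  | putN (a : ℕ) (i e : NExp)
  | putR (a : ℕ) (i : NExp) (e : RExp)
  | hashR (v : ℕ) (key : List NExp)
  | hashN (v : ℕ) (m : NExp) (key : List NExp)
  | seq (p q : Prog)
  | ite (b : BExp) (p q : Prog)
  | loop (b : BExp) (p : Prog)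

/-- Number of elementary steps needed to evaluate the components of a key. -/
def keySize (key : List NExp) : ℕ := (key.map NExp.size).sum

/-- `Exec u p s s' c`: with hash function `u`, the program `p` started in `s` halts in `s'`
after exactly `c` steps. An evaluation of the hash function takes one step, in addition to the
steps that compute its key. -/
inductive Exec (u : List ℕ → ℝ) : Prog → State → State → ℕ → Prop where
  | skip (s : State) : Exec u .skip s s 1
  | setN (s : State) (v : ℕ) (e : NExp) :
      Exec u (.setN v e) s { s with nvar := Function.update s.nvar v (e.eval s) } (e.size + 1)
  | setR (s : State) (v : ℕ) (e : RExp) :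
      Exec u (.setR v e) s { s with rvar := Function.update s.rvar v (e.eval s) } (e.size + 1)
  | putN (s : State) (a : ℕ) (i e : NExp) :
      Exec u (.putN a i e) s
        { s with narr := Function.update s.narr a
                  (Function.update (s.narr a) (i.eval s) (e.eval s)) }
        (i.size + e.size + 1)
  | putR (s : State) (a : ℕ) (i : NExp) (e : RExp) :
      Exec u (.putR a i e) s
        { s with rarr := Function.update s.rarr a
                  (Function.update (s.rarr a) (i.eval s) (e.eval s)) }
        (i.size + e.size + 1)
  | hashR (s : State) (v : ℕ) (key : List NExp) :
      Exec u (.hashR v key) s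
        { s with rvar := Function.update s.rvar v (u (key.map (NExp.eval s))) }
        (keySize key + 1)
  | hashN (s : State) (v : ℕ) (m : NExp) (key : List NExp) :
      Exec u (.hashN v m key) s
        { s with nvar := Function.update s.nvar v
                  ⌊(m.eval s : ℝ) * u (key.map (NExp.eval s))⌋₊ }
        (m.size + keySize key + 1)
  | seq {p q : Prog} {s s₁ s₂ : State} {c₁ c₂ : ℕ} :
      Exec u p s s₁ c₁ → Exec u q s₁ s₂ c₂ → Exec u (.seq p q) s s₂ (c₁ + c₂)
  | iteTrue {b : BExp} {p q : Prog} {s s' : State} {c : ℕ} :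
      b.holds s → Exec u p s s' c → Exec u (.ite b p q) s s' (b.size + 1 + c)
  | iteFalse {b : BExp} {p q : Prog} {s s' : State} {c : ℕ} :
      ¬ b.holds s → Exec u q s s' c → Exec u (.ite b p q) s s' (b.size + 1 + c)
  | loopTrue {b : BExp} {p : Prog} {s s₁ s₂ : State} {c₁ c₂ : ℕ} :
      b.holds s → Exec u p s s₁ c₁ → Exec u (.loop b p) s₁ s₂ c₂ →
        Exec u (.loop b p) s s₂ (b.size + 1 + c₁ + c₂)
  | loopFalse {b : BExp} {p : Prog} {s : State} :
      ¬ b.holds s → Exec u (.loop b p) s s (b.size + 1)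

/-- The final state and the number of steps are determined by the program, the hash function
and the initial state. -/
theorem Exec.deterministic {u : List ℕ → ℝ} {p : Prog} {s s₁ s₂ : State} {c₁ c₂ : ℕ}
    (h₁ : Exec u p s s₁ c₁) (h₂ : Exec u p s s₂ c₂) : s₁ = s₂ ∧ c₁ = c₂ := by
  induction h₁ generalizing s₂ c₂ with
  | seq _ _ ihp ihq =>
    cases h₂ with
    | seq hp hq =>
      obtain ⟨rfl, rfl⟩ := ihp hp
      obtain ⟨rfl, rfl⟩ := ihq hq
      exact ⟨rfl, rfl⟩
  | iteTrue hb _ ih =>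
    cases h₂ with
    | iteTrue _ h => obtain ⟨rfl, rfl⟩ := ih h; exact ⟨rfl, rfl⟩
    | iteFalse hb' _ => exact absurd hb hb'
  | iteFalse hb _ ih =>
    cases h₂ with
    | iteTrue hb' _ => exact absurd hb' hb
    | iteFalse _ h => obtain ⟨rfl, rfl⟩ := ih h; exact ⟨rfl, rfl⟩
  | loopTrue hb _ _ ihp ihl =>
    cases h₂ with
    | loopTrue _ hp hl =>
      obtain ⟨rfl, rfl⟩ := ihp hp
      obtain ⟨rfl, rfl⟩ := ihl hl
      exact ⟨rfl, rfl⟩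
    | loopFalse hb' => exact absurd hb hb'
  | loopFalse hb =>
    cases h₂ with
    | loopTrue hb' _ _ => exact absurd hb' hb
    | loopFalse _ => exact ⟨rfl, rfl⟩
  | _ => cases h₂; exact ⟨rfl, rfl⟩

/-- The running time (number of steps) of `p` started in `s`; it is `∞` if `p` does not halt. -/
noncomputable def time (u : List ℕ → ℝ) (p : Prog) (s : State) : ℝ≥0∞ :=
  ⨅ (c : ℕ) (_ : ∃ s', Exec u p s s' c), (c : ℝ≥0∞)

end RealRAM

namespace MinHash

/-- Nonzero weighted sets over `d` elements. -/
abbrev WeightedSet (d : ℕ) : Type := {x : Fin d → ℝ≥0 // x ≠ 0}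

/-- The sum of the weights. -/
noncomputable def l1norm {d : ℕ} (x : WeightedSet d) : ℝ := ∑ i, (x.1 i : ℝ)

/-- The weighted Jaccard similarity. -/
noncomputable def jaccard {d : ℕ} (x y : WeightedSet d) : ℝ :=
  (∑ i, min (x.1 i : ℝ) (y.1 i)) / ∑ i, max (x.1 i : ℝ) (y.1 i)

/-- `L` lists the elements of nonzero weight, in some order. -/
def IsListing {d : ℕ} (x : WeightedSet d) (L : List (Fin d)) : Prop :=
  L.Nodup ∧ ∀ i, i ∈ L ↔ x.1 i ≠ 0

/-- The initial memory: variable `0` holds `k`, variable `1` the number of nonzero elements, and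
the arrays number `0` the list of pairs (element, weight). All other memory is `0`; in
particular `d` is not part of the input. -/
noncomputable def input (k : ℕ) {d : ℕ} (x : WeightedSet d) (L : List (Fin d)) :
    RealRAM.State where
  nvar v := if v = 0 then k else if v = 1 then L.length else 0
  rvar _ := 0
  narr a m := if a = 0 then (L.map (fun i => (i : ℕ))).getD m 0 else 0
  rarr a m := if a = 0 then (L.map (fun i => (x.1 i : ℝ))).getD m 0 else 0

/-- The program halts, and the `j`-th value that it outputs is `y j`, a tuple of `w` integers
found at position `j` of the integer arrays `1, ..., w`. -/
def Outputs (u : List ℕ → ℝ) (p : RealRAM.Prog) (s : RealRAM.State) {k w : ℕ}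
    (y : Fin k → Fin w → ℕ) : Prop :=
  ∃ s' c, RealRAM.Exec u p s s' c ∧
    ∀ (j : Fin k) (a : Fin w), s'.narr ((a : ℕ) + 1) j = y j a

/-- A fully random hash function on tuples of integers: its values are independent and uniform
in `[0, 1)`. -/
structure IsFullyRandom {Ω : Type*} [MeasurableSpace Ω] (u : List ℕ → Ω → ℝ)
    (P : Measure Ω) : Prop where
  measurable : ∀ key, Measurable (u key)
  uniform : ∀ key, pdf.IsUniform (u key) (Set.Ico (0 : ℝ) 1) P volume
  indep : iIndepFun u P

end MinHash

/-! # Weighted minhashing with darts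

Attach to every element a quadrant of points (weight, rank) and throw *darts* at the quadrants by a
Poisson process of unit rate. Every dart carries a uniformly random mark `j < k`, so that the darts of
the different marks form independent Poisson processes of rate `1 / k`. The hash value `h j x` is the
identity of the dart of least rank among the darts of mark `j` whose weight is below the weight of
their element in `x` (`IsWinner`, `minHash`).

*Collisions.* Raise the rank until the first dart of mark `j` appears below `max (x i) (y i)` for some
`i`. If it lies below `min (x i) (y i)` then it is the winner for both `x` and `y`, and otherwise the
winners differ. The two kinds of darts are like independent exponential clocks of rates proportional
to `∑ min` and `∑ max - ∑ min`, so the first kind comes first with probability `∑ min / ∑ max`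
(`race`, `prob_minHash_eq`). All that is used of the Poisson process is the probability that a region
is void (`prob_void`).

*Generating the darts.* Each quadrant is tiled by rectangles of area one (`Cell`) such that only
`O(1 + log (1 + x) + log (1 + t) + x * t)` of them meet `[0, x) × [0, t)` (`elemSize_le`). The number
of darts in a tile is drawn by inversion of the Poisson distribution function of mean one, and each
dart draws its mark. The keys of the random numbers that place a dart contain its mark and its index
among the darts of this mark in its tile; hence the darts of mark `j` depend only on their numbers in
the tiles and on hash values used by no other mark. By Poisson splitting the former are independent
for different marks (`map_counts`), and therefore so are the darts (`indep_data`).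

*Running time.* The program scales the weights by `T = k * (1 + log k)`, which does not change the
Jaccard similarity, and searches all darts of rank less than `2 ^ s / S`, for `s = 0, 1, …`, until
every mark has one; `S` is the sum of the weights. It thus knows the winner of every mark when it
stops (`runs_mainProg`, `IsBest.eq_minHash`). The number of tiles in round `s` is at most a constant
times `2 ^ s * (n * log (S + 1 / S) + T)`, where `n` is the number of elements
(`sum_elemSize_le`), and round `s + 1` takes place with probability at most `exp (-2 ^ s)`
(`prob_fails_le`). This event is not independent of the numbers of darts, but since these have bounded
second moments the round costs little on average (`setLIntegral_total_le`), and the sum over all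
rounds converges (`lintegral_rounds_le`).
-/

/-! ### Weakest preconditions for the real RAM -/

namespace RealRAM

/-- The state `s` with integer variable `v` set to `x`. -/
def State.setN (s : State) (v x : ℕ) : State := { s with nvar := Function.update s.nvar v x }

/-- The state `s` with real variable `v` set to `x`. -/
def State.setR (s : State) (v : ℕ) (x : ℝ) : State := { s with rvar := Function.update s.rvar v x }

/-- The state `s` with entry `i` of the integer array `a` set to `x`. -/
def State.putN (s : State) (a i x : ℕ) : State :=
  { s with narr := Function.update s.narr a (Function.update (s.narr a) i x) }

/-- The state `s` with entry `i` of the real array `a` set to `x`. -/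
def State.putR (s : State) (a i : ℕ) (x : ℝ) : State :=
  { s with rarr := Function.update s.rarr a (Function.update (s.rarr a) i x) }

section
variable (s : State) (a i v x w : ℕ) (y : ℝ)

@[simp] lemma State.nvar_setN : (s.setN v x).nvar w = if w = v then x else s.nvar w := by
  simp [State.setN, Function.update_apply]
@[simp] lemma State.rvar_setN : (s.setN v x).rvar = s.rvar := rfl
@[simp] lemma State.narr_setN : (s.setN v x).narr = s.narr := rfl
@[simp] lemma State.rarr_setN : (s.setN v x).rarr = s.rarr := rfl
@[simp] lemma State.nvar_setR : (s.setR v y).nvar = s.nvar := rfl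
@[simp] lemma State.rvar_setR : (s.setR v y).rvar w = if w = v then y else s.rvar w := by
  simp [State.setR, Function.update_apply]
@[simp] lemma State.narr_setR : (s.setR v y).narr = s.narr := rfl
@[simp] lemma State.rarr_setR : (s.setR v y).rarr = s.rarr := rfl
@[simp] lemma State.nvar_putN : (s.putN a i x).nvar = s.nvar := rfl
@[simp] lemma State.rvar_putN : (s.putN a i x).rvar = s.rvar := rfl
@[simp] lemma State.narr_putN (b j : ℕ) :
    (s.putN a i x).narr b j = if b = a then (if j = i then x else s.narr b j) else s.narr b j := by
  by_cases h : b = a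
  · subst h; simp [State.putN, Function.update_apply]
  · simp [State.putN, h]
@[simp] lemma State.rarr_putN : (s.putN a i x).rarr = s.rarr := rfl
@[simp] lemma State.nvar_putR : (s.putR a i y).nvar = s.nvar := rfl
@[simp] lemma State.rvar_putR : (s.putR a i y).rvar = s.rvar := rfl
@[simp] lemma State.narr_putR : (s.putR a i y).narr = s.narr := rfl
@[simp] lemma State.rarr_putR (b j : ℕ) :
    (s.putR a i y).rarr b j = if b = a then (if j = i then y else s.rarr b j) else s.rarr b j := by
  by_cases h : b = a
  · subst h; simp [State.putR, Function.update_apply]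
  · simp [State.putR, h]
end

/-- Total correctness with a step count: `p` started in `s` halts, and the final state and the
number of steps satisfy `Q`. -/
def Runs (u : List ℕ → ℝ) (p : Prog) (s : State) (Q : State → ℕ → Prop) : Prop :=
  ∃ s' c, Exec u p s s' c ∧ Q s' c

variable {u : List ℕ → ℝ} {p q : Prog} {s : State} {Q R : State → ℕ → Prop}

lemma Runs.mono (h : Runs u p s Q) (hQ : ∀ s' c, Q s' c → R s' c) : Runs u p s R := by
  obtain ⟨s', c, he, hq⟩ := h
  exact ⟨s', c, he, hQ _ _ hq⟩

/-- This and the following lemmas compute the weakest precondition of each construct. -/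
lemma runs_skip : Runs u .skip s Q ↔ Q s 1 :=
  ⟨fun ⟨_, _, he, hq⟩ => by cases he; exact hq, fun h => ⟨_, _, .skip s, h⟩⟩

lemma runs_setN {v e} : Runs u (.setN v e) s Q ↔ Q (s.setN v (e.eval s)) (e.size + 1) :=
  ⟨fun ⟨_, _, he, hq⟩ => by cases he; exact hq, fun h => ⟨_, _, .setN s v e, h⟩⟩

lemma runs_setR {v e} : Runs u (.setR v e) s Q ↔ Q (s.setR v (e.eval s)) (e.size + 1) :=
  ⟨fun ⟨_, _, he, hq⟩ => by cases he; exact hq, fun h => ⟨_, _, .setR s v e, h⟩⟩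

lemma runs_putN {a i e} : Runs u (.putN a i e) s Q ↔
    Q (s.putN a (i.eval s) (e.eval s)) (i.size + e.size + 1) :=
  ⟨fun ⟨_, _, he, hq⟩ => by cases he; exact hq, fun h => ⟨_, _, .putN s a i e, h⟩⟩

lemma runs_putR {a i e} : Runs u (.putR a i e) s Q ↔
    Q (s.putR a (i.eval s) (e.eval s)) (i.size + e.size + 1) :=
  ⟨fun ⟨_, _, he, hq⟩ => by cases he; exact hq, fun h => ⟨_, _, .putR s a i e, h⟩⟩

lemma runs_hashR {v key} : Runs u (.hashR v key) s Q ↔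
    Q (s.setR v (u (key.map (NExp.eval s)))) (keySize key + 1) :=
  ⟨fun ⟨_, _, he, hq⟩ => by cases he; exact hq, fun h => ⟨_, _, .hashR s v key, h⟩⟩

lemma runs_hashN {v m key} : Runs u (.hashN v m key) s Q ↔
    Q (s.setN v ⌊(m.eval s : ℝ) * u (key.map (NExp.eval s))⌋₊) (m.size + keySize key + 1) :=
  ⟨fun ⟨_, _, he, hq⟩ => by cases he; exact hq, fun h => ⟨_, _, .hashN s v m key, h⟩⟩

lemma runs_seq : Runs u (.seq p q) s Q ↔
    Runs u p s fun s₁ c₁ => Runs u q s₁ fun s₂ c₂ => Q s₂ (c₁ + c₂) := by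
  constructor
  · rintro ⟨_, _, he, hq⟩
    cases he with
    | seq hp hq' => exact ⟨_, _, hp, _, _, hq', hq⟩
  · rintro ⟨_, _, hp, _, _, hq', hq⟩
    exact ⟨_, _, .seq hp hq', hq⟩

lemma runs_ite {b} : Runs u (.ite b p q) s Q ↔
    (b.holds s → Runs u p s fun s' c => Q s' (b.size + 1 + c)) ∧
    (¬ b.holds s → Runs u q s fun s' c => Q s' (b.size + 1 + c)) := by
  constructor
  · rintro ⟨_, _, he, hq⟩
    cases he with
    | iteTrue hb hp => exact ⟨fun _ => ⟨_, _, hp, hq⟩, fun h => absurd hb h⟩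
    | iteFalse hb hp => exact ⟨fun h => absurd h hb, fun _ => ⟨_, _, hp, hq⟩⟩
  · rintro ⟨h₁, h₂⟩
    by_cases hb : b.holds s
    · obtain ⟨_, _, hp, hq⟩ := h₁ hb
      exact ⟨_, _, .iteTrue hb hp, hq⟩
    · obtain ⟨_, _, hp, hq⟩ := h₂ hb
      exact ⟨_, _, .iteFalse hb hp, hq⟩

/-- Loop rule: `I n s` holds after `n` of the `M` iterations, and iteration `n` takes at most
`f n` steps, the test included. -/
lemma runs_loop {b : BExp} (I : ℕ → State → Prop) (f : ℕ → ℕ) (M : ℕ) (h0 : I 0 s)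
    (hstep : ∀ n s', n < M → I n s' → b.holds s' ∧
      Runs u p s' fun s'' c => I (n + 1) s'' ∧ b.size + 1 + c ≤ f n)
    (hend : ∀ s', I M s' → ¬ b.holds s') :
    Runs u (.loop b p) s fun s' c => I M s' ∧ c ≤ (∑ n ∈ Finset.range M, f n) + (b.size + 1) := by
  suffices h : ∀ m n s, n + m = M → I n s → Runs u (.loop b p) s fun s' c =>
      I M s' ∧ c ≤ (∑ i ∈ Finset.Ico n M, f i) + (b.size + 1) by
    simpa using h M 0 s (by simp) h0
  intro m
  induction m with
  | zero =>
    intro n s hn hI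
    obtain rfl : n = M := by simpa using hn
    exact ⟨s, _, .loopFalse (hend s hI), hI, by simp⟩
  | succ m ih =>
    intro n s hn hI
    obtain ⟨hb, s₁, c₁, he₁, hI₁, hc₁⟩ := hstep n s (by omega) hI
    obtain ⟨s₂, c₂, he₂, hI₂, hc₂⟩ := ih (n + 1) s₁ (by omega) hI₁
    refine ⟨s₂, _, .loopTrue hb he₁ he₂, hI₂, ?_⟩
    rw [Finset.sum_eq_sum_Ico_succ_bot (by omega)]
    omega

lemma time_le {c : ℕ} {s' : State} (h : Exec u p s s' c) : time u p s ≤ c :=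
  iInf₂_le c ⟨s', h⟩

end RealRAM

namespace DartMinHash
open RealRAM MinHash

/-! ### Cells and darts -/

section

/-- The address of a cell: a tile of area one of the quadrant of pairs (weight, rank), in the copy
of the quadrant that belongs to the element `elem`. With `D = 2 ^ scale`, one side of the tile is
`[D - 1, 2 * D - 1)` and the other is `[pos / D, (pos + 1) / D)`; the long side is the weight for
a `heavy` tile and the rank otherwise. -/
@[ext] structure Cell where
  elem : ℕ
  heavy : Bool
  scale : ℕ
  pos : ℕ

namespace Cell

/-- The common prefix of the hash keys that belong to the cell. -/
def key (c : Cell) : List ℕ := [c.elem, c.heavy.toNat, c.scale, c.pos]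

/-- The addresses in use: heavy tiles cover the weights `≥ 1`, the others the weights `< 1`. -/
def Valid (c : Cell) : Prop := if c.heavy then 1 ≤ c.scale else c.pos < 2 ^ c.scale

/-- The point of the long side of the tile at relative position `a ∈ [0, 1)`. -/
noncomputable def long (c : Cell) (a : ℝ) : ℝ := 2 ^ c.scale - 1 + 2 ^ c.scale * a

/-- The point of the short side of the tile at relative position `b ∈ [0, 1)`. -/
noncomputable def short (c : Cell) (b : ℝ) : ℝ := (c.pos + b) / 2 ^ c.scale

/-- The weight of the point of the tile with relative positions `a` (long) and `b` (short). -/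
noncomputable def weight (c : Cell) (a b : ℝ) : ℝ := if c.heavy then c.long a else c.short b

/-- The rank of the point of the tile with relative positions `a` (long) and `b` (short). -/
noncomputable def rank (c : Cell) (a b : ℝ) : ℝ := if c.heavy then c.short b else c.long a

end Cell

/-- The darts of one mark: for each cell their number, and the random numbers that place them. -/
abbrev Data : Type := Cell → ℕ × (List ℕ → ℝ)

/-- A candidate dart of a given mark: a cell and an index. -/
abbrev Dart : Type := Cell × ℕ

/-- The weight of a dart. -/
noncomputable def Data.weight (D : Data) (δ : Dart) : ℝ :=
  δ.1.weight ((D δ.1).2 [δ.2, 0]) ((D δ.1).2 [δ.2, 1])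

/-- The rank of a dart. -/
noncomputable def Data.rank (D : Data) (δ : Dart) : ℝ :=
  δ.1.rank ((D δ.1).2 [δ.2, 0]) ((D δ.1).2 [δ.2, 1])

/-- The darts that are present, in a cell in use, and light enough for the weights `X`. -/
def Data.darts (D : Data) (X : ℕ → ℝ) : Set Dart :=
  {δ | δ.1.Valid ∧ δ.2 < (D δ.1).1 ∧ D.weight δ < X δ.1.elem}

/-- The tuple of integers that identifies a dart among those of its mark. -/
def Dart.id (δ : Dart) : Fin 5 → ℕ :=
  ![δ.1.elem, δ.1.heavy.toNat, δ.1.scale, δ.1.pos, δ.2]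

/-- The quantile function of the Poisson distribution of mean one, on `[0, 1)`. -/
noncomputable def poissonQuantile (a : ℝ) : ℕ :=
  sInf {n : ℕ | a < ∑ i ∈ Finset.range (n + 1), Real.exp (-1) / (i.factorial : ℝ)}

/-- The number of darts in a cell, over all marks. -/
noncomputable def total (u : List ℕ → ℝ) (c : Cell) : ℕ := poissonQuantile (u (c.key ++ [0]))

/-- The mark of dart number `l` of a cell. -/
noncomputable def mark (u : List ℕ → ℝ) (k : ℕ) (c : Cell) (l : ℕ) : ℕ :=
  ⌊(k : ℝ) * u (c.key ++ [0, l])⌋₊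

/-- The number of darts of mark `j` among the first `n` darts of a cell. -/
noncomputable def count (u : List ℕ → ℝ) (k : ℕ) (c : Cell) (j n : ℕ) : ℕ :=
  ((Finset.range n).filter fun l => mark u k c l = j).card

/-- The darts of mark `j`. They are placed by numbers whose keys hold the index of the dart among
the darts of mark `j` in its cell, so that the darts of different marks are independent. -/
noncomputable def dataOf (u : List ℕ → ℝ) (k j : ℕ) : Data := fun c =>
  (count u k c j (total u c), fun l => u (c.key ++ (j + 1) :: l))

lemma count_succ (u : List ℕ → ℝ) (k : ℕ) (c : Cell) (j n : ℕ) :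
    count u k c j (n + 1) = count u k c j n + if mark u k c n = j then 1 else 0 := by
  unfold count
  rw [Finset.range_add_one, Finset.filter_insert]
  split_ifs <;> simp

lemma sum_exp_div_factorial_tendsto :
    Filter.Tendsto (fun n : ℕ => ∑ i ∈ Finset.range (n + 1), Real.exp (-1) / (i.factorial : ℝ))
      Filter.atTop (nhds 1) := by
  have h := hasSum_one_poissonMeasure 1
  simp only [NNReal.coe_one, one_pow, mul_one] at h
  exact h.tendsto_sum_nat.comp (Filter.tendsto_add_atTop_nat 1)

lemma exists_lt_sum {a : ℝ} (ha : a < 1) :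
    ∃ n : ℕ, a < ∑ i ∈ Finset.range (n + 1), Real.exp (-1) / (i.factorial : ℝ) :=
  (sum_exp_div_factorial_tendsto.eventually_const_lt ha).exists

lemma lt_sum_poissonQuantile {a : ℝ} (ha : a < 1) :
    a < ∑ i ∈ Finset.range (poissonQuantile a + 1), Real.exp (-1) / (i.factorial : ℝ) :=
  Nat.sInf_mem (exists_lt_sum ha)

lemma sum_le_of_lt_poissonQuantile {a : ℝ} {n : ℕ} (hn : n < poissonQuantile a) :
    ∑ i ∈ Finset.range (n + 1), Real.exp (-1) / (i.factorial : ℝ) ≤ a :=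
  not_lt.1 (Nat.notMem_of_lt_sInf hn)

/-- `v` is the least rank among the darts `A`, capped at `t`, and if the cap is not reached then
`o` identifies a dart of that rank. -/
def IsBest (D : Data) (t : ℝ) (A : Set Dart) (v : ℝ) (o : Fin 5 → ℕ) : Prop :=
  v ≤ t ∧ (∀ δ ∈ A, v ≤ D.rank δ) ∧
    (v = t ∨ ∃ δ ∈ A, v = D.rank δ ∧ v < t ∧ o = Dart.id δ)

lemma isBest_empty (D : Data) (t : ℝ) (o) : IsBest D t ∅ t o := by simp [IsBest]

lemma IsBest.insert_lt {D : Data} {t v : ℝ} {A : Set Dart} {o} (h : IsBest D t A v o) {δ : Dart}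
    (hδ : D.rank δ < v) : IsBest D t (insert δ A) (D.rank δ) (Dart.id δ) := by
  refine ⟨hδ.le.trans h.1, ?_, .inr ⟨δ, by simp, rfl, hδ.trans_le h.1, rfl⟩⟩
  rintro δ' (rfl | h')
  · exact le_rfl
  · exact hδ.le.trans (h.2.1 _ h')

lemma IsBest.insert_le {D : Data} {t v : ℝ} {A : Set Dart} {o} (h : IsBest D t A v o) {δ : Dart}
    (hδ : v ≤ D.rank δ) : IsBest D t (insert δ A) v o := by
  refine ⟨h.1, ?_, h.2.2.imp_right fun ⟨δ', h', h''⟩ => ⟨δ', .inr h', h''⟩⟩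
  rintro δ' (rfl | h')
  · exact hδ
  · exact h.2.1 _ h'

/-! ### The program -/

/-! Use of the memory.

* Integer variables: 0 holds `k`, 1 the number of elements of the input, 2 a flag, 3 a loop counter,
  4 to 7 the current cell, 8 its serial number, 9 the number of its darts, 10 the number of the
  current dart, 11 its mark, 12 its index among the darts of that mark in the cell.
* Real variables: 0 holds the sum of the weights, 1 the scale factor, 2 the limit for the ranks,
  3 the scaled weight of the current element, 4 and 5 the limits for the long and the short side of
  the cells, 6 the power `2 ^ scale`, 7 to 9 the state of the Poisson generator, 10 and 11 the weight
  and the rank of the current dart.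
* Arrays: those number 0 hold the input, the integer arrays 1 to 5 the output, the real array 1 the
  best ranks, and the integer arrays 6 and 7 the counters of the marks. -/

/-- Expands to the key of the current cell followed by `l`. -/
def cellKey (l : List NExp) : List NExp := .var 4 :: .var 5 :: .var 6 :: .var 7 :: l

/-- Sequential composition of a list of programs. -/
def block : List Prog → Prog
  | [] => .skip
  | [p] => p
  | p :: ps => .seq p (block ps)

/-- Draws the number of darts of the current cell into the integer variable 9, by inversion of
the Poisson distribution function. -/
def poissonProg : Prog := block [
  .setN 9 (.const 0),
  .hashR 7 (cellKey [.const 0]),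
  .setR 9 (.exp (.const (-1))),
  .setR 8 (.var 9),
  .loop (.leR (.var 8) (.var 7)) <| block [
    .setN 9 (.add (.var 9) (.const 1)),
    .setR 9 (.div (.var 9) (.ofNat (.var 9))),
    .setR 8 (.add (.var 8) (.var 9))]]

/-- Draws the mark of the current dart into the integer variable 11 and its index among the darts
of that mark into 12, and updates the counters. The counter of mark `j`, entry `j` of the integer
array 6, is up to date if entry `j` of the integer array 7 is the serial number of the current
cell, and counts as zero otherwise. -/
def markProg : Prog := block [
  .hashN 11 (.var 0) (cellKey [.const 0, .var 10]),
  .ite (.leN (.var 8) (.get 7 (.var 11)))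
    (.setN 12 (.get 6 (.var 11))) (.setN 12 (.const 0)),
  .putN 6 (.var 11) (.add (.var 12) (.const 1)),
  .putN 7 (.var 11) (.var 8)]

/-- Computes the weight and the rank of the current dart into the real variables 10 and 11. -/
def placeProg : Prog := block [
  .hashR 10 (cellKey [.add (.var 11) (.const 1), .var 12, .const 0]),
  .hashR 11 (cellKey [.add (.var 11) (.const 1), .var 12, .const 1]),
  .setR 10 (.add (.sub (.var 6) (.const 1)) (.mul (.var 6) (.var 10))),
  .setR 11 (.div (.add (.ofNat (.var 7)) (.var 11)) (.var 6)),
  .ite (.leN (.const 1) (.var 5)) .skip <| block [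
    .setR 12 (.var 10),
    .setR 10 (.var 11),
    .setR 11 (.var 12)]]

/-- Records the current dart if its weight is below the weight of the current element, in the real
variable 3, and its rank improves on the best rank of its mark, in the real array 1. -/
def recordProg : Prog :=
  .ite (.and (.not (.leR (.var 3) (.var 10))) (.not (.leR (.get 1 (.var 11)) (.var 11))))
    (block [
      .putR 1 (.var 11) (.var 11),
      .putN 1 (.var 11) (.var 4),
      .putN 2 (.var 11) (.var 5),
      .putN 3 (.var 11) (.var 6),
      .putN 4 (.var 11) (.var 7),
      .putN 5 (.var 11) (.var 12)])
    .skip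

/-- Processes the darts of the current cell. -/
def cellProg : Prog := block [
  .setN 8 (.add (.var 8) (.const 1)),
  poissonProg,
  .setN 10 (.const 0),
  .loop (.not (.leN (.var 9) (.var 10))) <| block [
    markProg, placeProg, recordProg,
    .setN 10 (.add (.var 10) (.const 1))]]

/-! ### Correctness and cost of the program -/

/-- `s'` agrees with `s` on the input arrays, on the integer variables below `N` and on the real
variables below `R`. -/
def Keeps (N R : ℕ) (s s' : State) : Prop :=
  (∀ v < N, s'.nvar v = s.nvar v) ∧ (∀ v < R, s'.rvar v = s.rvar v) ∧
    s'.narr 0 = s.narr 0 ∧ s'.rarr 0 = s.rarr 0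

lemma Keeps.refl (N R : ℕ) (s : State) : Keeps N R s s := by simp [Keeps]

lemma Keeps.trans {N R : ℕ} {s₁ s₂ s₃ : State} (h : Keeps N R s₁ s₂) (h' : Keeps N R s₂ s₃) :
    Keeps N R s₁ s₃ :=
  ⟨fun v hv => (h'.1 v hv).trans (h.1 v hv), fun v hv => (h'.2.1 v hv).trans (h.2.1 v hv),
    h'.2.2.1.trans h.2.2.1, h'.2.2.2.trans h.2.2.2⟩

lemma Keeps.mono {N R N' R' : ℕ} {s s' : State} (h : Keeps N R s s') (hN : N' ≤ N) (hR : R' ≤ R) :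
    Keeps N' R' s s' :=
  ⟨fun v hv => h.1 v (by omega), fun v hv => h.2.1 v (by omega), h.2.2⟩

lemma keeps_setN {N R : ℕ} {s : State} {v x : ℕ} (hv : N ≤ v) : Keeps N R s (s.setN v x) :=
  ⟨fun w hw => by simp [show w ≠ v by omega], by simp, rfl, rfl⟩

lemma keeps_setR {N R : ℕ} {s : State} {v : ℕ} {x : ℝ} (hv : R ≤ v) : Keeps N R s (s.setR v x) :=
  ⟨by simp, fun w hw => by simp [show w ≠ v by omega], rfl, rfl⟩

lemma keeps_putN {N R : ℕ} {s : State} {a i x : ℕ} (ha : a ≠ 0) : Keeps N R s (s.putN a i x) :=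
  ⟨by simp, by simp, by ext; simp [ha.symm], rfl⟩

lemma keeps_putR {N R : ℕ} {s : State} {a i : ℕ} {x : ℝ} (ha : a ≠ 0) :
    Keeps N R s (s.putR a i x) :=
  ⟨by simp, by simp, rfl, by ext; simp [ha.symm]⟩

/-- The output tuple for mark `j`. -/
def out (s : State) (j : ℕ) : Fin 5 → ℕ := fun a => s.narr (a + 1) j

/-- The variables hold the number `k` of marks, the cell `c`, and the weight limit `x`. -/
structure AtCell (k : ℕ) (c : Cell) (x : ℝ) (s : State) : Prop where
  k_eq : s.nvar 0 = k
  elem : s.nvar 4 = c.elem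
  heavy : s.nvar 5 = c.heavy.toNat
  scale : s.nvar 6 = c.scale
  pos : s.nvar 7 = c.pos
  limit : s.rvar 3 = x
  size : s.rvar 6 = 2 ^ c.scale

lemma AtCell.keeps {k c x s s'} (h : AtCell k c x s) (hs : Keeps 8 7 s s') : AtCell k c x s' where
  k_eq := (hs.1 0 (by omega)).trans h.k_eq
  elem := (hs.1 4 (by omega)).trans h.elem
  heavy := (hs.1 5 (by omega)).trans h.heavy
  scale := (hs.1 6 (by omega)).trans h.scale
  pos := (hs.1 7 (by omega)).trans h.pos
  limit := (hs.2.1 3 (by omega)).trans h.limit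
  size := (hs.2.1 6 (by omega)).trans h.size

lemma AtCell.map_cellKey {k c x s} (h : AtCell k c x s) (l : List NExp) :
    (cellKey l).map (NExp.eval s) = c.key ++ l.map (NExp.eval s) := by
  simp [cellKey, Cell.key, NExp.eval, h.elem, h.heavy, h.scale, h.pos]

lemma keySize_cellKey (l : List NExp) : keySize (cellKey l) = 4 + keySize l := by
  simp [cellKey, keySize, NExp.size]; omega

variable {u : List ℕ → ℝ}

lemma runs_poissonProg {k c x s} (hu : ∀ key, u key < 1) (h : AtCell k c x s) :
    Runs u poissonProg s fun s' cost => Keeps 9 7 s s' ∧ s'.nvar 9 = total u c ∧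
      s'.narr = s.narr ∧ s'.rarr = s.rarr ∧ cost ≤ 30 + 20 * total u c := by
  simp only [poissonProg, block, runs_seq, runs_setN, runs_hashR, runs_setR,
    (h.keeps (keeps_setN (by omega : 8 ≤ 9))).map_cellKey, keySize_cellKey]
  refine (runs_loop (fun n s' => Keeps 9 7 s s' ∧ s'.nvar 9 = n ∧ s'.narr = s.narr ∧
    s'.rarr = s.rarr ∧ s'.rvar 7 = u (c.key ++ [0]) ∧
    s'.rvar 9 = Real.exp (-1) / (n.factorial : ℝ) ∧
    s'.rvar 8 = ∑ i ∈ Finset.range (n + 1), Real.exp (-1) / (i.factorial : ℝ)) (fun _ => 20)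
    (total u c) ?_ ?_ ?_).mono ?_
  · refine ⟨?_, ?_⟩
    · exact (keeps_setN (by omega)).trans <| (keeps_setR (by omega)).trans <|
        (keeps_setR (by omega)).trans (keeps_setR (by omega))
    · simp [NExp.eval, RExp.eval]
  · rintro n s' hn ⟨hk, h9, hn1, hr1, h7, h9', h8⟩
    refine ⟨?_, ?_⟩
    · simp only [BExp.holds, RExp.eval, h8, h7]
      exact sum_le_of_lt_poissonQuantile hn
    · simp only [runs_seq, runs_setN, runs_setR]
      refine ⟨⟨?_, ?_⟩, ?_⟩
      · exact hk.trans <| (keeps_setN (by omega)).trans <| (keeps_setR (by omega)).trans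
          (keeps_setR (by omega))
      · simp only [State.nvar_setR, State.nvar_setN, State.rvar_setR, State.rvar_setN,
          State.narr_setR, State.narr_setN, State.rarr_setR, State.rarr_setN, NExp.eval, RExp.eval,
          h9, hn1, hr1, h7, h9', h8]
        norm_num
        rw [Finset.sum_range_succ _ (n + 1), Nat.factorial_succ]
        push_cast
        have : (n.factorial : ℝ) ≠ 0 := by positivity
        constructor <;> field_simp
      · simp [BExp.size, NExp.size, RExp.size]
  · rintro s' ⟨-, -, -, -, h7, -, h8⟩
    simp only [BExp.holds, RExp.eval, h8, h7, not_le]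
    exact lt_sum_poissonQuantile (hu _)
  · rintro s' cost ⟨⟨hk, h9, hn1, hr1, -⟩, hc⟩
    refine ⟨hk, h9, hn1, hr1, ?_⟩
    simp [keySize, NExp.size, RExp.size, BExp.size] at hc ⊢
    omega

end

section
variable {u : List ℕ → ℝ}

/-- The counters hold the numbers of darts of each mark among the first `n` darts of `c`. -/
def Counters (u : List ℕ → ℝ) (k : ℕ) (c : Cell) (n : ℕ) (s : State) : Prop :=
  (∀ j, s.narr 7 j ≤ s.nvar 8) ∧
    ∀ j, (if s.narr 7 j = s.nvar 8 then s.narr 6 j else 0) = count u k c j n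

lemma runs_markProg {k c x s n} (h : AtCell k c x s) (hn : s.nvar 10 = n)
    (hc : Counters u k c n s) :
    Runs u markProg s fun s' cost => Keeps 11 10 s s' ∧ s'.nvar 11 = mark u k c n ∧
      s'.nvar 12 = count u k c (mark u k c n) n ∧ Counters u k c (n + 1) s' ∧
      (∀ j, out s' j = out s j) ∧ s'.rarr = s.rarr ∧ cost ≤ 40 := by
  obtain ⟨hc1, hc2⟩ := hc
  simp only [markProg, block, runs_seq, runs_setN, runs_hashN, runs_putN, runs_ite, h.map_cellKey,
    keySize_cellKey]
  have key : ∀ (s₁ : State) (a : ℕ), s₁ = s.setN 11 (mark u k c n) →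
      a = count u k c (mark u k c n) n → ∀ cost ≤ 40,
      let s' := ((s₁.setN 12 a).putN 6 (mark u k c n) (a + 1)).putN 7 (mark u k c n) (s.nvar 8)
      Keeps 11 10 s s' ∧ s'.nvar 11 = mark u k c n ∧
      s'.nvar 12 = count u k c (mark u k c n) n ∧ Counters u k c (n + 1) s' ∧
      (∀ j, out s' j = out s j) ∧ s'.rarr = s.rarr ∧ cost ≤ 40 := by
    rintro _ _ rfl rfl cost hcost
    refine ⟨?_, by simp, by simp, ⟨?_, ?_⟩, ?_, by simp, hcost⟩
    · exact (keeps_setN (by omega)).trans <| (keeps_setN (by omega)).trans <|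
        (keeps_putN (by omega)).trans (keeps_putN (by omega))
    · intro j
      have := hc1 j
      by_cases hj : j = mark u k c n <;> simp [hj, this]
    · intro j
      have := hc2 j
      rw [count_succ]
      by_cases hj : j = mark u k c n
      · simp [hj]
      · simp [hj, this, Ne.symm hj]
    · intro j
      ext a
      have : (a : ℕ) < 5 := a.2
      simp [out, show (a : ℕ) ≠ 6 by omega, show (a : ℕ) ≠ 5 by omega]
  have e1 : ⌊((NExp.var 0).eval s : ℝ) * u (c.key ++ [NExp.const 0, NExp.var 10].map (NExp.eval s))⌋₊
      = mark u k c n := by simp [mark, NExp.eval, h.k_eq, hn]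
  rw [e1]
  constructor <;> intro hb
  · simp [BExp.holds, NExp.eval] at hb
    have hb' : s.narr 7 (mark u k c n) = s.nvar 8 := le_antisymm (hc1 _) hb
    have := hc2 (mark u k c n)
    rw [if_pos hb'] at this
    have := key _ _ rfl this (23 + 15) (by norm_num)
    simpa [NExp.eval, NExp.size, keySize, BExp.size] using this
  · simp [BExp.holds, NExp.eval] at hb
    have := hc2 (mark u k c n)
    rw [if_neg (by omega)] at this
    have := key _ _ rfl this (22 + 15) (by norm_num)
    simpa [NExp.eval, NExp.size, keySize, BExp.size] using this

lemma runs_placeProg {k c x s j m} (h : AtCell k c x s) (hj : s.nvar 11 = j) (hm : s.nvar 12 = m) :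
    Runs u placeProg s fun s' cost => Keeps 13 10 s s' ∧
      s'.rvar 10 = (dataOf u k j).weight (c, m) ∧ s'.rvar 11 = (dataOf u k j).rank (c, m) ∧
      s'.narr = s.narr ∧ s'.nvar = s.nvar ∧ s'.rarr = s.rarr ∧ cost ≤ 70 := by
  have hk : ∀ (s' : State), s'.nvar = s.nvar → ∀ (l : List NExp),
      (cellKey l).map (NExp.eval s') = c.key ++ l.map (NExp.eval s') := by
    intro s' hs l
    simp [cellKey, Cell.key, NExp.eval, h.elem, h.heavy, h.scale, h.pos, hs]
  simp only [placeProg, block, runs_seq, runs_setR, runs_hashR, runs_ite, runs_skip,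
    keySize_cellKey]
  rw [hk s rfl, hk _ (by simp)]
  have hsz := h.size
  have hps := h.pos
  have hhv := h.heavy
  constructor <;> intro hb
  · have hb' : c.heavy = true := by
      simp [BExp.holds, NExp.eval, hhv] at hb
      cases hc : c.heavy <;> simp_all
    refine ⟨(keeps_setR (by omega)).trans <| (keeps_setR (by omega)).trans <|
        (keeps_setR (by omega)).trans (keeps_setR (by omega)), ?_⟩
    simp [NExp.eval, RExp.eval, hj, hm, hsz, hps, Data.weight, Data.rank, dataOf, Cell.weight,
      Cell.rank, Cell.long, Cell.short, hb', keySize, NExp.size, RExp.size, BExp.size]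
  · have hb' : c.heavy = false := by
      simp [BExp.holds, NExp.eval, hhv] at hb
      cases hc : c.heavy <;> simp_all
    refine ⟨(keeps_setR (by omega)).trans <| (keeps_setR (by omega)).trans <|
        (keeps_setR (by omega)).trans <| (keeps_setR (by omega)).trans <|
        (keeps_setR (by omega)).trans <| (keeps_setR (by omega)).trans <|
        (keeps_setR (by omega)), ?_⟩
    simp [NExp.eval, RExp.eval, hj, hm, hsz, hps, Data.weight, Data.rank, dataOf, Cell.weight,
      Cell.rank, Cell.long, Cell.short, hb', keySize, NExp.size, RExp.size, BExp.size]

/-- For every mark, the best dart among the processed darts `A` is recorded. -/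
def Recorded (u : List ℕ → ℝ) (k : ℕ) (t : ℝ) (A : ℕ → Set Dart) (s : State) : Prop :=
  ∀ j < k, IsBest (dataOf u k j) t (A j) (s.rarr 1 j) (out s j)

lemma Recorded.congr {k t A B s s'} (h : Recorded u k t A s) (hAB : ∀ j < k, A j = B j)
    (hout : ∀ j, out s' j = out s j) (hr : s'.rarr = s.rarr) : Recorded u k t B s' := by
  intro j hj
  rw [hr, hout, ← hAB j hj]
  exact h j hj

lemma runs_recordProg {k c x t A s j m} (h : AtCell k c x s) (hj : s.nvar 11 = j)
    (hm : s.nvar 12 = m) (hw : s.rvar 10 = (dataOf u k j).weight (c, m))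
    (hr : s.rvar 11 = (dataOf u k j).rank (c, m)) (hA : Recorded u k t A s) :
    Runs u recordProg s fun s' cost => Keeps 13 10 s s' ∧
      Recorded u k t (fun i => A i ∪ {δ | i = j ∧ δ = (c, m) ∧ (dataOf u k i).weight δ < x}) s' ∧
      s'.narr 6 = s.narr 6 ∧ s'.narr 7 = s.narr 7 ∧ s'.nvar = s.nvar ∧ cost ≤ 40 := by
  have hout : out ((((((s.putR 1 j (s.rvar 11)).putN 1 j (s.nvar 4)).putN 2 j (s.nvar 5)).putN 3 j
      (s.nvar 6)).putN 4 j (s.nvar 7)).putN 5 j (s.nvar 12)) j = Dart.id (c, m) := by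
    ext a
    fin_cases a <;> simp [out, Dart.id, h.elem, h.heavy, h.scale, h.pos, hm]
  simp only [recordProg, block, runs_seq, runs_putN, runs_putR, runs_ite, runs_skip]
  constructor <;> intro hb
  · simp only [BExp.holds, RExp.eval, NExp.eval, h.limit, hj, hw, not_le] at hb
    refine ⟨?_, ?_, ?_, ?_, ?_, ?_⟩
    · exact (keeps_putR (by omega)).trans <| (keeps_putN (by omega)).trans <|
        (keeps_putN (by omega)).trans <| (keeps_putN (by omega)).trans <|
        (keeps_putN (by omega)).trans (keeps_putN (by omega))
    · intro i hi
      by_cases hij : i = j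
      · subst hij
        have := (hA i hi).insert_lt (δ := (c, m)) (hr ▸ hb.2)
        rw [← hout, ← hr] at this
        convert this using 1
        · ext δ; simp only [Set.mem_union, Set.mem_ofPred_eq, Set.mem_insert_iff, true_and]
          constructor
          · rintro (h | h)
            exacts [.inr h, .inl h.1]
          · rintro (rfl | h)
            exacts [.inr ⟨rfl, hb.1⟩, .inl h]
        · simp [NExp.eval, RExp.eval, hj]
        · simp [NExp.eval, RExp.eval, hj]
      · have := hA i hi
        convert this using 1
        · simp [hij]
        · simp [NExp.eval, hj, hij]
        · ext a; simp [out, NExp.eval, hj, hij]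
    · ext; simp
    · ext; simp
    · simp
    · simp [NExp.size, RExp.size, BExp.size]
  · refine ⟨.refl _ _ _, ?_, by simp, by simp, by simp, by simp [NExp.size, RExp.size, BExp.size]⟩
    simp only [BExp.holds, RExp.eval, NExp.eval, h.limit, hj, hw, hr, not_le, not_and, not_lt] at hb
    intro i hi
    by_cases hij : i = j
    · subst hij
      by_cases hx : (dataOf u k i).weight (c, m) < x
      · have := (hA i hi).insert_le (δ := (c, m)) (hb hx)
        convert this using 1
        ext δ; simp only [Set.mem_union, Set.mem_ofPred_eq, Set.mem_insert_iff, true_and]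
        constructor
        · rintro (h | h)
          exacts [.inr h, .inl h.1]
        · rintro (rfl | h)
          exacts [.inr ⟨rfl, hx⟩, .inl h]
      · convert hA i hi using 1
        ext δ; simp only [Set.mem_union, Set.mem_ofPred_eq, true_and]
        constructor
        · rintro (h | ⟨rfl, h⟩)
          exacts [h, absurd h hx]
        · exact .inl
    · convert hA i hi using 1
      simp [hij]

/-- The darts of mark `j` among the first `n` darts of the cell `c`, if lighter than `x`. -/
def cellDarts (u : List ℕ → ℝ) (k : ℕ) (x : ℝ) (c : Cell) (n j : ℕ) : Set Dart :=
  {δ | δ.1 = c ∧ δ.2 < count u k c j n ∧ (dataOf u k j).weight δ < x}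

lemma cellDarts_succ (u : List ℕ → ℝ) (k : ℕ) (x : ℝ) (c : Cell) (n i : ℕ) :
    cellDarts u k x c (n + 1) i = cellDarts u k x c n i ∪
      {δ | i = mark u k c n ∧ δ = (c, count u k c (mark u k c n) n) ∧
        (dataOf u k i).weight δ < x} := by
  ext ⟨c', m⟩
  simp only [cellDarts, count_succ, Set.mem_union, Set.mem_ofPred_eq, Prod.mk.injEq]
  by_cases hi : mark u k c n = i
  · rw [if_pos hi, hi]
    constructor
    · rintro ⟨h1, h2, h3⟩
      rcases Nat.lt_succ_iff_lt_or_eq.1 h2 with h | h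
      · exact .inl ⟨h1, h, h3⟩
      · exact .inr ⟨rfl, ⟨h1, h⟩, h3⟩
    · rintro (⟨h1, h2, h3⟩ | ⟨-, ⟨h1, h2⟩, h3⟩)
      exacts [⟨h1, by omega, h3⟩, ⟨h1, by omega, h3⟩]
  · simp [hi, Ne.symm hi]

/-- The cap on the serial numbers in the hypothesis makes the counters of all marks count as zero for
the new cell, without any step spent on resetting them. -/
lemma runs_cellProg {k c x t A s} (hu : ∀ key, u key < 1) (h : AtCell k c x s)
    (hstamp : ∀ j, s.narr 7 j ≤ s.nvar 8) (hA : Recorded u k t A s) :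
    Runs u cellProg s fun s' cost => Keeps 8 7 s s' ∧ (∀ j, s'.narr 7 j ≤ s'.nvar 8) ∧
      Recorded u k t (fun j => A j ∪ cellDarts u k x c (total u c) j) s' ∧
      cost ≤ 200 * (1 + total u c) := by
  simp only [cellProg, block, runs_seq, runs_setN]
  have h1 : Keeps 8 7 s (s.setN 8 ((NExp.var 8).add (.const 1) |>.eval s)) := keeps_setN (by omega)
  refine (runs_poissonProg hu (h.keeps h1)).mono ?_
  rintro s₁ c₁ ⟨hk1, hN, hn1, hr1, hc1⟩
  refine (runs_loop (fun n s' => Keeps 10 7 s₁ s' ∧ s'.nvar 10 = n ∧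
    Counters u k c n s' ∧ Recorded u k t (fun j => A j ∪ cellDarts u k x c n j) s')
    (fun _ => 160) (total u c) ?_ ?_ ?_).mono ?_
  · refine ⟨keeps_setN (by omega), by simp [NExp.eval], ⟨?_, ?_⟩, ?_⟩
    · intro j
      have := hstamp j
      simp [hn1, hk1.1 8, NExp.eval]; omega
    · intro j
      have := hstamp j
      simp [hn1, hk1.1 8, NExp.eval, count]; omega
    · refine hA.congr (by simp [cellDarts, count]) ?_ (by simp [hr1])
      intro j; ext a; simp [out, hn1]
  · rintro n s₂ hn ⟨hk2, h10, hct, hA2⟩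
    have hat : AtCell k c x s₂ := h.keeps <| h1.trans <| (hk1.mono (by omega) (by omega)).trans
      (hk2.mono (by omega) (by omega))
    refine ⟨?_, ?_⟩
    · simp [BExp.holds, NExp.eval, h10, hk2.1 9, hN, hn]
    simp only [runs_seq, runs_setN]
    refine (runs_markProg hat h10 hct).mono ?_
    rintro s₃ c₃ ⟨hk3, h11, h12, hct3, ho3, hr3, hc3⟩
    have hat3 := hat.keeps (hk3.mono (by omega) (by omega))
    refine (runs_placeProg hat3 h11 h12).mono ?_
    rintro s₄ c₄ ⟨hk4, hw4, hr4, hn4, hv4, hr4', hc4⟩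
    refine (runs_recordProg (hat3.keeps (hk4.mono (by omega) (by omega))) (hv4 ▸ h11) (hv4 ▸ h12)
      hw4 hr4 (hA2.congr (fun _ _ => rfl) ?_ (hr4'.trans hr3))).mono ?_
    · intro j
      rw [← ho3]; ext a; simp [out, hn4]
    rintro s₅ c₅ ⟨hk5, hA5, h65, h75, hv5, hc5⟩
    refine ⟨⟨?_, ?_, ?_, ?_⟩, ?_⟩
    · exact hk2.trans <| (hk3.mono (by omega) (by omega)).trans <|
        (hk4.mono (by omega) (by omega)).trans <| (hk5.mono (by omega) (by omega)).trans <|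
        keeps_setN (by omega)
    · have e3 := hk3.1 10 (by omega)
      simp [NExp.eval, hv5, hv4, e3, h10]
    · obtain ⟨ha, hb⟩ := hct3
      constructor
      · simpa [NExp.eval, h75, hn4, hv5, hv4] using ha
      · simpa [NExp.eval, h75, h65, hn4, hv5, hv4] using hb
    · refine hA5.congr ?_ (fun j => by ext a; simp [out]) (by simp)
      intro j _
      rw [cellDarts_succ, Set.union_assoc]
    · simp [NExp.size, BExp.size] at *
      omega
  · rintro s₂ ⟨hk2, h10, -⟩
    simp [BExp.holds, NExp.eval, h10, hk2.1 9, hN]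
  · rintro s₂ c₂ ⟨⟨hk2, -, hct, hA2⟩, hc2⟩
    refine ⟨h1.trans <| (hk1.mono (by omega) (by omega)).trans (hk2.mono (by omega) (by omega)),
      hct.1, hA2, ?_⟩
    simp [NExp.size, BExp.size] at *
    omega

end

section
variable {u : List ℕ → ℝ}

/-- The darts of mark `j` in the cells `S` that are light enough for the weights `X`. -/
def dartsIn (u : List ℕ → ℝ) (k : ℕ) (X : ℕ → ℝ) (S : Set Cell) (j : ℕ) : Set Dart :=
  {δ | δ.1 ∈ S ∧ δ.2 < (dataOf u k j δ.1).1 ∧ (dataOf u k j).weight δ < X δ.1.elem}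

lemma runs_cellProg_dartsIn {k c X t S s} (hu : ∀ key, u key < 1) (h : AtCell k c (X c.elem) s)
    (hstamp : ∀ j, s.narr 7 j ≤ s.nvar 8) (hA : Recorded u k t (dartsIn u k X S) s) :
    Runs u cellProg s fun s' cost => Keeps 8 7 s s' ∧ (∀ j, s'.narr 7 j ≤ s'.nvar 8) ∧
      Recorded u k t (dartsIn u k X (insert c S)) s' ∧ cost ≤ 200 * (1 + total u c) := by
  refine (runs_cellProg hu h hstamp hA).mono fun s' cost ⟨h1, h2, h3, h4⟩ => ⟨h1, h2, ?_, h4⟩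
  refine h3.congr (fun j _ => ?_) (fun _ => rfl) rfl
  ext ⟨c', m⟩
  simp only [dartsIn, cellDarts, Set.mem_union, Set.mem_ofPred_eq, Set.mem_insert_iff, dataOf]
  constructor
  · rintro (⟨h1, h2, h3⟩ | ⟨rfl, h2, h3⟩)
    exacts [⟨.inr h1, h2, h3⟩, ⟨.inl rfl, h2, h3⟩]
  · rintro ⟨rfl | h1, h2, h3⟩
    exacts [.inr ⟨rfl, h2, h3⟩, .inl ⟨h1, h2, h3⟩]

/-- Processes the cells of the current element, type and scale, up to the limit in the real
variable 5 for the short side. -/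
def bandProg : Prog := block [
  .setN 7 (.const 0),
  .loop (.not (.leR (.var 5) (.div (.ofNat (.var 7)) (.var 6)))) <| block [
    cellProg,
    .setN 7 (.add (.var 7) (.const 1))]]

/-- Processes the scales of the current element and type, up to the limit in the real variable 4
for the long side. -/
def bandsProg : Prog :=
  .loop (.not (.leR (.var 4) (.sub (.var 6) (.const 1)))) <| block [
    bandProg,
    .setR 6 (.add (.var 6) (.var 6)),
    .setN 6 (.add (.var 6) (.const 1))]

/-- The integer variables hold an element, a type and a scale. -/
structure AtBand (k i : ℕ) (h : Bool) (b : ℕ) (x l : ℝ) (s : State) : Prop where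
  k_eq : s.nvar 0 = k
  elem : s.nvar 4 = i
  heavy : s.nvar 5 = h.toNat
  scale : s.nvar 6 = b
  limit : s.rvar 3 = x
  inner : s.rvar 5 = l
  size : s.rvar 6 = 2 ^ b
  stamp : ∀ j, s.narr 7 j ≤ s.nvar 8

lemma AtBand.keeps {k i h b x l s s'} (hb : AtBand k i h b x l s) (hs : Keeps 7 7 s s')
    (hst : ∀ j, s'.narr 7 j ≤ s'.nvar 8) : AtBand k i h b x l s' where
  k_eq := (hs.1 0 (by omega)).trans hb.k_eq
  elem := (hs.1 4 (by omega)).trans hb.elem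
  heavy := (hs.1 5 (by omega)).trans hb.heavy
  scale := (hs.1 6 (by omega)).trans hb.scale
  limit := (hs.2.1 3 (by omega)).trans hb.limit
  inner := (hs.2.1 5 (by omega)).trans hb.inner
  size := (hs.2.1 6 (by omega)).trans hb.size
  stamp := hst

/-- The cost of the cells of one scale, up to a constant factor. -/
noncomputable def bandCost (u : List ℕ → ℝ) (i : ℕ) (h : Bool) (l : ℝ) (b : ℕ) : ℕ :=
  1 + ∑ q ∈ Finset.range ⌈l * 2 ^ b⌉₊, (1 + total u ⟨i, h, b, q⟩)

lemma lt_ceil_mul_iff {l : ℝ} {b q : ℕ} : q < ⌈l * 2 ^ b⌉₊ ↔ (q : ℝ) / 2 ^ b < l := by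
  rw [Nat.lt_ceil, div_lt_iff₀ (by positivity)]

lemma runs_bandProg {k i h b X l t S s} (hu : ∀ key, u key < 1)
    (hs : AtBand k i h b (X i) l s) (hA : Recorded u k t (dartsIn u k X S) s) :
    Runs u bandProg s fun s' cost => Keeps 7 7 s s' ∧ (∀ j, s'.narr 7 j ≤ s'.nvar 8) ∧
      Recorded u k t (dartsIn u k X (S ∪ {c | c.elem = i ∧ c.heavy = h ∧ c.scale = b ∧
        (c.pos : ℝ) / 2 ^ c.scale < l})) s' ∧ cost ≤ 300 * bandCost u i h l b := by
  simp only [bandProg, block, runs_seq, runs_setN]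
  refine (runs_loop (fun n s' => Keeps 7 7 s s' ∧ s'.nvar 7 = n ∧
    (∀ j, s'.narr 7 j ≤ s'.nvar 8) ∧ Recorded u k t (dartsIn u k X (S ∪ {c | c.elem = i ∧
      c.heavy = h ∧ c.scale = b ∧ c.pos < n})) s')
    (fun q => 300 * (1 + total u ⟨i, h, b, q⟩)) ⌈l * 2 ^ b⌉₊ ?_ ?_ ?_).mono ?_
  · refine ⟨keeps_setN (by omega), by simp [NExp.eval], by simpa using hs.stamp, ?_⟩
    exact hA.congr (by simp) (fun _ => rfl) rfl
  · rintro n s₁ hn ⟨hk, h7, hst, hA₁⟩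
    have hat := hs.keeps hk hst
    refine ⟨?_, ?_⟩
    · simpa [BExp.holds, RExp.eval, NExp.eval, h7, hat.inner, hat.size] using lt_ceil_mul_iff.1 hn
    simp only [runs_seq, runs_setN]
    refine (runs_cellProg_dartsIn (c := ⟨i, h, b, n⟩) hu ⟨hat.k_eq, hat.elem, hat.heavy, hat.scale,
      h7, hat.limit, hat.size⟩ hst hA₁).mono ?_
    rintro s₂ c₂ ⟨hk2, hst2, hA2, hc2⟩
    refine ⟨⟨hk.trans <| (hk2.mono (by omega) (by omega)).trans (keeps_setN (by omega)), ?_,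
      by simpa using hst2, ?_⟩, ?_⟩
    · simp [NExp.eval, hk2.1 7, h7]
    · refine hA2.congr (fun j _ => ?_) (fun _ => rfl) rfl
      congr 1
      ext c
      simp only [Set.mem_insert_iff, Set.mem_union, Set.mem_ofPred_eq, Cell.ext_iff]
      constructor
      · rintro (⟨h1, h2, h3, h4⟩ | h1 | ⟨h1, h2, h3, h4⟩)
        exacts [.inr ⟨h1, h2, h3, by omega⟩, .inl h1, .inr ⟨h1, h2, h3, by omega⟩]
      · rintro (h1 | ⟨h1, h2, h3, h4⟩)
        · exact .inr (.inl h1)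
        · rcases Nat.lt_succ_iff_lt_or_eq.1 h4 with h5 | h5
          exacts [.inr (.inr ⟨h1, h2, h3, h5⟩), .inl ⟨h1, h2, h3, h5⟩]
    · simp [NExp.size, BExp.size, RExp.size]
      omega
  · rintro s₁ ⟨hk, h7, hst, -⟩
    have hat := hs.keeps hk hst
    have := (lt_ceil_mul_iff (l := l) (b := b) (q := ⌈l * 2 ^ b⌉₊)).not.1 (lt_irrefl _)
    simpa [BExp.holds, RExp.eval, NExp.eval, h7, hat.inner, hat.size] using this
  · rintro s₁ c₁ ⟨⟨hk, -, hst, hA₁⟩, hc⟩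
    refine ⟨hk, hst, hA₁.congr (fun j _ => ?_) (fun _ => rfl) rfl, ?_⟩
    · congr 2
      ext c
      simp only [Set.mem_ofPred_eq]
      constructor
      · rintro ⟨h1, h2, rfl, h4⟩
        exact ⟨h1, h2, rfl, lt_ceil_mul_iff.1 h4⟩
      · rintro ⟨h1, h2, rfl, h4⟩
        exact ⟨h1, h2, rfl, lt_ceil_mul_iff.2 h4⟩
    · rw [← Finset.mul_sum] at hc
      simp [NExp.size, BExp.size, RExp.size, bandCost] at *
      omega

/-- The least scale whose long side starts at `o` or above. -/
noncomputable def bandEnd (o : ℝ) : ℕ := sInf {b : ℕ | o ≤ 2 ^ b - 1}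

lemma lt_bandEnd_iff {o : ℝ} {b : ℕ} : b < bandEnd o ↔ (2 : ℝ) ^ b - 1 < o := by
  constructor
  · intro h
    exact not_le.1 (Nat.notMem_of_lt_sInf h)
  · intro h
    obtain ⟨n, hn⟩ := pow_unbounded_of_one_lt (o + 1) (one_lt_two (α := ℝ))
    have h1 : o ≤ 2 ^ bandEnd o - 1 := Nat.sInf_mem (s := {b : ℕ | o ≤ 2 ^ b - 1})
      ⟨n, by simp only [Set.mem_ofPred_eq]; linarith⟩
    by_contra hb
    have : (2 : ℝ) ^ bandEnd o ≤ 2 ^ b := pow_le_pow_right₀ one_le_two (not_lt.1 hb)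
    linarith

/-- The cost of all scales from `b₀` on, up to a constant factor. -/
noncomputable def bandsCost (u : List ℕ → ℝ) (i : ℕ) (h : Bool) (b₀ : ℕ) (o l : ℝ) : ℕ :=
  1 + ∑ b ∈ Finset.Ico b₀ (bandEnd o), bandCost u i h l b

/-- The limit `o` bounds the long side of the cells and `l` the short side. -/
lemma runs_bandsProg {k i h b₀ X o l t S s} (hu : ∀ key, u key < 1)
    (hs : AtBand k i h b₀ (X i) l s) (ho : s.rvar 4 = o)
    (hA : Recorded u k t (dartsIn u k X S) s) :
    Runs u bandsProg s fun s' cost => Keeps 6 6 s s' ∧ (∀ j, s'.narr 7 j ≤ s'.nvar 8) ∧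
      Recorded u k t (dartsIn u k X (S ∪ {c | c.elem = i ∧ c.heavy = h ∧ b₀ ≤ c.scale ∧
        (2 : ℝ) ^ c.scale - 1 < o ∧ (c.pos : ℝ) / 2 ^ c.scale < l})) s' ∧
      cost ≤ 320 * bandsCost u i h b₀ o l := by
  refine (runs_loop (fun n s' => Keeps 6 6 s s' ∧ AtBand k i h (b₀ + n) (X i) l s' ∧
    Recorded u k t (dartsIn u k X (S ∪ {c | c.elem = i ∧ c.heavy = h ∧ b₀ ≤ c.scale ∧
      c.scale < b₀ + n ∧ (c.pos : ℝ) / 2 ^ c.scale < l})) s')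
    (fun n => 320 * bandCost u i h l (b₀ + n)) (bandEnd o - b₀) ?_ ?_ ?_).mono ?_
  · refine ⟨.refl _ _ _, hs, hA.congr (fun j _ => ?_) (fun _ => rfl) rfl⟩
    congr 1
    ext c
    simp only [Set.mem_union, Set.mem_ofPred_eq]
    constructor
    · exact .inl
    · rintro (h | ⟨-, -, h1, h2, -⟩)
      exacts [h, by omega]
  · rintro n s₁ hn ⟨hk, hat, hA₁⟩
    refine ⟨?_, ?_⟩
    · have := (lt_bandEnd_iff (o := o) (b := b₀ + n)).1 (by omega)
      simpa [BExp.holds, RExp.eval, hk.2.1 4, ho, hat.size] using this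
    simp only [block, runs_seq, runs_setN, runs_setR]
    refine (runs_bandProg hu hat hA₁).mono ?_
    rintro s₂ c₂ ⟨hk2, hst2, hA2, hc2⟩
    have hat2 := hat.keeps hk2 hst2
    refine ⟨⟨hk.trans <| (hk2.mono (by omega) (by omega)).trans <| (keeps_setR (by omega)).trans
      (keeps_setN (by omega)), ⟨?_, ?_, ?_, ?_, ?_, ?_, ?_, ?_⟩, ?_⟩, ?_⟩
    · simpa using hat2.k_eq
    · simpa using hat2.elem
    · simpa using hat2.heavy
    · simp [NExp.eval, hat2.scale]; omega
    · simpa using hat2.limit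
    · simpa using hat2.inner
    · simp [RExp.eval, hat2.size]; ring
    · simpa using hst2
    · refine hA2.congr (fun j _ => ?_) (fun _ => rfl) rfl
      congr 1
      ext c
      simp only [Set.mem_union, Set.mem_ofPred_eq]
      constructor
      · rintro ((h1 | ⟨h1, h2, h3, h4, h5⟩) | ⟨h1, h2, h3, h4⟩)
        exacts [.inl h1, .inr ⟨h1, h2, h3, by omega, h5⟩, .inr ⟨h1, h2, by omega, by omega, h4⟩]
      · rintro (h1 | ⟨h1, h2, h3, h4, h5⟩)
        · exact .inl (.inl h1)
        · by_cases h6 : c.scale = b₀ + n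
          exacts [.inr ⟨h1, h2, h6, h5⟩, .inl (.inr ⟨h1, h2, h3, by omega, h5⟩)]
    · have : 1 ≤ bandCost u i h l (b₀ + n) := by simp [bandCost]
      simp [NExp.size, BExp.size, RExp.size]
      omega
  · rintro s₁ ⟨hk, hat, -⟩
    have := (lt_bandEnd_iff (o := o) (b := b₀ + (bandEnd o - b₀))).not.1 (by omega)
    simpa [BExp.holds, RExp.eval, hk.2.1 4, ho, hat.size] using this
  · rintro s₁ c₁ ⟨⟨hk, hat, hA₁⟩, hc⟩
    refine ⟨hk, hat.stamp, hA₁.congr (fun j _ => ?_) (fun _ => rfl) rfl, ?_⟩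
    · congr 2
      ext c
      simp only [Set.mem_ofPred_eq, ← lt_bandEnd_iff]
      constructor
      · rintro ⟨h1, h2, h3, h4, h5⟩
        exact ⟨h1, h2, h3, by omega, h5⟩
      · rintro ⟨h1, h2, h3, h4, h5⟩
        exact ⟨h1, h2, h3, by omega, h5⟩
    · rw [← Finset.mul_sum] at hc
      rw [bandsCost, Finset.sum_Ico_eq_sum_range]
      simp [BExp.size, RExp.size] at *
      omega

/-- Processes the cells of element number `e` of the input, with `e` in the integer variable 3, the
scale factor of the weights in the real variable 1 and the limit for the ranks in 2: first the heavy
cells, whose long side is the weight, then the others. -/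
def elemProg : Prog := block [
  .setN 4 (.get 0 (.var 3)),
  .setR 3 (.mul (.var 1) (.get 0 (.var 3))),
  .setR 4 (.var 3),
  .setR 5 (.var 2),
  .setR 6 (.const 2),
  .setN 5 (.const 1),
  .setN 6 (.const 1),
  bandsProg,
  .setR 4 (.var 2),
  .ite (.leR (.var 3) (.const 1)) (.setR 5 (.var 3)) (.setR 5 (.const 1)),
  .setR 6 (.const 1),
  .setN 5 (.const 0),
  .setN 6 (.const 0),
  bandsProg]

/-- The cells that can hold darts below the weights `X` and below the rank `t`. -/
def cellsBelow (X : ℕ → ℝ) (t : ℝ) : Set Cell :=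
  {c | c.Valid ∧ c.weight 0 0 < X c.elem ∧ c.rank 0 0 < t}

/-- The cost of an element, up to a constant factor. -/
noncomputable def elemCost (u : List ℕ → ℝ) (i : ℕ) (x t : ℝ) : ℕ :=
  bandsCost u i true 1 x t + bandsCost u i false 0 t (min x 1)

lemma runs_elemProg {k i X T t S s} (hu : ∀ key, u key < 1) (hk : s.nvar 0 = k)
    (hi : s.narr 0 (s.nvar 3) = i) (hX : T * s.rarr 0 (s.nvar 3) = X i) (hT : s.rvar 1 = T)
    (ht : s.rvar 2 = t) (hst : ∀ j, s.narr 7 j ≤ s.nvar 8)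
    (hA : Recorded u k t (dartsIn u k X S) s) :
    Runs u elemProg s fun s' cost => Keeps 4 3 s s' ∧ (∀ j, s'.narr 7 j ≤ s'.nvar 8) ∧
      Recorded u k t (dartsIn u k X (S ∪ {c | c.elem = i ∧ c ∈ cellsBelow X t})) s' ∧
      cost ≤ 400 * elemCost u i (X i) t := by
  simp only [elemProg, block, runs_seq, runs_setN, runs_setR]
  refine (runs_bandsProg (k := k) (i := i) (h := true) (b₀ := 1) (X := X) (o := X i) (l := t)
    (t := t) (S := S) hu ⟨?_, ?_, ?_, ?_, ?_, ?_, ?_, ?_⟩ ?_ ?_).mono ?_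
  · simpa using hk
  · simpa [NExp.eval] using hi
  · simp [NExp.eval]
  · simp [NExp.eval]
  · simp [NExp.eval, RExp.eval, hT, hX]
  · simp [RExp.eval, ht]
  · simp [RExp.eval]
  · simpa using hst
  · simp [NExp.eval, RExp.eval, hT, hX]
  · exact hA.congr (fun _ _ => rfl) (fun _ => rfl) rfl
  rintro s₁ c₁ ⟨hk1, hst1, hA1, hc1⟩
  have e0 : s₁.nvar 0 = k := by rw [hk1.1 0 (by omega)]; simpa using hk
  have e4 : s₁.nvar 4 = i := by rw [hk1.1 4 (by omega)]; simpa [NExp.eval] using hi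
  have e3 : s₁.rvar 3 = X i := by
    rw [hk1.2.1 3 (by omega)]; simp [NExp.eval, RExp.eval, hT, hX]
  have e2 : s₁.rvar 2 = t := by rw [hk1.2.1 2 (by omega)]; simp [ht]
  have hk0 : Keeps 4 3 s s₁ := by
    refine Keeps.trans ?_ (hk1.mono (by omega) (by omega))
    exact (keeps_setN (by omega)).trans <| (keeps_setR (by omega)).trans <|
      (keeps_setR (by omega)).trans <| (keeps_setR (by omega)).trans <|
      (keeps_setR (by omega)).trans <| (keeps_setN (by omega)).trans (keeps_setN (by omega))
  have key : ∀ (r : ℝ) (c₀ : ℕ), r = min (X i) 1 → c₀ ≤ 10 →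
      Runs u bandsProg ((((((s₁.setR 4 t).setR 5 r).setR 6 1).setN 5 0).setN 6 0))
      fun s' cost => Keeps 4 3 s s' ∧ (∀ j, s'.narr 7 j ≤ s'.nvar 8) ∧
      Recorded u k t (dartsIn u k X (S ∪ {c | c.elem = i ∧ c ∈ cellsBelow X t})) s' ∧
      60 + c₁ + c₀ + cost ≤ 400 * elemCost u i (X i) t := by
    rintro r c₀ rfl hc₀
    refine (runs_bandsProg (k := k) (i := i) (h := false) (b₀ := 0) (X := X) (o := t)
      (l := min (X i) 1) (t := t)
      (s := ((((s₁.setR 4 t).setR 5 (min (X i) 1)).setR 6 1).setN 5 0).setN 6 0) hu ⟨?_, ?_, ?_, ?_, ?_, ?_, ?_, ?_⟩ ?_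
      (hA1.congr (fun _ _ => rfl) (fun _ => rfl) rfl)).mono ?_
    · simpa using e0
    · simpa using e4
    · simp
    · simp
    · simpa using e3
    · simp
    · simp
    · simpa using hst1
    · simp
    rintro s₂ c₂ ⟨hk2, hst2, hA2, hc2⟩
    refine ⟨?_, hst2, hA2.congr (fun j _ => ?_) (fun _ => rfl) rfl, ?_⟩
    · refine hk0.trans (Keeps.trans ?_ (hk2.mono (by omega) (by omega)))
      exact (keeps_setR (by omega)).trans <| (keeps_setR (by omega)).trans <|
        (keeps_setR (by omega)).trans <| (keeps_setN (by omega)).trans (keeps_setN (by omega))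
    · congr 1
      ext ⟨i', h, b, q⟩
      have hp : (0 : ℝ) < 2 ^ b := by positivity
      have hq : (q : ℝ) / 2 ^ b < 1 ↔ q < 2 ^ b := by
        rw [div_lt_one hp]; exact_mod_cast Iff.rfl
      cases h <;>
        simp [cellsBelow, Cell.Valid, Cell.weight, Cell.rank, Cell.long, Cell.short, hq] <;>
        grind
    · have : 1 ≤ bandsCost u i true 1 (X i) t := by simp [bandsCost]
      rw [elemCost]
      omega
  simp only [runs_ite, runs_setR]
  constructor <;> intro hb
  · simp only [BExp.holds, RExp.eval, State.rvar_setR] at hb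
    simp [e3] at hb
    have := key (X i) 5 (by simp [hb]) (by norm_num)
    simp only [NExp.eval, RExp.eval, State.rvar_setR, e2, e3]
    norm_num [e3]
    refine this.mono fun s' cost ⟨h1, h2, h3, h4⟩ => ⟨h1, h2, h3, ?_⟩
    simp [NExp.size, BExp.size, RExp.size]
    omega
  · simp only [BExp.holds, RExp.eval, State.rvar_setR] at hb
    simp [e3] at hb
    have := key 1 5 (by simp [hb.le]) (by norm_num)
    simp only [NExp.eval, RExp.eval, e2]
    norm_num
    refine this.mono fun s' cost ⟨h1, h2, h3, h4⟩ => ⟨h1, h2, h3, ?_⟩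
    simp [NExp.size, BExp.size, RExp.size]
    omega

end

section
variable {u : List ℕ → ℝ}

/-- Sets the best rank of every mark to the cap `t`, in the real variable 2. -/
def resetProg : Prog := block [
  .setN 3 (.const 0),
  .loop (.not (.leN (.var 0) (.var 3))) <| block [
    .putR 1 (.var 3) (.var 2),
    .setN 3 (.add (.var 3) (.const 1))]]

/-- Processes all elements of the input. -/
def elemsProg : Prog := block [
  .setN 3 (.const 0),
  .loop (.not (.leN (.var 1) (.var 3))) <| block [
    elemProg,
    .setN 3 (.add (.var 3) (.const 1))]]

/-- Sets the integer variable 2 to 1 if a dart was found for every mark, and to 0 otherwise. -/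
def checkProg : Prog := block [
  .setN 2 (.const 1),
  .setN 3 (.const 0),
  .loop (.not (.leN (.var 0) (.var 3))) <| block [
    .ite (.leR (.var 2) (.get 1 (.var 3))) (.setN 2 (.const 0)) .skip,
    .setN 3 (.add (.var 3) (.const 1))]]

/-- One round: finds for every mark the dart of least rank among those of rank below the real
variable 2. -/
def roundProg : Prog := block [resetProg, elemsProg, checkProg]

/-- Computes the sum of the weights into the real variable 0. -/
def sumProg : Prog := block [
  .setR 0 (.const 0),
  .setN 3 (.const 0),
  .loop (.not (.leN (.var 1) (.var 3))) <| block [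
    .setR 0 (.add (.var 0) (.get 0 (.var 3))),
    .setN 3 (.add (.var 3) (.const 1))]]

/-- The whole program: rounds with a doubling limit for the ranks, until every mark has a dart. -/
def mainProg : Prog := block [
  sumProg,
  .setR 1 (.mul (.ofNat (.var 0)) (.add (.const 1) (.log (.ofNat (.var 0))))),
  .setR 2 (.div (.const 1) (.var 0)),
  .setN 2 (.const 0),
  .loop (.leN (.var 2) (.const 0)) <| block [
    roundProg,
    .setR 2 (.add (.var 2) (.var 2))]]

/-- The factor by which the program scales the weights. For a rank limit `2 ^ s / S`, where `S` is the
sum of the unscaled weights, each mark has `(1 + log k) * 2 ^ s` darts on average, so that by a union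
bound even round zero finds a dart of every mark with constant probability. -/
noncomputable def scaleFactor (k : ℕ) : ℝ := k * (1 + Real.log k)

/-- The memory holds the input: `n` elements `ids`, with weights `X` after scaling by `T`. -/
structure Loaded (k n : ℕ) (ids : ℕ → ℕ) (X : ℕ → ℝ) (T : ℝ) (s : State) : Prop where
  k_eq : s.nvar 0 = k
  n_eq : s.nvar 1 = n
  ids_eq : ∀ e < n, s.narr 0 e = ids e
  weights : ∀ e < n, T * s.rarr 0 e = X (ids e)

lemma Loaded.keeps {k n ids X T s s'} {R : ℕ} (h : Loaded k n ids X T s) (hs : Keeps 2 R s s') :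
    Loaded k n ids X T s' where
  k_eq := (hs.1 0 (by omega)).trans h.k_eq
  n_eq := (hs.1 1 (by omega)).trans h.n_eq
  ids_eq := by rw [hs.2.2.1]; exact h.ids_eq
  weights := by rw [hs.2.2.2]; exact h.weights

lemma runs_resetProg {k t X s} (hk : s.nvar 0 = k) (ht : s.rvar 2 = t) :
    Runs u resetProg s fun s' cost => Keeps 3 6 s s' ∧ s'.narr = s.narr ∧
      (∀ v ≠ 3, s'.nvar v = s.nvar v) ∧ Recorded u k t (dartsIn u k X ∅) s' ∧
      cost ≤ 10 + 20 * k := by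
  simp only [resetProg, block, runs_seq, runs_setN]
  refine (runs_loop (fun n s' => Keeps 3 6 s s' ∧ s'.nvar 3 = n ∧ s'.narr = s.narr ∧
    (∀ v ≠ 3, s'.nvar v = s.nvar v) ∧ ∀ j < n, s'.rarr 1 j = t) (fun _ => 20) k ?_ ?_ ?_).mono ?_
  · exact ⟨keeps_setN (by omega), by simp [NExp.eval], rfl, fun v hv => by simp [hv], by simp⟩
  · rintro n s₁ hn ⟨hk1, h3, hna, hv, hj⟩
    refine ⟨by simp [BExp.holds, NExp.eval, h3, hk1.1 0, hk, hn], ?_⟩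
    simp only [runs_seq, runs_setN, runs_putR]
    refine ⟨⟨hk1.trans ((keeps_putR (by omega)).trans (keeps_setN (by omega))), ?_, ?_, ?_, ?_⟩, ?_⟩
    · simp [NExp.eval, h3]
    · simpa using hna
    · intro v hv3
      simp [hv3, hv v hv3]
    · intro j hjn
      by_cases h : j = n
      · simp [NExp.eval, RExp.eval, h3, h, hk1.2.1 2, ht]
      · simp [NExp.eval, h3, h, hj j (by omega)]
    · simp [NExp.size, BExp.size, RExp.size]
  · rintro s₁ ⟨hk1, h3, -⟩
    simp [BExp.holds, NExp.eval, h3, hk1.1 0, hk]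
  · rintro s₁ c₁ ⟨⟨hk1, -, hna, hv, hj⟩, hc⟩
    refine ⟨hk1, hna, hv, fun j hjk => ?_, ?_⟩
    · rw [hj j hjk]
      simpa [dartsIn] using isBest_empty _ _ _
    · simp [NExp.size, BExp.size] at *
      omega

lemma runs_elemsProg {k n ids X T t s} (hu : ∀ key, u key < 1) (hs : Loaded k n ids X T s)
    (hT : s.rvar 1 = T) (ht : s.rvar 2 = t) (hst : ∀ j, s.narr 7 j ≤ s.nvar 8)
    (hA : Recorded u k t (dartsIn u k X ∅) s) :
    Runs u elemsProg s fun s' cost => Keeps 3 3 s s' ∧ (∀ j, s'.narr 7 j ≤ s'.nvar 8) ∧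
      Recorded u k t (dartsIn u k X {c | (∃ e < n, c.elem = ids e) ∧ c ∈ cellsBelow X t}) s' ∧
      cost ≤ 10 + 420 * ∑ e ∈ Finset.range n, elemCost u (ids e) (X (ids e)) t := by
  simp only [elemsProg, block, runs_seq, runs_setN]
  refine (runs_loop (fun m s' => Keeps 3 3 s s' ∧ s'.nvar 3 = m ∧
    (∀ j, s'.narr 7 j ≤ s'.nvar 8) ∧ Recorded u k t (dartsIn u k X
      {c | (∃ e < m, c.elem = ids e) ∧ c ∈ cellsBelow X t}) s')
    (fun e => 420 * elemCost u (ids e) (X (ids e)) t) n ?_ ?_ ?_).mono ?_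
  · refine ⟨keeps_setN (by omega), by simp [NExp.eval], by simpa using hst, ?_⟩
    exact hA.congr (fun j _ => by simp) (fun _ => rfl) rfl
  · rintro m s₁ hm ⟨hk1, h3, hst1, hA1⟩
    have hs1 := hs.keeps (hk1.mono (by omega) le_rfl)
    refine ⟨by simp [BExp.holds, NExp.eval, h3, hs1.n_eq, hm], ?_⟩
    simp only [runs_seq, runs_setN]
    refine (runs_elemProg (i := ids m) (X := X) (T := T) hu hs1.k_eq (by rw [h3, hs1.ids_eq m hm])
      (by rw [h3, hs1.weights m hm]) ((hk1.2.1 1 (by omega)).trans hT)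
      ((hk1.2.1 2 (by omega)).trans ht) hst1 hA1).mono ?_
    rintro s₂ c₂ ⟨hk2, hst2, hA2, hc2⟩
    refine ⟨⟨hk1.trans ((hk2.mono (by omega) le_rfl).trans (keeps_setN (by omega))), ?_,
      by simpa using hst2, hA2.congr (fun j _ => ?_) (fun _ => rfl) rfl⟩, ?_⟩
    · simp [NExp.eval, hk2.1 3, h3]
    · congr 1
      ext c
      simp only [Set.mem_union, Set.mem_ofPred_eq]
      constructor
      · rintro (⟨⟨e, h1, h2⟩, h4⟩ | ⟨h1, h2⟩)
        exacts [⟨⟨e, by omega, h2⟩, h4⟩, ⟨⟨m, by omega, h1⟩, h2⟩]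
      · rintro ⟨⟨e, h1, h2⟩, h4⟩
        rcases Nat.lt_succ_iff_lt_or_eq.1 h1 with h | rfl
        exacts [.inl ⟨⟨e, h, h2⟩, h4⟩, .inr ⟨h2, h4⟩]
    · have : 1 ≤ elemCost u (ids m) (X (ids m)) t := by simp [elemCost, bandsCost]; omega
      simp [NExp.size, BExp.size]
      omega
  · rintro s₁ ⟨hk1, h3, -⟩
    simp [BExp.holds, NExp.eval, h3, hk1.1 1, hs.n_eq]
  · rintro s₁ c₁ ⟨⟨hk1, -, hst1, hA1⟩, hc⟩
    refine ⟨hk1, hst1, hA1, ?_⟩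
    rw [← Finset.mul_sum] at hc
    simp [NExp.size, BExp.size] at *
    omega

open Classical in
lemma runs_checkProg {k t s} (hk : s.nvar 0 = k) (ht : s.rvar 2 = t) :
    Runs u checkProg s fun s' cost => Keeps 2 6 s s' ∧ s'.narr = s.narr ∧ s'.rarr = s.rarr ∧
      s'.nvar 8 = s.nvar 8 ∧ s'.nvar 2 = (if ∀ j < k, s.rarr 1 j < t then 1 else 0) ∧
      cost ≤ 10 + 20 * k := by
  simp only [checkProg, block, runs_seq, runs_setN]
  refine (runs_loop (fun n s' => Keeps 2 6 s s' ∧ s'.nvar 3 = n ∧ s'.narr = s.narr ∧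
    s'.rarr = s.rarr ∧ s'.nvar 8 = s.nvar 8 ∧
    s'.nvar 2 = (if ∀ j < n, s.rarr 1 j < t then 1 else 0)) (fun _ => 20) k ?_ ?_ ?_).mono ?_
  · exact ⟨(keeps_setN (by omega)).trans (keeps_setN (by omega)), by simp [NExp.eval], rfl, rfl,
      by simp, by simp [NExp.eval]⟩
  · rintro n s₁ hn ⟨hk1, h3, hna, hra, h8, h2⟩
    refine ⟨by simp [BExp.holds, NExp.eval, h3, hk1.1 0, hk, hn], ?_⟩
    have e2 := (hk1.2.1 2 (by omega)).trans ht
    simp only [runs_seq, runs_setN, runs_ite, runs_skip]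
    constructor <;> intro hb
    · simp only [BExp.holds, RExp.eval, NExp.eval, h3, hra, e2] at hb
      refine ⟨⟨hk1.trans ((keeps_setN (by omega)).trans (keeps_setN (by omega))), ?_, ?_, ?_, ?_,
        ?_⟩, ?_⟩
      · simp [NExp.eval, h3]
      · simpa using hna
      · simpa using hra
      · simpa using h8
      · rw [if_neg (fun h => absurd (h n (by omega)) (not_lt.2 hb))]
        simp [NExp.eval]
      · simp [NExp.size, BExp.size, RExp.size]
    · simp only [BExp.holds, RExp.eval, NExp.eval, h3, hra, e2, not_le] at hb
      refine ⟨⟨hk1.trans (keeps_setN (by omega)), ?_, ?_, ?_, ?_, ?_⟩, ?_⟩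
      · simp [NExp.eval, h3]
      · simpa using hna
      · simpa using hra
      · simpa using h8
      · simp only [State.nvar_setN, h2]
        have : (∀ j < n + 1, s.rarr 1 j < t) ↔ ∀ j < n, s.rarr 1 j < t :=
          ⟨fun h j hj => h j (by omega), fun h j hj => by
            rcases Nat.lt_succ_iff_lt_or_eq.1 hj with h' | rfl
            exacts [h j h', hb]⟩
        simp only [this, Nat.reduceEqDiff, if_false]
      · simp [NExp.size, BExp.size, RExp.size]
  · rintro s₁ ⟨hk1, h3, -⟩
    simp [BExp.holds, NExp.eval, h3, hk1.1 0, hk]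
  · rintro s₁ c₁ ⟨⟨hk1, -, hna, hra, h8, h2⟩, hc⟩
    refine ⟨hk1, hna, hra, h8, h2, ?_⟩
    simp [NExp.size, BExp.size] at *
    omega

/-- The cost of a round, up to a constant factor. -/
noncomputable def roundCost (u : List ℕ → ℝ) (k n : ℕ) (ids : ℕ → ℕ) (X : ℕ → ℝ) (t : ℝ) : ℕ :=
  1 + k + ∑ e ∈ Finset.range n, elemCost u (ids e) (X (ids e)) t

/-- Every mark has a dart of rank below `t`. -/
def Success (u : List ℕ → ℝ) (k : ℕ) (X : ℕ → ℝ) (t : ℝ) : Prop :=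
  ∀ j < k, ∃ δ ∈ dartsIn u k X (cellsBelow X t) j, (dataOf u k j).rank δ < t

lemma Cell.weight_zero_nonneg (c : Cell) : 0 ≤ c.weight 0 0 := by
  have : (1 : ℝ) ≤ 2 ^ c.scale := one_le_pow₀ one_le_two
  unfold Cell.weight Cell.long Cell.short
  split_ifs
  · linarith
  · positivity

open Classical in
lemma runs_roundProg {k n ids X T t s} (hu : ∀ key, u key < 1) (hs : Loaded k n ids X T s)
    (hX : ∀ i, 0 < X i → ∃ e < n, i = ids e)
    (hT : s.rvar 1 = T) (ht : s.rvar 2 = t) (hst : ∀ j, s.narr 7 j ≤ s.nvar 8) :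
    Runs u roundProg s fun s' cost => Keeps 2 3 s s' ∧ (∀ j, s'.narr 7 j ≤ s'.nvar 8) ∧
      Recorded u k t (dartsIn u k X (cellsBelow X t)) s' ∧
      s'.nvar 2 = (if Success u k X t then 1 else 0) ∧
      cost ≤ 420 * roundCost u k n ids X t := by
  simp only [roundProg, block, runs_seq]
  refine (runs_resetProg (X := X) hs.k_eq ht).mono ?_
  rintro s₁ c₁ ⟨hk1, hn1, hv1, hA1, hc1⟩
  refine (runs_elemsProg hu (hs.keeps (hk1.mono (by omega) le_rfl)) ((hk1.2.1 1 (by omega)).trans hT)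
    ((hk1.2.1 2 (by omega)).trans ht) (by rw [hn1, hv1 8 (by omega)]; exact hst) hA1).mono ?_
  rintro s₂ c₂ ⟨hk2, hst2, hA2, hc2⟩
  have hcells : {c | (∃ e < n, c.elem = ids e) ∧ c ∈ cellsBelow X t} = cellsBelow X t := by
    ext c
    exact ⟨fun h => h.2, fun h => ⟨hX _ ((c.weight_zero_nonneg).trans_lt h.2.1), h⟩⟩
  rw [hcells] at hA2
  have e0 := ((hk2.1 0 (by omega)).trans (hk1.1 0 (by omega))).trans hs.k_eq
  refine (runs_checkProg e0 (((hk2.2.1 2 (by omega)).trans (hk1.2.1 2 (by omega))).trans ht)).mono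
    ?_
  rintro s₃ c₃ ⟨hk3, hn3, hr3, h83, h23, hc3⟩
  refine ⟨?_, by rwa [hn3, h83], hA2.congr (fun _ _ => rfl) (fun j => by ext a; simp [out, hn3]) hr3,
    ?_, ?_⟩
  · exact (hk1.mono (by omega) (by omega)).trans <| (hk2.mono (by omega) (by omega)).trans
      (hk3.mono (by omega) (by omega))
  · rw [h23]
    congr 1
    rw [eq_iff_iff]
    refine forall₂_congr fun j hj => ⟨fun h => ?_, fun ⟨δ, hδ, h⟩ => ?_⟩
    · rcases (hA2 j hj).2.2 with h' | ⟨δ, hδ, h1, h2, -⟩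
      · exact absurd h' h.ne
      · exact ⟨δ, hδ, h1 ▸ h2⟩
    · exact ((hA2 j hj).2.1 δ hδ).trans_lt h
  · rw [roundCost]
    omega

lemma runs_sumProg {n s} (hn : s.nvar 1 = n) :
    Runs u sumProg s fun s' cost => Keeps 3 0 s s' ∧ s'.narr = s.narr ∧ s'.nvar 8 = s.nvar 8 ∧
      s'.rvar 0 = ∑ e ∈ Finset.range n, s.rarr 0 e ∧ cost ≤ 10 + 20 * n := by
  simp only [sumProg, block, runs_seq, runs_setN, runs_setR]
  refine (runs_loop (fun m s' => Keeps 3 0 s s' ∧ s'.nvar 3 = m ∧ s'.narr = s.narr ∧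
    s'.nvar 8 = s.nvar 8 ∧ s'.rvar 0 = ∑ e ∈ Finset.range m, s.rarr 0 e) (fun _ => 20) n
    ?_ ?_ ?_).mono ?_
  · exact ⟨(keeps_setR (by omega)).trans (keeps_setN (by omega)), by simp [NExp.eval], rfl,
      by simp, by simp [RExp.eval]⟩
  · rintro m s₁ hm ⟨hk1, h3, hna, h8, h0⟩
    refine ⟨by simp [BExp.holds, NExp.eval, h3, hk1.1 1, hn, hm], ?_⟩
    simp only [runs_seq, runs_setN, runs_setR]
    refine ⟨⟨hk1.trans ((keeps_setR (by omega)).trans (keeps_setN (by omega))), ?_, ?_, ?_, ?_⟩, ?_⟩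
    · simp [NExp.eval, h3]
    · simpa using hna
    · simpa using h8
    · simp [NExp.eval, RExp.eval, h3, h0, Finset.sum_range_succ, hk1.2.2.2]
    · simp [NExp.size, BExp.size, RExp.size]
  · rintro s₁ ⟨hk1, h3, -⟩
    simp [BExp.holds, NExp.eval, h3, hk1.1 1, hn]
  · rintro s₁ c₁ ⟨⟨hk1, -, hna, h8, h0⟩, hc⟩
    refine ⟨hk1, hna, h8, h0, ?_⟩
    simp [NExp.size, BExp.size, RExp.size] at *
    omega

/-- If round `r` is the first to succeed then the program halts with its result. -/
lemma runs_mainProg {k n ids X S s r} (hu : ∀ key, u key < 1)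
    (hs : Loaded k n ids X (scaleFactor k) s) (hX : ∀ i, 0 < X i → ∃ e < n, i = ids e)
    (hS : ∑ e ∈ Finset.range n, s.rarr 0 e = S)
    (hst : ∀ j, s.narr 7 j ≤ s.nvar 8) (hr : Success u k X (2 ^ r / S))
    (hr' : ∀ m < r, ¬ Success u k X (2 ^ m / S)) :
    Runs u mainProg s fun s' cost =>
      Recorded u k (2 ^ r / S) (dartsIn u k X (cellsBelow X (2 ^ r / S))) s' ∧
      cost ≤ 50 * (1 + n) + ∑ m ∈ Finset.range (r + 1), 440 * roundCost u k n ids X (2 ^ m / S) := by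
  classical
  simp only [mainProg, block, runs_seq, runs_setN, runs_setR]
  refine (runs_sumProg hs.n_eq).mono ?_
  rintro s₁ c₁ ⟨hk1, hn1, h81, h01, hc1⟩
  rw [hS] at h01
  refine (runs_loop (fun m s' => Loaded k n ids X (scaleFactor k) s' ∧ s'.rvar 1 = scaleFactor k ∧
    s'.rvar 2 = 2 ^ m / S ∧ (∀ j, s'.narr 7 j ≤ s'.nvar 8) ∧
    s'.nvar 2 = (if m = r + 1 then 1 else 0) ∧
    ∀ m', m = m' + 1 → Recorded u k (2 ^ m' / S) (dartsIn u k X (cellsBelow X (2 ^ m' / S))) s')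
    (fun m => 440 * roundCost u k n ids X (2 ^ m / S)) (r + 1) ?_ ?_ ?_).mono ?_
  · refine ⟨hs.keeps (R := 0) ?_, ?_, ?_, ?_, ?_, ?_⟩
    · exact (hk1.mono (by omega) le_rfl).trans <| (keeps_setR (by omega)).trans <|
        (keeps_setR (by omega)).trans (keeps_setN (by omega))
    · simp [RExp.eval, NExp.eval, scaleFactor, hk1.1 0, hs.k_eq]
    · simp [RExp.eval, h01]
    · simpa [hn1, h81] using hst
    · simp [NExp.eval]
    · simp
  · rintro m s₂ hm ⟨hl2, h12, h22, hst2, h2, -⟩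
    refine ⟨by simp [BExp.holds, NExp.eval, h2]; omega, ?_⟩
    simp only [runs_seq, runs_setR]
    refine (runs_roundProg hu hl2 hX h12 h22 hst2).mono ?_
    rintro s₃ c₃ ⟨hk3, hst3, hA3, h23, hc3⟩
    refine ⟨⟨hl2.keeps (R := 0) ((hk3.mono le_rfl (by omega)).trans (keeps_setR (by omega))),
      ?_, ?_, by simpa using hst3, ?_, ?_⟩, ?_⟩
    · simp [hk3.2.1 1, h12]
    · simp [RExp.eval, hk3.2.1 2, h22]; ring
    · simp only [State.nvar_setR, h23, add_left_inj]
      by_cases hmr : m = r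
      · rw [if_pos (hmr ▸ hr), if_pos hmr]
      · rw [if_neg (hr' m (by omega)), if_neg hmr]
    · rintro m' h
      obtain rfl : m = m' := by omega
      exact hA3.congr (fun _ _ => rfl) (fun _ => rfl) rfl
    · have : 1 ≤ roundCost u k n ids X (2 ^ m / S) := by simp [roundCost]; omega
      simp [NExp.size, BExp.size, RExp.size]
      omega
  · rintro s₂ ⟨-, -, -, -, h2, -⟩
    simp [BExp.holds, NExp.eval, h2]
  · rintro s₂ c₂ ⟨⟨-, -, -, -, -, hA⟩, hc⟩
    refine ⟨hA r rfl, ?_⟩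
    simp [NExp.size, BExp.size, RExp.size] at *
    omega

end

/-! ### Distribution and independence of the hash values -/

section

variable {Ω : Type*} [MeasurableSpace Ω] {P : Measure Ω}

/-- Grouping independent random variables in disjoint blocks gives independent blocks. -/
lemma iIndepFun_curry {ι κ β : Type*} [MeasurableSpace β] [IsProbabilityMeasure P]
    {X : ι → κ → Ω → β} (mX : ∀ i j, Measurable (X i j))
    (h : iIndepFun (fun p : ι × κ => X p.1 p.2) P) :
    iIndepFun (fun i ω j => X i j ω) P := by
  have hm : ∀ i, Measurable fun ω j => X i j ω := fun i => measurable_pi_iff.2 (mX i)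
  have hp : ∀ i j, IsProbabilityMeasure (P.map (X i j)) :=
    fun i j => Measure.isProbabilityMeasure_map (mX i j).aemeasurable
  have hs : iIndepFun (fun (p : (_ : ι) × κ) => X p.1 p.2) P :=
    h.precomp (Equiv.sigmaEquivProd ι κ).injective
  have hrow : ∀ i, iIndepFun (X i) P := fun i =>
    h.precomp (g := fun j => (i, j)) (fun a b hab => (Prod.mk.inj hab).2)
  rw [iIndepFun_iff_map_fun_eq_infinitePi_map hm]
  have h1 : (fun ω i j => X i j ω) = MeasurableEquiv.piCurry (fun (_ : ι) (_ : κ) => β) ∘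
      fun ω p => X p.1 p.2 ω := by
    ext; simp [Sigma.curry]
  have hmu : Measurable fun ω (p : (_ : ι) × κ) => X p.1 p.2 ω :=
    measurable_pi_iff.2 fun p => mX p.1 p.2
  rw [h1, ← Measure.map_map (by fun_prop) hmu,
    (iIndepFun_iff_map_fun_eq_infinitePi_map (X := fun (p : (_ : ι) × κ) => X p.1 p.2)
      (fun p => mX p.1 p.2)).1 hs,
    Measure.infinitePi_map_piCurry (fun i j => P.map (X i j))]
  congr 1
  ext1 i
  exact ((iIndepFun_iff_map_fun_eq_infinitePi_map (mX i)).1 (hrow i)).symm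

instance : Countable Cell := by
  refine Function.Injective.countable (β := ℕ × Bool × ℕ × ℕ)
    (f := fun c => (c.elem, c.heavy, c.scale, c.pos)) ?_
  intro a b h
  simpa [Cell.ext_iff] using h

lemma Cell.key_injective : Function.Injective Cell.key := by
  intro a b h
  simp only [Cell.key, List.cons.injEq] at h
  obtain ⟨h1, h2, h3, h4, -⟩ := h
  refine Cell.ext h1 ?_ h3 h4
  revert h2
  cases a.heavy <;> cases b.heavy <;> simp

variable {u : List ℕ → Ω → ℝ}

lemma indep_cells [IsProbabilityMeasure P] (hu : IsFullyRandom u P) :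
    iIndepFun (fun (c : Cell) ω (l : List ℕ) => u (c.key ++ l) ω) P := by
  refine iIndepFun_curry (fun c l => hu.measurable _)
    (hu.indep.precomp (g := fun p : Cell × List ℕ => p.1.key ++ p.2) ?_)
  rintro ⟨c, l⟩ ⟨c', l'⟩ h
  obtain ⟨h1, h2⟩ := List.append_inj h (by simp [Cell.key])
  exact Prod.ext (Cell.key_injective h1) h2

lemma indep_blocks [IsProbabilityMeasure P] (hu : IsFullyRandom u P) (c : Cell) :
    iIndepFun (fun (o : ℕ) ω (l : List ℕ) => u (c.key ++ o :: l) ω) P := by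
  refine iIndepFun_curry (fun c l => hu.measurable _)
    (hu.indep.precomp (g := fun p : ℕ × List ℕ => c.key ++ p.1 :: p.2) ?_)
  rintro ⟨o, l⟩ ⟨o', l'⟩ h
  simpa using h

lemma map_uniform (hu : IsFullyRandom u P) (key : List ℕ) :
    P.map (u key) = volume.restrict (Set.Ico (0 : ℝ) 1) := by
  have := hu.uniform key
  unfold pdf.IsUniform at this
  rw [this, ProbabilityTheory.cond]
  simp

lemma ae_mem_Ico (hu : IsFullyRandom u P) :
    ∀ᵐ ω ∂P, ∀ key, u key ω ∈ Set.Ico (0 : ℝ) 1 := by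
  rw [ae_all_iff]
  intro key
  have h : ∀ᵐ x ∂(P.map (u key)), x ∈ Set.Ico (0 : ℝ) 1 := by
    rw [map_uniform hu]
    exact ae_restrict_mem measurableSet_Ico
  exact ae_of_ae_map (hu.measurable key).aemeasurable h

/-- The part of the Poisson distribution function of mean one below `n`. -/
noncomputable def poissonSum (n : ℕ) : ℝ :=
  ∑ i ∈ Finset.range n, Real.exp (-1) / (i.factorial : ℝ)

lemma poissonSum_mono : Monotone poissonSum := by
  refine monotone_nat_of_le_succ fun n => ?_
  rw [poissonSum, poissonSum, Finset.sum_range_succ]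
  have : 0 ≤ Real.exp (-1) / (n.factorial : ℝ) := by positivity
  linarith

lemma poissonSum_le_one (n : ℕ) : poissonSum n ≤ 1 := by
  have h := hasSum_one_poissonMeasure 1
  simp only [NNReal.coe_one, one_pow, mul_one] at h
  exact sum_le_hasSum _ (fun i _ => by positivity) h

lemma poissonQuantile_eq_iff {a : ℝ} (ha : a ∈ Set.Ico (0 : ℝ) 1) {n : ℕ} :
    poissonQuantile a = n ↔ a ∈ Set.Ico (poissonSum n) (poissonSum (n + 1)) := by
  constructor
  · rintro rfl
    refine ⟨?_, lt_sum_poissonQuantile ha.2⟩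
    rcases h : poissonQuantile a with _ | m
    · simpa [poissonSum] using ha.1
    · exact sum_le_of_lt_poissonQuantile (by omega)
  · rintro ⟨h1, h2⟩
    refine le_antisymm (Nat.sInf_le h2) ?_
    by_contra h
    have h3 := lt_sum_poissonQuantile ha.2
    exact absurd (h3.trans_le (poissonSum_mono (show poissonQuantile a + 1 ≤ n by omega)))
      (not_lt.2 h1)

lemma measurable_poissonQuantile : Measurable poissonQuantile := by
  have h : ∀ n, MeasurableSet {a : ℝ | a < poissonSum (n + 1)} := fun n => measurableSet_Iio
  refine measurable_to_countable' fun n => ?_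
  have : poissonQuantile ⁻¹' {n} = ({a | a < poissonSum (n + 1)} ∩
      ⋂ (m : ℕ) (_ : m < n), {a | a < poissonSum (m + 1)}ᶜ) ∪
      ({_a | n = 0} ∩ ⋂ m : ℕ, {a | a < poissonSum (m + 1)}ᶜ) := by
    ext a
    simp only [Set.mem_preimage, Set.mem_singleton_iff, Set.mem_union, Set.mem_inter_iff,
      Set.mem_iInter, Set.mem_compl_iff, Set.mem_ofPred_eq]
    constructor
    · rintro rfl
      by_cases hne : ∃ m, a < poissonSum (m + 1)
      · exact .inl ⟨Nat.sInf_mem hne, fun m hm => Nat.notMem_of_lt_sInf hm⟩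
      · push Not at hne
        refine .inr ⟨?_, fun m => not_lt.2 (hne m)⟩
        refine Nat.sInf_eq_zero.2 (.inr ?_)
        ext m
        simpa [poissonSum] using hne m
    · rintro (⟨h1, h2⟩ | ⟨rfl, h⟩)
      · refine le_antisymm (Nat.sInf_le h1) ?_
        by_contra hlt
        exact h2 _ (not_le.1 hlt) (Nat.sInf_mem (s := {n | a < poissonSum (n + 1)}) ⟨n, h1⟩)
      · refine Nat.sInf_eq_zero.2 (.inr ?_)
        ext m
        simpa [poissonSum] using h m
  rw [this]
  refine ((h n).inter ?_).union (MeasurableSet.inter (.const _) ?_)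
  · exact MeasurableSet.iInter fun m => MeasurableSet.iInter fun _ => (h m).compl
  · exact MeasurableSet.iInter fun m => (h m).compl

lemma measurable_total (hu : ∀ key, Measurable (u key)) (c : Cell) :
    Measurable fun ω => total (fun key => u key ω) c :=
  measurable_poissonQuantile.comp (hu _)

lemma measurable_mark (hu : ∀ key, Measurable (u key)) (k : ℕ) (c : Cell) (l : ℕ) :
    Measurable fun ω => mark (fun key => u key ω) k c l :=
  Nat.measurable_floor.comp ((hu _).const_mul _)

lemma prob_total (hu : IsFullyRandom u P) (c : Cell) (n : ℕ) :
    P {ω | total (fun key => u key ω) c = n} =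
      ENNReal.ofReal (Real.exp (-1) / (n.factorial : ℝ)) := by
  have h1 : P {ω | total (fun key => u key ω) c = n} =
      P (u (c.key ++ [0]) ⁻¹' Set.Ico (poissonSum n) (poissonSum (n + 1))) := by
    refine measure_congr ?_
    filter_upwards [ae_mem_Ico hu] with ω hω
    exact propext (poissonQuantile_eq_iff (hω _))
  rw [h1, ← Measure.map_apply (hu.measurable _) measurableSet_Ico, map_uniform hu,
    Measure.restrict_apply measurableSet_Ico, Set.inter_eq_left.2, Real.volume_Ico]
  · congr 1
    rw [poissonSum, poissonSum, Finset.sum_range_succ]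
    ring
  · refine Set.Ico_subset_Ico ?_ (poissonSum_le_one _)
    exact Finset.sum_nonneg fun i _ => by positivity

lemma prob_mark (hu : IsFullyRandom u P) {k j : ℕ} (hj : j < k) (c : Cell) (l : ℕ) :
    P {ω | mark (fun key => u key ω) k c l = j} = ENNReal.ofReal (1 / k) := by
  have hk : (0 : ℝ) < k := by exact_mod_cast (by omega : 0 < k)
  have h1 : P {ω | mark (fun key => u key ω) k c l = j} =
      P (u (c.key ++ [0, l]) ⁻¹' Set.Ico ((j : ℝ) / k) ((j + 1) / k)) := by
    refine measure_congr ?_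
    filter_upwards [ae_mem_Ico hu] with ω hω
    refine propext ?_
    change ⌊(k : ℝ) * u (c.key ++ [0, l]) ω⌋₊ = j ↔
      u (c.key ++ [0, l]) ω ∈ Set.Ico ((j : ℝ) / k) ((j + 1) / k)
    rw [Nat.floor_eq_iff (mul_nonneg hk.le (hω _).1), Set.mem_Ico,
      div_le_iff₀ hk, lt_div_iff₀ hk, mul_comm]
  rw [h1, ← Measure.map_apply (hu.measurable _) measurableSet_Ico, map_uniform hu,
    Measure.restrict_apply measurableSet_Ico, Set.inter_eq_left.2, Real.volume_Ico]
  · congr 1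
    ring
  · refine Set.Ico_subset_Ico (by positivity) ?_
    rw [div_le_one hk]
    exact_mod_cast hj

lemma ae_mark_lt (hu : IsFullyRandom u P) {k : ℕ} (hk : 1 ≤ k) :
    ∀ᵐ ω ∂P, ∀ c l, mark (fun key => u key ω) k c l < k := by
  filter_upwards [ae_mem_Ico hu] with ω hω c l
  have hk' : (0 : ℝ) < k := by exact_mod_cast hk
  rw [mark, Nat.floor_lt (mul_nonneg hk'.le (hω _).1)]
  nlinarith [(hω (c.key ++ [0, l])).2]

end

/-! ### Poisson splitting -/

section
variable {Ω : Type*} [MeasurableSpace Ω] {P : Measure Ω} {u : List ℕ → Ω → ℝ}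

lemma measurable_count (hu : ∀ key, Measurable (u key)) (k : ℕ) (c : Cell) (j n : ℕ) :
    Measurable fun ω => count (fun key => u key ω) k c j n := by
  induction n with
  | zero => simp [count]
  | succ n ih =>
    simp only [count_succ]
    refine ih.add (Measurable.ite ?_ measurable_const measurable_const)
    exact measurable_mark hu k c n (measurableSet_singleton j)

lemma measurable_count_total (hu : ∀ key, Measurable (u key)) (k : ℕ) (c : Cell) (j : ℕ) :
    Measurable fun ω => count (fun key => u key ω) k c j (total (fun key => u key ω) c) := by
  have h : Measurable fun p : ℕ × Ω => count (fun key => u key p.2) k c j p.1 :=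
    measurable_from_prod_countable_right fun n => measurable_count hu k c j n
  exact h.comp ((measurable_total hu c).prodMk measurable_id)

/-- The number of darts of a cell (entry `0`) and their marks (entries `l + 1`). -/
noncomputable def draws (u : List ℕ → ℝ) (k : ℕ) (c : Cell) : ℕ → ℕ
  | 0 => total u c
  | l + 1 => mark u k c l

lemma indep_draws (hu : IsFullyRandom u P) (k : ℕ) (c : Cell) :
    iIndepFun (fun i ω => draws (fun key => u key ω) k c i) P := by
  have h := (hu.indep.precomp (g := fun i : ℕ => c.key ++ 0 :: (if i = 0 then [] else [i - 1]))
    ?_).comp (γ := fun _ => ℕ) (mγ := fun _ => Nat.instMeasurableSpace)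
    (fun i x => if i = 0 then poissonQuantile x else ⌊(k : ℝ) * x⌋₊) ?_
  · convert h using 1
    ext i ω
    cases i <;> simp [draws, total, mark]
  · intro a b hab
    simp only [List.append_cancel_left_eq, List.cons.injEq, true_and] at hab
    split_ifs at hab <;> simp_all
    omega
  · intro i
    by_cases hi : i = 0
    · simpa [hi] using measurable_poissonQuantile
    · simp only [hi, if_false]
      exact Nat.measurable_floor.comp (measurable_id.const_mul (k : ℝ))

/-- The counts of the first `n` marks are a function of these marks, hence independent of the
other draws. -/
lemma indep_count_draw (hu : IsFullyRandom u P) (k : ℕ) (c : Cell) (n i : ℕ)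
    (hi : i ∉ Finset.Ioc 0 n) :
    IndepFun (fun ω => draws (fun key => u key ω) k c i)
      (fun ω (j : Fin k) => count (fun key => u key ω) k c j n) P := by
  have hm : ∀ i, Measurable fun ω => draws (fun key => u key ω) k c i := by
    rintro (_ | i)
    exacts [measurable_total hu.measurable c, measurable_mark hu.measurable k c i]
  have h := (indep_draws hu k c).indepFun_finset {i} (Finset.Ioc 0 n) (by simpa using hi) hm
  have h2 := h.comp (φ := fun f => f ⟨i, by simp⟩)
    (ψ := fun f (j : Fin k) => ∑ l ∈ (Finset.Ioc 0 n).attach, if f l = (j : ℕ) then 1 else 0)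
    Measurable.of_discrete Measurable.of_discrete
  refine h2.congr .rfl (.of_forall fun ω => funext fun j => ?_)
  simp only [Function.comp, count, Finset.card_filter]
  rw [Finset.sum_attach (Finset.Ioc 0 n) (f := fun l =>
    if draws (fun key => u key ω) k c l = j then 1 else 0), Finset.range_eq_Ico,
    show Finset.Ioc 0 n = Finset.Ico (0 + 1) (n + 1) by ext; simp; omega,
    ← Finset.sum_Ico_add' (fun l => if draws (fun key => u key ω) k c l = j then 1 else 0) 0 n 1]
  rfl

lemma measure_eq_sum_of_ae_lt {f : Ω → ℕ} (hf : Measurable f) {k : ℕ} (hk : ∀ᵐ ω ∂P, f ω < k)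
    (A : Set Ω) : P A = ∑ j : Fin k, P ({ω | f ω = j} ∩ A) := by
  have hm : ∀ j, MeasurableSet (f ⁻¹' {j}) := fun j => hf (measurableSet_singleton j)
  have h := sum_measure_preimage_singleton (μ := P.restrict A) (Finset.range k) (f := f)
    fun y _ => hm y
  rw [Finset.sum_range] at h
  have h2 : P.restrict A (f ⁻¹' (Finset.range k : Set ℕ)) = P.restrict A Set.univ := by
    refine measure_congr ?_
    filter_upwards [ae_restrict_of_ae hk] with ω hω
    refine propext ⟨fun _ => trivial, fun _ => ?_⟩
    change f ω ∈ (Finset.range k : Set ℕ)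
    simpa using hω
  rw [h2, Measure.restrict_apply_univ] at h
  rw [← h]
  exact Finset.sum_congr rfl fun j _ => Measure.restrict_apply (hm _)

/-- The multinomial distribution with `n` trials and `k` equally likely outcomes. -/
noncomputable def multinomial {k : ℕ} (n : ℕ) (v : Fin k → ℕ) : ℝ :=
  if ∑ j, v j = n then (n.factorial : ℝ) / (∏ j, ((v j).factorial : ℝ)) / k ^ n else 0

lemma multinomial_nonneg {k : ℕ} (n : ℕ) (v : Fin k → ℕ) : 0 ≤ multinomial n v := by
  unfold multinomial
  split_ifs <;> positivity

/-- The recursion that results from conditioning on the outcome `j` of the last trial. -/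
lemma multinomial_succ {k : ℕ} (n : ℕ) (v : Fin k → ℕ) :
    multinomial (n + 1) v = ∑ j, 1 / (k : ℝ) *
      if v j = 0 then 0 else multinomial n (Function.update v j (v j - 1)) := by
  have key : ∀ j, (if v j = 0 then (0 : ℝ) else multinomial n (Function.update v j (v j - 1))) =
      v j * (if ∑ j, v j = n + 1 then
        (n.factorial : ℝ) / (∏ j, ((v j).factorial : ℝ)) / k ^ n else 0) := by
    intro j
    split_ifs with h0 h1 h1
    · simp [h0]
    · simp [h0]
    · have hs : ∑ i, Function.update v j (v j - 1) i = n := by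
        rw [Finset.sum_update_of_mem (Finset.mem_univ j)]
        rw [← Finset.add_sum_erase _ _ (Finset.mem_univ j)] at h1
        rw [Finset.sdiff_singleton_eq_erase]
        omega
      rw [multinomial, if_pos hs]
      have hp : ∏ i, ((v i).factorial : ℝ) =
          v j * ∏ i, ((Function.update v j (v j - 1) i).factorial : ℝ) := by
        rw [← Finset.mul_prod_erase _ _ (Finset.mem_univ j),
          ← Finset.mul_prod_erase (Finset.univ) (fun i =>
            ((Function.update v j (v j - 1) i).factorial : ℝ)) (Finset.mem_univ j), ← mul_assoc]
        congr 1
        · rw [Function.update_self, ← Nat.cast_mul, Nat.mul_factorial_pred h0]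
        · refine Finset.prod_congr rfl fun i hi => ?_
          rw [Function.update_of_ne (Finset.ne_of_mem_erase hi)]
      have hv : (v j : ℝ) ≠ 0 := by exact_mod_cast h0
      rw [hp]
      have hq : ∏ i, ((Function.update v j (v j - 1) i).factorial : ℝ) ≠ 0 :=
        Finset.prod_ne_zero_iff.2 fun i _ => by positivity
      rcases eq_or_ne (k : ℝ) 0 with hk | hk
      · have : k = 0 := by exact_mod_cast hk
        exact absurd j.2 (by omega)
      · field_simp
    · have hs : ∑ i, Function.update v j (v j - 1) i ≠ n := by
        rw [Finset.sum_update_of_mem (Finset.mem_univ j)]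
        rw [← Finset.add_sum_erase _ _ (Finset.mem_univ j)] at h1
        rw [Finset.sdiff_singleton_eq_erase]
        omega
      rw [multinomial, if_neg hs, mul_zero]
  simp_rw [key, ← mul_assoc]
  rw [← Finset.sum_mul, ← Finset.mul_sum, multinomial]
  split_ifs with h
  · have : ∑ j, (v j : ℝ) = n + 1 := by exact_mod_cast h
    rw [this, Nat.factorial_succ, pow_succ]
    push_cast
    ring
  · simp

/-- The numbers of darts of the marks among the first `n` darts have a multinomial distribution. -/
lemma prob_count (hu : IsFullyRandom u P) [IsProbabilityMeasure P] {k : ℕ} (hk : 1 ≤ k) (c : Cell)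
    (n : ℕ) (v : Fin k → ℕ) :
    P {ω | ∀ j : Fin k, count (fun key => u key ω) k c j n = v j} =
      ENNReal.ofReal (multinomial n v) := by
  have hm : ∀ n (v : Fin k → ℕ),
      MeasurableSet {ω | ∀ j : Fin k, count (fun key => u key ω) k c j n = v j} := by
    intro n v
    simp only [Set.ofPred_forall]
    exact MeasurableSet.iInter fun j =>
      measurable_count hu.measurable k c j n (measurableSet_singleton _)
  induction n generalizing v with
  | zero =>
    by_cases h : ∀ j, v j = 0
    · simp [count, multinomial, h]
    · have h' : ¬ ∀ j, 0 = v j := fun h' => h fun j => (h' j).symm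
      simp [count, multinomial, h, h']
  | succ n ih =>
    have hml := measurable_mark hu.measurable k c n
    have hae : ∀ᵐ ω ∂P, mark (fun key => u key ω) k c n < k := by
      filter_upwards [ae_mark_lt hu hk] with ω h using h c n
    rw [measure_eq_sum_of_ae_lt hml hae, multinomial_succ,
      ENNReal.ofReal_sum_of_nonneg]
    swap
    · intro j _
      refine mul_nonneg (by positivity) ?_
      split_ifs
      exacts [le_rfl, multinomial_nonneg _ _]
    refine Finset.sum_congr rfl fun j _ => ?_
    rw [ENNReal.ofReal_mul (by positivity)]
    split_ifs with h0
    · rw [ENNReal.ofReal_zero, mul_zero, ← measure_empty (μ := P)]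
      congr 1
      ext ω
      simp only [Set.mem_inter_iff, Set.mem_ofPred_eq, Set.mem_empty_iff_false, iff_false, not_and,
        not_forall]
      intro h
      exact ⟨j, by rw [count_succ, if_pos h]; omega⟩
    · have hset : {ω | mark (fun key => u key ω) k c n = j} ∩
          {ω | ∀ j : Fin k, count (fun key => u key ω) k c j (n + 1) = v j} =
          (fun ω => draws (fun key => u key ω) k c (n + 1)) ⁻¹' {(j : ℕ)} ∩
          (fun ω (j : Fin k) => count (fun key => u key ω) k c j n) ⁻¹'
            {Function.update v j (v j - 1)} := by
        ext ω
        simp only [Set.mem_inter_iff, Set.mem_ofPred_eq, Set.mem_preimage, Set.mem_singleton_iff,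
          draws, funext_iff, count_succ]
        refine and_congr_right fun h => forall_congr' fun i => ?_
        rw [h]
        by_cases hij : i = j
        · subst hij
          simp
          omega
        · have : (j : ℕ) ≠ i := fun h => hij (Fin.ext h.symm)
          simp [hij, this]
      rw [hset, (indep_count_draw hu k c n (n + 1) (by simp)).measure_inter_preimage_eq_mul _ _
        (measurableSet_singleton _) (measurableSet_singleton _), ← prob_mark hu j.2 c n, ← ih]
      congr 2
      ext ω
      simp [funext_iff]

/-- Poisson splitting: the numbers of darts of the different marks in a cell are independent and
have the Poisson distribution of mean `1 / k`. -/
lemma map_counts (hu : IsFullyRandom u P) [IsProbabilityMeasure P] {k : ℕ} (hk : 1 ≤ k) (c : Cell) :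
    P.map (fun ω (j : Fin k) =>
      count (fun key => u key ω) k c j (total (fun key => u key ω) c)) =
    Measure.pi fun _ => poissonMeasure (1 / k) := by
  have hmt : Measurable fun ω (j : Fin k) =>
      count (fun key => u key ω) k c j (total (fun key => u key ω) c) :=
    measurable_pi_iff.2 fun j => measurable_count_total hu.measurable k c j
  refine Measure.ext_of_singleton fun v => ?_
  rw [Measure.map_apply hmt (measurableSet_singleton v), Measure.pi_singleton]
  simp only [poissonMeasure_singleton]
  rw [← ENNReal.ofReal_prod_of_nonneg (fun j _ => by positivity)]
  set n := ∑ j, v j with hn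
  have h1 : P ((fun ω (j : Fin k) => count (fun key => u key ω) k c j
        (total (fun key => u key ω) c)) ⁻¹' {v}) =
      P ((fun ω => draws (fun key => u key ω) k c 0) ⁻¹' {n} ∩
        (fun ω (j : Fin k) => count (fun key => u key ω) k c j n) ⁻¹' {v}) := by
    refine measure_congr ?_
    filter_upwards [ae_mark_lt hu hk] with ω hω
    have hsum : ∀ m, ∑ j : Fin k, count (fun key => u key ω) k c j m = m := by
      intro m
      induction m with
      | zero => simp [count]
      | succ m ih =>
        simp only [count_succ, Finset.sum_add_distrib, ih]
        congr 1
        rw [Finset.sum_eq_single ⟨mark (fun key => u key ω) k c m, hω c m⟩]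
        · simp
        · intro j _ hj
          rw [if_neg]
          exact fun h => hj (Fin.ext h.symm)
        · simp
    refine propext ?_
    change (fun j : Fin k => _) = v ↔ total (fun key => u key ω) c = n ∧ (fun j : Fin k => _) = v
    constructor
    · intro h
      have : total (fun key => u key ω) c = n := by
        rw [hn, ← h, hsum]
      exact ⟨this, by rw [← this]; exact h⟩
    · rintro ⟨h1, h2⟩
      rw [h1]; exact h2
  rw [h1, (indep_count_draw hu k c n 0 (by simp)).measure_inter_preimage_eq_mul _ _
        (measurableSet_singleton _) (measurableSet_singleton _)]
  have h2 := prob_total hu c n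
  have h3 := prob_count hu hk c n v
  have e2 : (fun ω => draws (fun key => u key ω) k c 0) ⁻¹' {n} =
    {ω | total (fun key => u key ω) c = n} := rfl
  have e3 : (fun ω (j : Fin k) => count (fun key => u key ω) k c j n) ⁻¹' {v} =
    {ω | ∀ j : Fin k, count (fun key => u key ω) k c j n = v j} := by
    ext ω; simp [funext_iff]
  rw [e2, e3, h2, h3, ← ENNReal.ofReal_mul (by positivity)]
  congr 1
  have hk0 : (k : ℝ) ≠ 0 := by positivity
  rw [multinomial, if_pos hn.symm, Finset.prod_div_distrib, Finset.prod_mul_distrib,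
    Finset.prod_pow_eq_pow_sum, ← hn]
  simp only [Finset.prod_const, Finset.card_univ, Fintype.card_fin, ← Real.exp_nat_mul]
  push_cast
  have : (k : ℝ) * -(1 / (k : ℝ)) = -1 := by field_simp
  rw [this]
  have h4 : (k : ℝ) ^ n * (1 / (k : ℝ)) ^ n = 1 := by rw [← mul_pow, mul_one_div_cancel hk0, one_pow]
  field_simp
  linarith

end

/-! ### Independence of the darts of different marks -/

section
variable {Ω : Type*} [MeasurableSpace Ω] {P : Measure Ω} {u : List ℕ → Ω → ℝ}

/-- The numbers of darts of the marks in a cell, as a function of the hash values they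
use: `v l` stands for the hash value of the key of `c` followed by `0 :: l`, and the five entries of
the key before `l` are dropped. -/
noncomputable def countsOf (k : ℕ) (c : Cell) (v : List ℕ → ℝ) (j : Fin k) : ℕ :=
  count (fun key => v (key.drop 5)) k c j (total (fun key => v (key.drop 5)) c)

lemma measurable_countsOf (k : ℕ) (c : Cell) : Measurable (countsOf k c) :=
  measurable_pi_iff.2 fun j => measurable_count_total
    (u := fun key (v : List ℕ → ℝ) => v (key.drop 5)) (fun _ => measurable_pi_apply _) k c j

lemma countsOf_eq (u : List ℕ → ℝ) (k : ℕ) (c : Cell) (j : Fin k) :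
    countsOf k c (fun l => u (c.key ++ 0 :: l)) j = count u k c j (total u c) := by
  rfl

lemma measurable_dataOf (hu : ∀ key, Measurable (u key)) (k j : ℕ) :
    Measurable fun ω => dataOf (fun key => u key ω) k j :=
  measurable_pi_iff.2 fun c => (measurable_count_total hu k c j).prodMk
    (measurable_pi_iff.2 fun _ => hu _)

variable [IsProbabilityMeasure P]

lemma map_count (hu : IsFullyRandom u P) {k : ℕ} (hk : 1 ≤ k) (c : Cell) {j : ℕ} (hj : j < k) :
    P.map (fun ω => (dataOf (fun key => u key ω) k j c).1) = poissonMeasure (1 / k) := by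
  have mN : Measurable fun ω (j : Fin k) =>
      count (fun key => u key ω) k c j (total (fun key => u key ω) c) :=
    measurable_pi_iff.2 fun j => measurable_count_total hu.measurable k c j
  have h := (measurePreserving_eval (fun _ : Fin k => poissonMeasure (1 / k)) ⟨j, hj⟩).map_eq
  rw [← map_counts hu hk c, Measure.map_map (measurable_pi_apply _) mN] at h
  exact h

/-- The numbers of darts in a cell are independent of their places: the keys of the former continue
the key of the cell by `0`, those of the latter by `j + 1`. -/
lemma indep_counts_places (hu : IsFullyRandom u P) (k : ℕ) (c : Cell) :
    IndepFun (fun ω (j : Fin k) => (dataOf (fun key => u key ω) k j c).1)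
      (fun ω (j : Fin k) => (dataOf (fun key => u key ω) k j c).2) P := by
  have h := (indep_blocks hu c).indepFun_finset {0} (Finset.Ioc 0 k) (by simp)
    fun o => measurable_pi_iff.2 fun l => hu.measurable _
  have m0 : Measurable fun f : ({0} : Finset ℕ) → List ℕ → ℝ => f ⟨0, by simp⟩ :=
    measurable_pi_apply _
  have m1 : Measurable fun (f : Finset.Ioc 0 k → List ℕ → ℝ) (j : Fin k) =>
      f ⟨(j : ℕ) + 1, by simp⟩ := measurable_pi_iff.2 fun j => measurable_pi_apply _
  have h2 := h.comp ((measurable_countsOf k c).comp m0) m1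
  refine h2.congr (.of_forall fun ω => funext fun j => ?_) .rfl
  exact countsOf_eq (fun key => u key ω) k c j

lemma indep_data_cell (hu : IsFullyRandom u P) {k : ℕ} (hk : 1 ≤ k) (c : Cell) :
    iIndepFun (fun (j : Fin k) ω => dataOf (fun key => u key ω) k j c) P := by
  set N : Ω → Fin k → ℕ := fun ω j => (dataOf (fun key => u key ω) k j c).1 with hN
  set V : Ω → Fin k → List ℕ → ℝ := fun ω j => (dataOf (fun key => u key ω) k j c).2 with hV
  have mN : Measurable N := measurable_pi_iff.2 fun j => measurable_count_total hu.measurable k c j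
  have mV : Measurable V := measurable_pi_iff.2 fun j => measurable_pi_iff.2 fun l =>
    hu.measurable _
  have mNj : ∀ j, Measurable fun ω => N ω j := fun j => (measurable_pi_apply j).comp mN
  have mVj : ∀ j, Measurable fun ω => V ω j := fun j => (measurable_pi_apply j).comp mV
  have hNV : IndepFun N V P := indep_counts_places hu k c
  have pNj : ∀ j, IsProbabilityMeasure (P.map fun ω => N ω j) :=
    fun j => Measure.isProbabilityMeasure_map (mNj j).aemeasurable
  have pVj : ∀ j, IsProbabilityMeasure (P.map fun ω => V ω j) :=
    fun j => Measure.isProbabilityMeasure_map (mVj j).aemeasurable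
  have hVi : iIndepFun (fun j ω => V ω j) P :=
    (indep_blocks hu c).precomp (g := fun j : Fin k => (j : ℕ) + 1)
      (fun a b h => Fin.ext (by simpa using h))
  have lV : P.map V = Measure.pi fun j => P.map fun ω => V ω j :=
    (iIndepFun_iff_map_fun_eq_pi_map fun j => (mVj j).aemeasurable).1 hVi
  have lN : P.map N = Measure.pi fun j => P.map fun ω => N ω j := by
    have h1 : ∀ j : Fin k, P.map (fun ω => N ω j) = poissonMeasure (1 / k) :=
      fun j => map_count hu hk c j.2
    simp_rw [h1]
    exact map_counts hu hk c
  have mD : ∀ j : Fin k, Measurable fun ω => dataOf (fun key => u key ω) k j c :=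
    fun j => (mNj j).prodMk (mVj j)
  rw [iIndepFun_iff_map_fun_eq_pi_map fun j => (mD j).aemeasurable]
  have hD : ∀ j : Fin k, P.map (fun ω => dataOf (fun key => u key ω) k j c) =
      (P.map fun ω => N ω j).prod (P.map fun ω => V ω j) := by
    intro j
    have := hNV.comp (measurable_pi_apply j) (measurable_pi_apply j)
    exact (indepFun_iff_map_prod_eq_prod_map_map (mNj j).aemeasurable (mVj j).aemeasurable).1 this
  simp_rw [hD]
  have h1 := (indepFun_iff_map_prod_eq_prod_map_map mN.aemeasurable mV.aemeasurable).1 hNV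
  have h2 := measurePreserving_arrowProdEquivProdArrow ℕ (List ℕ → ℝ) (Fin k)
    (fun j => P.map fun ω => N ω j) (fun j => P.map fun ω => V ω j)
  rw [lN, lV, ← h2.map_eq] at h1
  -- Transposing the two independent families turns the product of products into a product of pairs.
  have h3 := congrArg (Measure.map (MeasurableEquiv.arrowProdEquivProdArrow ℕ (List ℕ → ℝ)
    (Fin k)).symm) h1
  rw [MeasurableEquiv.map_symm_map, Measure.map_map (MeasurableEquiv.measurable _)
    (mN.prodMk mV)] at h3
  exact h3

lemma indep_data_pairs (hu : IsFullyRandom u P) {k : ℕ} (hk : 1 ≤ k) :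
    iIndepFun (fun (p : Cell × Fin k) ω => dataOf (fun key => u key ω) k p.2 p.1) P := by
  refine iIndepFun_uncurry' (X := fun (c : Cell) (j : Fin k) ω =>
    dataOf (fun key => u key ω) k j c) (fun c j => ?_) ?_ (indep_data_cell hu hk)
  · exact (measurable_pi_apply c).comp (measurable_dataOf hu.measurable k j)
  · refine (indep_cells hu).comp
      (fun c v (j : Fin k) => (countsOf k c (fun l => v (0 :: l)) j, fun l => v ((j + 1) :: l)))
      (fun c => measurable_pi_iff.2 fun j => ?_) |>.congr fun c => .of_forall fun ω => ?_
    · have m : ∀ o : ℕ, Measurable fun (v : List ℕ → ℝ) (l : List ℕ) => v (o :: l) :=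
        fun o => measurable_pi_iff.2 fun l => measurable_pi_apply _
      exact (((measurable_pi_apply j).comp (measurable_countsOf k c)).comp (m 0)).prodMk (m _)
    · funext j
      simp only [Function.comp]
      rw [countsOf_eq (fun key => u key ω) k c j]
      rfl

/-- The darts of different marks are independent. -/
lemma indep_data (hu : IsFullyRandom u P) {k : ℕ} (hk : 1 ≤ k) :
    iIndepFun (fun (j : Fin k) ω => dataOf (fun key => u key ω) k j) P := by
  have h : iIndepFun (fun (p : Fin k × Cell) ω => dataOf (fun key => u key ω) k p.1 p.2) P :=
    (indep_data_pairs hu hk).precomp (g := fun p : Fin k × Cell => (p.2, p.1))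
      (fun a b h => by simpa [Prod.ext_iff, and_comm] using h)
  have m : ∀ (j : Fin k) (c : Cell), Measurable fun ω => dataOf (fun key => u key ω) k j c :=
    fun j c => (measurable_pi_apply c).comp (measurable_dataOf hu.measurable k j)
  exact iIndepFun_curry m h

/-- The darts of a mark in different cells are independent. -/
lemma indep_data_cells (hu : IsFullyRandom u P) {k : ℕ} (hk : 1 ≤ k) {j : ℕ} (hj : j < k) :
    iIndepFun (fun (c : Cell) ω => dataOf (fun key => u key ω) k j c) P := by
  have h := indep_data_pairs hu hk
  have hg : Function.Injective fun c : Cell => (c, (⟨j, hj⟩ : Fin k)) :=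
    fun a b h => (Prod.mk.inj h).1
  exact h.precomp hg

end

/-! ### The tiling of the quadrant -/

section

namespace Cell

/-- The point of the tile with given relative positions, as a pair (weight, rank). -/
noncomputable def place (c : Cell) (p : ℝ × ℝ) : ℝ × ℝ := (c.weight p.1 p.2, c.rank p.1 p.2)

/-- The tile itself. -/
def tile (c : Cell) : Set (ℝ × ℝ) :=
  Set.Ico (c.weight 0 0) (c.weight 1 1) ×ˢ Set.Ico (c.rank 0 0) (c.rank 1 1)

lemma measurableSet_tile (c : Cell) : MeasurableSet c.tile :=
  measurableSet_Ico.prod measurableSet_Ico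

lemma long_mem_Ico_iff (c : Cell) (a : ℝ) :
    c.long a ∈ Set.Ico (c.long 0) (c.long 1) ↔ a ∈ Set.Ico (0 : ℝ) 1 := by
  have h : (0 : ℝ) < 2 ^ c.scale := by positivity
  simp [long, h]

lemma short_mem_Ico_iff (c : Cell) (a : ℝ) :
    c.short a ∈ Set.Ico (c.short 0) (c.short 1) ↔ a ∈ Set.Ico (0 : ℝ) 1 := by
  have h : (0 : ℝ) < 2 ^ c.scale := by positivity
  simp [short, div_le_div_iff_of_pos_right h, div_lt_div_iff_of_pos_right h]

lemma place_mem_tile_iff (c : Cell) (p : ℝ × ℝ) :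
    c.place p ∈ c.tile ↔ p ∈ Set.Ico (0 : ℝ) 1 ×ˢ Set.Ico (0 : ℝ) 1 := by
  have h1 := c.long_mem_Ico_iff p.1
  have h2 := c.short_mem_Ico_iff p.2
  rcases hc : c.heavy <;>
    simp only [place, tile, weight, rank, hc, Set.mem_prod, if_true, Bool.false_eq_true, if_false,
      h1, h2, and_comm]

/-- A tile has area one: the long side is scaled by `2 ^ scale` and the short side by its inverse. -/
lemma measurePreserving_place (c : Cell) : MeasurePreserving c.place := by
  have h : (0 : ℝ) < 2 ^ c.scale := by positivity
  have hl : Measurable c.long := by unfold long; fun_prop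
  have hs : Measurable c.short := by unfold short; fun_prop
  have ml : Measure.map c.long volume = ENNReal.ofReal (2 ^ c.scale)⁻¹ • volume := by
    have : c.long = (fun x => (2 ^ c.scale - 1) + x) ∘ (fun x => 2 ^ c.scale * x) := rfl
    rw [this, ← Measure.map_map (by fun_prop) (by fun_prop), Real.map_volume_mul_left h.ne',
      Measure.map_smul, (measurePreserving_add_left volume _).map_eq, abs_of_pos (inv_pos.2 h)]
  have ms : Measure.map c.short volume = ENNReal.ofReal (2 ^ c.scale) • volume := by
    have : c.short = (fun x => (2 ^ c.scale)⁻¹ * x) ∘ (fun x => (c.pos : ℝ) + x) := by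
      ext x; simp [short]; ring
    rw [this, ← Measure.map_map (by fun_prop) (by fun_prop),
      (measurePreserving_add_left volume _).map_eq, Real.map_volume_mul_left (inv_pos.2 h).ne',
      inv_inv, abs_of_pos h]
  have hc : ENNReal.ofReal (2 ^ c.scale)⁻¹ * ENNReal.ofReal (2 ^ c.scale) = 1 := by
    rw [← ENNReal.ofReal_mul (by positivity), inv_mul_cancel₀ h.ne', ENNReal.ofReal_one]
  have key : MeasurePreserving (Prod.map c.long c.short) := by
    refine ⟨hl.prodMap hs, ?_⟩
    have : SFinite (Measure.map c.long volume) := by rw [ml]; infer_instance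
    have : SFinite (Measure.map c.short volume) := by rw [ms]; infer_instance
    rw [Measure.volume_eq_prod, ← Measure.map_prod_map _ _ hl hs, ml, ms, Measure.prod_smul_left,
      Measure.prod_smul_right, smul_smul, hc, one_smul]
  rcases hv : c.heavy
  · have : c.place = Prod.swap ∘ Prod.map c.long c.short := by
      ext p <;> simp [place, weight, rank, hv]
    rw [this]
    exact Measure.measurePreserving_swap.comp key
  · have : c.place = Prod.map c.long c.short := by
      ext p <;> simp [place, weight, rank, hv]
    rw [this]
    exact key

lemma volume_preimage_place (c : Cell) {G : Set (ℝ × ℝ)} (hG : MeasurableSet G) :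
    volume (c.place ⁻¹' G ∩ Set.Ico (0 : ℝ) 1 ×ˢ Set.Ico (0 : ℝ) 1) = volume (G ∩ c.tile) := by
  rw [← c.measurePreserving_place.measure_preimage (hG.inter c.measurableSet_tile).nullMeasurableSet]
  congr 1
  ext p
  simp only [Set.mem_inter_iff, Set.mem_preimage, place_mem_tile_iff]

end Cell

lemma scale_unique {y : ℝ} {a b : ℕ} (h1 : (2 : ℝ) ^ a - 1 ≤ y) (h2 : y < 2 ^ a - 1 + 2 ^ a)
    (h3 : (2 : ℝ) ^ b - 1 ≤ y) (h4 : y < 2 ^ b - 1 + 2 ^ b) : a = b := by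
  have h5 : (2 : ℝ) ^ a < 2 ^ (b + 1) := by rw [pow_succ]; linarith
  have h6 : (2 : ℝ) ^ b < 2 ^ (a + 1) := by rw [pow_succ]; linarith
  rw [pow_lt_pow_iff_right₀ one_lt_two] at h5 h6
  omega

lemma exists_scale {y : ℝ} (hy : 0 ≤ y) : ∃ b : ℕ, (2 : ℝ) ^ b - 1 ≤ y ∧ y < 2 ^ b - 1 + 2 ^ b := by
  obtain ⟨n, h1, h2⟩ := exists_nat_pow_near (show (1 : ℝ) ≤ y + 1 by linarith) one_lt_two
  rw [pow_succ] at h2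
  exact ⟨n, by linarith, by linarith⟩

lemma pos_unique {y D : ℝ} (hD : 0 < D) {a b : ℕ} (h1 : (a : ℝ) / D ≤ y) (h2 : y < (a + 1) / D)
    (h3 : (b : ℝ) / D ≤ y) (h4 : y < (b + 1) / D) : a = b := by
  rw [div_le_iff₀ hD] at h1 h3
  rw [lt_div_iff₀ hD] at h2 h4
  have h5 : (a : ℝ) < b + 1 := by linarith
  have h6 : (b : ℝ) < a + 1 := by linarith
  norm_cast at h5 h6
  omega

lemma exists_pos {y D : ℝ} (hy : 0 ≤ y) (hD : 0 < D) :
    ∃ q : ℕ, (q : ℝ) / D ≤ y ∧ y < (q + 1) / D := by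
  refine ⟨⌊y * D⌋₊, ?_, ?_⟩
  · rw [div_le_iff₀ hD]
    exact Nat.floor_le (by positivity)
  · rw [lt_div_iff₀ hD]
    exact Nat.lt_floor_add_one _

lemma Cell.mem_tile_iff (c : Cell) (p : ℝ × ℝ) : p ∈ c.tile ↔
    if c.heavy then (((2 : ℝ) ^ c.scale - 1 ≤ p.1 ∧ p.1 < 2 ^ c.scale - 1 + 2 ^ c.scale) ∧
      (c.pos / 2 ^ c.scale ≤ p.2 ∧ p.2 < (c.pos + 1) / 2 ^ c.scale))
    else ((c.pos / 2 ^ c.scale ≤ p.1 ∧ p.1 < (c.pos + 1) / 2 ^ c.scale) ∧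
      ((2 : ℝ) ^ c.scale - 1 ≤ p.2 ∧ p.2 < 2 ^ c.scale - 1 + 2 ^ c.scale)) := by
  rcases h : c.heavy <;> simp [tile, weight, rank, long, short, h]

lemma Cell.Valid.le_fst {c : Cell} (hc : c.Valid) {p : ℝ × ℝ} (hp : p ∈ c.tile) :
    c.heavy = true ↔ 1 ≤ p.1 := by
  rw [Cell.mem_tile_iff] at hp
  rcases h : c.heavy
  · simp only [Valid, h, Bool.false_eq_true, if_false] at hc hp ⊢
    have : ((c.pos : ℝ) + 1) / 2 ^ c.scale ≤ 1 := by
      rw [div_le_one (by positivity)]; exact_mod_cast hc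
    simp only [false_iff, not_le]
    linarith [hp.1.2]
  · simp only [Valid, h, if_true] at hc hp ⊢
    have : (2 : ℝ) ^ 1 ≤ 2 ^ c.scale := pow_le_pow_right₀ one_le_two hc
    simp only [true_iff]
    linarith [hp.1.1]

/-- The tiles of an element are disjoint. -/
lemma Cell.Valid.eq_of_mem_tile {c c' : Cell} (hc : c.Valid) (hc' : c'.Valid)
    (he : c.elem = c'.elem) {p : ℝ × ℝ} (hp : p ∈ c.tile) (hp' : p ∈ c'.tile) : c = c' := by
  have hh : c.heavy = c'.heavy := by
    rw [Bool.eq_iff_iff, hc.le_fst hp, hc'.le_fst hp']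
  rw [Cell.mem_tile_iff] at hp hp'
  rw [← hh] at hp'
  have hs : c.scale = c'.scale := by
    rcases h : c.heavy <;> simp only [h, Bool.false_eq_true, if_false, if_true] at hp hp'
    exacts [scale_unique hp.2.1 hp.2.2 hp'.2.1 hp'.2.2, scale_unique hp.1.1 hp.1.2 hp'.1.1 hp'.1.2]
  rw [← hs] at hp'
  refine Cell.ext he hh hs ?_
  rcases h : c.heavy <;> simp only [h, Bool.false_eq_true, if_false, if_true] at hp hp'
  exacts [pos_unique (by positivity) hp.1.1 hp.1.2 hp'.1.1 hp'.1.2,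
    pos_unique (by positivity) hp.2.1 hp.2.2 hp'.2.1 hp'.2.2]

/-- The tiles of an element cover the quadrant. -/
lemma exists_mem_tile (i : ℕ) {p : ℝ × ℝ} (h1 : 0 ≤ p.1) (h2 : 0 ≤ p.2) :
    ∃ c : Cell, c.elem = i ∧ c.Valid ∧ p ∈ c.tile := by
  by_cases hp : 1 ≤ p.1
  · obtain ⟨b, hb⟩ := exists_scale h1
    obtain ⟨q, hq⟩ := exists_pos h2 (D := 2 ^ b) (by positivity)
    refine ⟨⟨i, true, b, q⟩, rfl, ?_, (Cell.mem_tile_iff _ _).2 ⟨hb, hq⟩⟩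
    rcases b with _ | b
    · norm_num at hb
      linarith
    · simp [Cell.Valid]
  · obtain ⟨b, hb⟩ := exists_scale h2
    obtain ⟨q, hq⟩ := exists_pos h1 (D := 2 ^ b) (by positivity)
    refine ⟨⟨i, false, b, q⟩, rfl, ?_, (Cell.mem_tile_iff _ _).2 ⟨hq, hb⟩⟩
    have := hq.1.trans_lt (not_le.1 hp)
    rw [div_lt_one (by positivity)] at this
    simpa [Cell.Valid] using by exact_mod_cast this

/-- The cells of an element that meet a bounded part of the quadrant are finite in number. -/
lemma finite_cells (d : ℕ) (x t : ℝ) :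
    {c : Cell | c.elem < d ∧ c.Valid ∧ c.weight 0 0 < x ∧ c.rank 0 0 < t}.Finite := by
  obtain ⟨B, hB⟩ := pow_unbounded_of_one_lt (max x t + 1) (one_lt_two (α := ℝ))
  obtain ⟨M, hM⟩ := exists_nat_gt (max x t * 2 ^ B)
  have hfin : (Set.Iio d ×ˢ (Set.univ : Set Bool) ×ˢ Set.Iio B ×ˢ Set.Iio M).Finite :=
    (Set.finite_Iio d).prod (Set.finite_univ.prod ((Set.finite_Iio B).prod (Set.finite_Iio M)))
  refine (hfin.preimage (f := fun c : Cell => (c.elem, c.heavy, c.scale, c.pos)) ?_).subset ?_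
  · intro a _ b _ h
    simpa [Cell.ext_iff] using h
  · rintro c ⟨h1, -, h3, h4⟩
    obtain ⟨hl, hs⟩ : c.long 0 < max x t ∧ c.short 0 < max x t := by
      unfold Cell.weight at h3
      unfold Cell.rank at h4
      split_ifs at h3 h4
      exacts [⟨h3.trans_le (le_max_left _ _), h4.trans_le (le_max_right _ _)⟩,
        ⟨h4.trans_le (le_max_right _ _), h3.trans_le (le_max_left _ _)⟩]
    have hb : c.scale < B := by
      rw [← pow_lt_pow_iff_right₀ (one_lt_two (α := ℝ))]
      simp only [Cell.long, mul_zero, add_zero] at hl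
      linarith
    refine ⟨h1, trivial, hb, ?_⟩
    simp only [Cell.short, add_zero] at hs
    rw [div_lt_iff₀ (by positivity)] at hs
    have h0 : 0 ≤ max x t := by
      have : (0 : ℝ) ≤ c.pos / 2 ^ c.scale := by positivity
      rw [← div_lt_iff₀ (by positivity)] at hs
      linarith
    have : max x t * 2 ^ c.scale ≤ max x t * 2 ^ B :=
      mul_le_mul_of_nonneg_left (pow_le_pow_right₀ one_le_two hb.le) h0
    have : (c.pos : ℝ) < M := by linarith
    exact_mod_cast this

end

/-! ### The probability that a region holds no dart -/

section
variable {Ω : Type*} [MeasurableSpace Ω] {P : Measure Ω} {u : List ℕ → Ω → ℝ}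

lemma measure_eq_tsum (P : Measure Ω) {f : Ω → ℕ} (hf : Measurable f) (A : Set Ω) :
    P A = ∑' n, P (f ⁻¹' {n} ∩ A) := by
  have h := measure_iUnion (μ := P.restrict A) (f := fun n => f ⁻¹' {n})
    (fun i j hij => Disjoint.preimage _ (by simpa using hij))
    (fun n => hf (measurableSet_singleton n))
  have h2 : ⋃ n, f ⁻¹' {n} = Set.univ := by ext; simp
  rw [h2, Measure.restrict_apply_univ] at h
  rw [h]
  exact tsum_congr fun n => Measure.restrict_apply (hf (measurableSet_singleton n))

/-- The relative position in its tile of dart number `m` of a mark in a cell. -/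
def relPos (v : List ℕ → ℝ) (m : ℕ) : ℝ × ℝ := (v [m, 0], v [m, 1])

lemma measurable_relPos (m : ℕ) : Measurable fun v => relPos v m :=
  (measurable_pi_apply _).prodMk (measurable_pi_apply _)

lemma Cell.measurable_place (c : Cell) : Measurable c.place := c.measurePreserving_place.measurable

variable [IsProbabilityMeasure P]

lemma indep_relPos (hu : IsFullyRandom u P) (k j : ℕ) (c : Cell) :
    iIndepFun (fun m ω => relPos (dataOf (fun key => u key ω) k j c).2 m) P := by
  have h := iIndepFun_curry (P := P) (X := fun (m : ℕ) (l : List ℕ) ω =>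
    u (c.key ++ (j + 1) :: m :: l) ω) (fun m l => hu.measurable _)
    (hu.indep.precomp (g := fun p : ℕ × List ℕ => c.key ++ (j + 1) :: p.1 :: p.2) fun p q h => by
      simpa [Prod.ext_iff] using h)
  exact h.comp (fun _ v => (v [0], v [1])) fun m =>
    (measurable_pi_apply _).prodMk (measurable_pi_apply _)

lemma map_relPos (hu : IsFullyRandom u P) (k j : ℕ) (c : Cell) (m : ℕ) :
    P.map (fun ω => relPos (dataOf (fun key => u key ω) k j c).2 m) =
      volume.restrict (Set.Ico (0 : ℝ) 1 ×ˢ Set.Ico (0 : ℝ) 1) := by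
  have h : IndepFun (u (c.key ++ [j + 1, m, 0])) (u (c.key ++ [j + 1, m, 1])) P :=
    hu.indep.indepFun (by simp)
  have h2 := (indepFun_iff_map_prod_eq_prod_map_map (hu.measurable _).aemeasurable
    (hu.measurable _).aemeasurable).1 h
  rw [map_uniform hu, map_uniform hu, Measure.prod_restrict] at h2
  exact h2

lemma prob_relPos_notMem (hu : IsFullyRandom u P) (k j : ℕ) (c : Cell) {A : Set (ℝ × ℝ)}
    (hA : MeasurableSet A) (n : ℕ) :
    P {ω | ∀ m < n, relPos (dataOf (fun key => u key ω) k j c).2 m ∉ A} =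
      ENNReal.ofReal
        ((1 - volume.real (A ∩ Set.Ico (0 : ℝ) 1 ×ˢ Set.Ico (0 : ℝ) 1)) ^ n) := by
  set Q : Set (ℝ × ℝ) := Set.Ico (0 : ℝ) 1 ×ˢ Set.Ico (0 : ℝ) 1 with hQ
  have hQ1 : volume Q = 1 := by
    rw [hQ, Measure.volume_eq_prod, Measure.prod_prod]; simp
  have : IsProbabilityMeasure (volume.restrict Q) := ⟨by simp [hQ1]⟩
  have hm : ∀ m, Measurable fun ω => relPos (dataOf (fun key => u key ω) k j c).2 m := by
    intro m
    exact (hu.measurable _).prodMk (hu.measurable _)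
  have h := (indep_relPos hu k j c).meas_biInter (S := Finset.range n)
    (s := fun m => (fun ω => relPos (dataOf (fun key => u key ω) k j c).2 m) ⁻¹' Aᶜ)
    (fun m _ => ⟨Aᶜ, hA.compl, rfl⟩)
  have h1 : ∀ m, P ((fun ω => relPos (dataOf (fun key => u key ω) k j c).2 m) ⁻¹' Aᶜ) =
      ENNReal.ofReal (1 - volume.real (A ∩ Q)) := by
    intro m
    rw [← Measure.map_apply (hm m) hA.compl, map_relPos hu, prob_compl_eq_one_sub hA,
      Measure.restrict_apply hA, ENNReal.ofReal_sub _ measureReal_nonneg, ENNReal.ofReal_one,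
      measureReal_def, ENNReal.ofReal_toReal]
    exact ((measure_mono Set.inter_subset_right).trans_lt (hQ1 ▸ ENNReal.one_lt_top)).ne
  simp_rw [h1, Finset.prod_const, Finset.card_range] at h
  have hle : volume.real (A ∩ Q) ≤ 1 := by
    have := measureReal_mono (μ := volume) (Set.inter_subset_right : A ∩ Q ⊆ Q) (by simp [hQ1])
    rwa [measureReal_def (s := Q), hQ1, ENNReal.toReal_one] at this
  rw [ENNReal.ofReal_pow (by linarith), ← h]
  congr 1
  ext ω
  simp

/-- The number of darts of a mark in a part of a cell has a Poisson distribution. Only the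
probability of the value zero is needed. -/
lemma prob_cell_void (hu : IsFullyRandom u P) {k : ℕ} (hk : 1 ≤ k) {j : ℕ} (hj : j < k) (c : Cell)
    {G : Set (ℝ × ℝ)} (hG : MeasurableSet G) :
    P {ω | ∀ m < (dataOf (fun key => u key ω) k j c).1,
        c.place (relPos (dataOf (fun key => u key ω) k j c).2 m) ∉ G} =
      ENNReal.ofReal (Real.exp (-(volume.real (G ∩ c.tile) / k))) := by
  set g := volume.real (G ∩ c.tile) with hg
  have hg' : volume.real (c.place ⁻¹' G ∩ Set.Ico (0 : ℝ) 1 ×ˢ Set.Ico (0 : ℝ) 1) = g := by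
    rw [measureReal_def, c.volume_preimage_place hG]; rfl
  have hg1 : g ≤ 1 := by
    have h1 : volume (Set.Ico (0 : ℝ) 1 ×ˢ Set.Ico (0 : ℝ) 1) = 1 := by
      rw [Measure.volume_eq_prod, Measure.prod_prod]; simp
    rw [← hg']
    have := measureReal_mono (μ := volume) (Set.inter_subset_right :
      c.place ⁻¹' G ∩ Set.Ico (0 : ℝ) 1 ×ˢ Set.Ico (0 : ℝ) 1 ⊆ _) (by simp [h1])
    rwa [measureReal_def (s := Set.Ico (0 : ℝ) 1 ×ˢ Set.Ico (0 : ℝ) 1), h1, ENNReal.toReal_one]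
      at this
  have mN : Measurable fun ω => (dataOf (fun key => u key ω) k j c).1 :=
    measurable_count_total hu.measurable k c j
  have hind : IndepFun (fun ω => (dataOf (fun key => u key ω) k j c).1)
      (fun ω => (dataOf (fun key => u key ω) k j c).2) P :=
    (indep_counts_places hu k c).comp (measurable_pi_apply (⟨j, hj⟩ : Fin k))
      (measurable_pi_apply (⟨j, hj⟩ : Fin k))
  have hterm : ∀ n : ℕ, P ((fun ω => (dataOf (fun key => u key ω) k j c).1) ⁻¹' {n} ∩
      {ω | ∀ m < (dataOf (fun key => u key ω) k j c).1,
        c.place (relPos (dataOf (fun key => u key ω) k j c).2 m) ∉ G}) =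
      ENNReal.ofReal (Real.exp (-(1 / k)) * (1 / k) ^ n / n.factorial * (1 - g) ^ n) := by
    intro n
    have e : (fun ω => (dataOf (fun key => u key ω) k j c).1) ⁻¹' {n} ∩
        {ω | ∀ m < (dataOf (fun key => u key ω) k j c).1,
          c.place (relPos (dataOf (fun key => u key ω) k j c).2 m) ∉ G} =
        (fun ω => (dataOf (fun key => u key ω) k j c).1) ⁻¹' {n} ∩
        (fun ω => (dataOf (fun key => u key ω) k j c).2) ⁻¹'
          {v | ∀ m < n, relPos v m ∉ c.place ⁻¹' G} := by
      ext ω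
      simp only [Set.mem_inter_iff, Set.mem_preimage, Set.mem_singleton_iff, Set.mem_ofPred_eq]
      constructor <;> rintro ⟨rfl, h⟩ <;> exact ⟨rfl, h⟩
    have hms : MeasurableSet {v | ∀ m < n, relPos v m ∉ c.place ⁻¹' G} := by
      simp only [Set.ofPred_forall]
      exact MeasurableSet.iInter fun m => MeasurableSet.iInter fun _ =>
        (measurable_relPos m (c.measurable_place hG)).compl
    rw [e, hind.measure_inter_preimage_eq_mul _ _ (measurableSet_singleton _) hms,
      ← Measure.map_apply mN (measurableSet_singleton _), map_count hu hk c hj,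
      poissonMeasure_singleton]
    have h2 := prob_relPos_notMem hu k j c (c.measurable_place hG) n
    rw [hg'] at h2
    have e2 : (fun ω => (dataOf (fun key => u key ω) k j c).2) ⁻¹'
        {v | ∀ m < n, relPos v m ∉ c.place ⁻¹' G} =
        {ω | ∀ m < n, relPos (dataOf (fun key => u key ω) k j c).2 m ∉ c.place ⁻¹' G} := rfl
    rw [e2, h2, ← ENNReal.ofReal_mul (by positivity)]
    push_cast
    rfl
  rw [measure_eq_tsum P mN]
  simp_rw [hterm]
  have hsum := (hasSum_one_poissonMeasure (Real.toNNReal ((1 - g) / k))).mul_left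
    (Real.exp (-(g / k)))
  have hnn : (0 : ℝ) ≤ (1 - g) / k := div_nonneg (by linarith) (by positivity)
  rw [Real.coe_toNNReal _ hnn, mul_one] at hsum
  have heq : (fun n : ℕ => Real.exp (-(g / k)) *
      (Real.exp (-((1 - g) / k)) * ((1 - g) / k) ^ n / n.factorial)) =
      fun n : ℕ => Real.exp (-(1 / k)) * (1 / k) ^ n / n.factorial * (1 - g) ^ n := by
    funext n
    have : Real.exp (-(1 / k)) = Real.exp (-(g / k)) * Real.exp (-((1 - g) / k)) := by
      rw [← Real.exp_add]; congr 1; ring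
    rw [this, div_pow (1 - g), div_pow 1]
    ring
  rw [heq] at hsum
  rw [← ENNReal.ofReal_tsum_of_nonneg _ hsum.summable, hsum.tsum_eq]
  intro n
  have : (0 : ℝ) ≤ 1 - g := by linarith
  positivity

/-- No dart of `D` lies in the region `G`, which is a part of the quadrant of each element. -/
def Void (D : Data) (G : ℕ → Set (ℝ × ℝ)) : Prop :=
  ∀ δ : Dart, δ.1.Valid → δ.2 < (D δ.1).1 → (D.weight δ, D.rank δ) ∉ G δ.1.elem

lemma weight_zero_le {c : Cell} {a b : ℝ} (ha : 0 ≤ a) (hb : 0 ≤ b) :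
    c.weight 0 0 ≤ c.weight a b := by
  have h : (0 : ℝ) < 2 ^ c.scale := by positivity
  unfold Cell.weight Cell.long Cell.short
  split_ifs
  · nlinarith
  · gcongr

lemma rank_zero_le {c : Cell} {a b : ℝ} (ha : 0 ≤ a) (hb : 0 ≤ b) :
    c.rank 0 0 ≤ c.rank a b := by
  have h : (0 : ℝ) < 2 ^ c.scale := by positivity
  unfold Cell.rank Cell.long Cell.short
  split_ifs
  · gcongr
  · nlinarith

/-- The darts of mark `j` form a Poisson process of rate `1 / k`. Only the probability that a bounded
region holds no dart is needed; it is the product over the cells that meet the region. -/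
lemma prob_void (hu : IsFullyRandom u P) {k : ℕ} (hk : 1 ≤ k) {j : ℕ} (hj : j < k) {d : ℕ} {x t : ℝ}
    {G : ℕ → Set (ℝ × ℝ)} (hG : ∀ i, MeasurableSet (G i)) (hGd : ∀ i, d ≤ i → G i = ∅)
    (hGb : ∀ i, G i ⊆ Set.Ico 0 x ×ˢ Set.Ico 0 t) :
    P {ω | Void (dataOf (fun key => u key ω) k j) G} =
      ENNReal.ofReal (Real.exp (-((∑ i ∈ Finset.range d, volume.real (G i)) / k))) := by
  classical
  set V := (finite_cells d x t).toFinset with hV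
  have h1 : P {ω | Void (dataOf (fun key => u key ω) k j) G} =
      P (⋂ c ∈ V, {ω | ∀ m < (dataOf (fun key => u key ω) k j c).1,
        c.place (relPos (dataOf (fun key => u key ω) k j c).2 m) ∉ G c.elem}) := by
    refine measure_congr ?_
    filter_upwards [ae_mem_Ico hu] with ω hω
    refine propext ?_
    change Void (dataOf (fun key => u key ω) k j) G ↔ ω ∈ ⋂ c ∈ V, _
    simp only [Set.mem_iInter, Set.mem_ofPred_eq, hV, Set.Finite.mem_toFinset]
    constructor
    · rintro h c ⟨-, hc, -⟩ m hm
      exact h (c, m) hc hm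
    · rintro h ⟨c, m⟩ hc hm hmem
      have hb := hGb _ hmem
      have hd : c.elem < d := by
        by_contra hd
        rw [hGd c.elem (not_lt.1 hd)] at hmem
        exact hmem
      refine h c ⟨hd, hc, ?_, ?_⟩ m hm hmem
      · exact (weight_zero_le (hω _).1 (hω _).1).trans_lt hb.1.2
      · exact (rank_zero_le (hω _).1 (hω _).1).trans_lt hb.2.2
  have hms : ∀ c : Cell, MeasurableSet {D : ℕ × (List ℕ → ℝ) |
      ∀ m < D.1, c.place (relPos D.2 m) ∉ G c.elem} := by
    intro c
    have : {D : ℕ × (List ℕ → ℝ) | ∀ m < D.1, c.place (relPos D.2 m) ∉ G c.elem} =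
        ⋂ m : ℕ, ({D | m < D.1}ᶜ ∪ (fun D => c.place (relPos D.2 m)) ⁻¹' (G c.elem)ᶜ) := by
      ext D
      simp only [Set.mem_ofPred_eq, Set.mem_iInter, Set.mem_union, Set.mem_compl_iff,
        Set.mem_preimage, imp_iff_not_or]
    rw [this]
    refine MeasurableSet.iInter fun m => ((measurableSet_lt measurable_const
      measurable_fst).compl).union ?_
    exact (c.measurable_place.comp ((measurable_relPos m).comp measurable_snd)) (hG _).compl
  have h2 := (indep_data_cells hu hk hj).meas_biInter (S := V)
    (s := fun c => {ω | ∀ m < (dataOf (fun key => u key ω) k j c).1,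
        c.place (relPos (dataOf (fun key => u key ω) k j c).2 m) ∉ G c.elem})
    (fun c _ => ⟨_, hms c, rfl⟩)
  rw [h1, h2]
  simp_rw [prob_cell_void hu hk hj _ (hG _)]
  rw [← ENNReal.ofReal_prod_of_nonneg (fun _ _ => (Real.exp_pos _).le), ← Real.exp_sum,
    Finset.sum_neg_distrib, ← Finset.sum_div]
  congr 4
  have hmaps : ∀ c ∈ V, c.elem ∈ Finset.range d := by
    intro c hc
    rw [hV, Set.Finite.mem_toFinset] at hc
    exact Finset.mem_range.2 hc.1
  rw [← Finset.sum_fiberwise_of_maps_to hmaps]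
  refine Finset.sum_congr rfl fun i hi => ?_
  have hcover : G i = ⋃ c ∈ V.filter fun c => c.elem = i, (G i ∩ c.tile) := by
    ext p
    simp only [Set.mem_iUnion, Set.mem_inter_iff, Finset.mem_filter, exists_prop]
    constructor
    · intro hp
      have hb := hGb i hp
      obtain ⟨c, hci, hcv, hct⟩ := exists_mem_tile i hb.1.1 hb.2.1
      refine ⟨c, ⟨?_, hci⟩, hp, hct⟩
      rw [hV, Set.Finite.mem_toFinset]
      exact ⟨hci ▸ Finset.mem_range.1 hi, hcv, hct.1.1.trans_lt hb.1.2, hct.2.1.trans_lt hb.2.2⟩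
    · rintro ⟨c, -, hp, -⟩
      exact hp
  have hfin : volume (G i) ≠ ∞ := by
    refine ((measure_mono (hGb i)).trans_lt ?_).ne
    rw [Measure.volume_eq_prod, Measure.prod_prod]
    simp [ENNReal.mul_lt_top]
  conv_rhs => rw [hcover]
  rw [measureReal_biUnion_finset]
  · refine Finset.sum_congr rfl fun c hc => ?_
    rw [(Finset.mem_filter.1 hc).2]
  · intro c hc c' hc' hne
    refine Set.disjoint_left.2 fun p hp hp' => hne ?_
    simp only [Finset.coe_filter, hV, Set.Finite.mem_toFinset, Set.mem_ofPred_eq] at hc hc'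
    exact hc.1.2.1.eq_of_mem_tile hc'.1.2.1 (hc.2.trans hc'.2.symm) hp.2 hp'.2
  · exact fun c _ => (hG i).inter c.measurableSet_tile

end

/-! ### A race of two exponential clocks -/

section

/-- Two clocks with independent exponential alarm times of rates `a` and `b`, where `A s` is the
event that the first rings at `s` or later, and `B t` that the second rings at `t` or later. The
first rings before the second with probability at least `a / (a + b)`. -/
lemma race {Ω : Type*} [MeasurableSpace Ω] {P : Measure Ω} [IsProbabilityMeasure P]
    {A B : ℝ → Set Ω} {a b : ℝ} (ha : 0 ≤ a) (hab : 0 < a + b)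
    (mA : ∀ t, MeasurableSet (A t)) (mB : ∀ t, MeasurableSet (B t)) (hA : Antitone A)
    (h : ∀ s t, 0 ≤ s → 0 ≤ t → P.real (A s ∩ B t) = Real.exp (-(a * s + b * t)))
    {E : Set Ω} (hE : ∀ t, B t \ A t ⊆ E) : a / (a + b) ≤ P.real E := by
  -- The events that the first clock rings in a given time slot of length `δ` and the second after
  -- that slot are disjoint, and their probabilities form a geometric series.
  have key : ∀ δ : ℝ, 0 < δ → a * (1 - b * δ) ≤ (a + b) * (1 + a * δ) * P.real E := by
    intro δ hδ
    set r := Real.exp (-((a + b) * δ)) with hr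
    have hr1 : r < 1 := by
      rw [hr, Real.exp_lt_one_iff, neg_lt_zero]; positivity
    have hr0 : 0 < r := Real.exp_pos _
    set S : ℕ → Set Ω := fun q => (A (q * δ) ∩ B ((q + 1) * δ)) \
      (A ((q + 1) * δ) ∩ B ((q + 1) * δ)) with hS
    have mS : ∀ q, MeasurableSet (S q) := fun q =>
      MeasurableSet.diff ((mA _).inter (mB _)) ((mA _).inter (mB _))
    have hSP : ∀ q, P.real (S q) = (1 - Real.exp (-(a * δ))) * Real.exp (-(b * δ)) * r ^ q := by
      intro q
      rw [hS]
      dsimp only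
      rw [measureReal_sdiff (Set.inter_subset_inter_left _ (hA (by nlinarith)))
        ((mA _).inter (mB _)), h _ _ (by positivity) (by positivity),
        h _ _ (by positivity) (by positivity), hr, ← Real.exp_nat_mul, sub_mul, sub_mul,
        one_mul, ← Real.exp_add, ← Real.exp_add, ← Real.exp_add]
      congr 2 <;> ring
    have hdisj : ∀ n : ℕ, Set.PairwiseDisjoint (↑(Finset.range n)) S := by
      intro n q _ q' _ hne
      wlog hlt : q < q' generalizing q q'
      · exact (this ‹_› ‹_› hne.symm (by omega)).symm
      refine Set.disjoint_left.2 fun ω hω hω' => hω.2 ⟨hA ?_ hω'.1.1, hω.1.2⟩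
      have : (q : ℝ) + 1 ≤ q' := by exact_mod_cast hlt
      nlinarith
    have hsub : ∀ q, S q ⊆ E := fun q ω hω =>
      hE ((q + 1) * δ) ⟨hω.1.2, fun hA' => hω.2 ⟨hA', hω.1.2⟩⟩
    have hsum := (hasSum_geometric_of_lt_one hr0.le hr1).mul_left
      ((1 - Real.exp (-(a * δ))) * Real.exp (-(b * δ)))
    have hnn : 0 ≤ 1 - Real.exp (-(a * δ)) := by
      rw [sub_nonneg, Real.exp_le_one_iff, neg_nonpos]; positivity
    have hle : (1 - Real.exp (-(a * δ))) * Real.exp (-(b * δ)) * (1 - r)⁻¹ ≤ P.real E := by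
      rw [← hsum.tsum_eq]
      refine Real.tsum_le_of_sum_range_le (fun q => by positivity) fun n => ?_
      rw [← Finset.sum_congr rfl fun q _ => hSP q,
        ← measureReal_biUnion_finset (hdisj n) fun q _ => mS q]
      exact measureReal_mono (Set.iUnion₂_subset fun q _ => hsub q)
    have h1r : 0 < 1 - r := by linarith
    rw [← div_eq_mul_inv, div_le_iff₀ h1r] at hle
    have e1 : a * δ ≤ (1 + a * δ) * (1 - Real.exp (-(a * δ))) := by
      have h1 := Real.add_one_le_exp (a * δ)
      have h2 : Real.exp (a * δ) * Real.exp (-(a * δ)) = 1 := by rw [← Real.exp_add]; simp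
      have h3 := Real.exp_pos (-(a * δ))
      nlinarith
    have e2 : 1 - b * δ ≤ Real.exp (-(b * δ)) := by linarith [Real.add_one_le_exp (-(b * δ))]
    have e3 : 1 - r ≤ (a + b) * δ := by linarith [Real.add_one_le_exp (-((a + b) * δ))]
    have hp : 0 ≤ P.real E := measureReal_nonneg
    have haδ : 0 ≤ a * δ := by positivity
    have e4 : a * δ * (1 - b * δ) ≤
        (1 + a * δ) * ((1 - Real.exp (-(a * δ))) * Real.exp (-(b * δ))) := by
      calc a * δ * (1 - b * δ) ≤ a * δ * Real.exp (-(b * δ)) := by gcongr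
        _ ≤ (1 + a * δ) * (1 - Real.exp (-(a * δ))) * Real.exp (-(b * δ)) := by gcongr
        _ = _ := by ring
    have e5 : a * δ * (1 - b * δ) ≤ (1 + a * δ) * (P.real E * ((a + b) * δ)) := by
      exact e4.trans (mul_le_mul_of_nonneg_left
        (hle.trans (mul_le_mul_of_nonneg_left e3 hp)) (by linarith))
    have e6 : δ * (a * (1 - b * δ)) ≤ δ * ((a + b) * (1 + a * δ) * P.real E) := by linarith
    exact le_of_mul_le_mul_left e6 hδ
  have hlim : a * (1 - b * 0) ≤ (a + b) * (1 + a * 0) * P.real E := by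
    refine le_of_tendsto_of_tendsto (b := nhdsWithin (0 : ℝ) (Set.Ioi 0))
      (f := fun δ => a * (1 - b * δ)) (g := fun δ => (a + b) * (1 + a * δ) * P.real E)
      (Continuous.tendsto (by fun_prop) 0 |>.mono_left nhdsWithin_le_nhds)
      (Continuous.tendsto (by fun_prop) 0 |>.mono_left nhdsWithin_le_nhds) ?_
    filter_upwards [self_mem_nhdsWithin] with δ hδ using key δ hδ
  rw [div_le_iff₀ hab]
  linarith

/-! ### The dart of least rank -/

/-- `δ` is the dart of least rank among those below the weights `X`. -/
def IsWinner (D : Data) (X : ℕ → ℝ) (δ : Dart) : Prop :=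
  δ ∈ D.darts X ∧ ∀ δ' ∈ D.darts X, δ' ≠ δ → D.rank δ < D.rank δ'

lemma IsWinner.unique {D X δ δ'} (h : IsWinner D X δ) (h' : IsWinner D X δ') : δ = δ' := by
  by_contra hne
  exact lt_asymm (h.2 _ h'.1 (Ne.symm hne)) (h'.2 _ h.1 hne)

open Classical in
/-- The weighted minhash: the identifier of the dart of least rank, or zero if there is none. -/
noncomputable def minHash (D : Data) (X : ℕ → ℝ) : Fin 5 → ℕ :=
  if h : ∃ δ, IsWinner D X δ then Dart.id h.choose else 0

lemma IsWinner.minHash_eq {D X δ} (h : IsWinner D X δ) : minHash D X = Dart.id δ := by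
  have h' : ∃ δ, IsWinner D X δ := ⟨δ, h⟩
  rw [minHash, dif_pos h', h'.choose_spec.unique h]

lemma Dart.id_injective : Function.Injective Dart.id := by
  rintro ⟨⟨i, h, b, q⟩, m⟩ ⟨⟨i', h', b', q'⟩, m'⟩ he
  have e0 := congrFun he 0
  have e1 := congrFun he 1
  have e2 := congrFun he 2
  have e3 := congrFun he 3
  have e4 := congrFun he 4
  simp [Dart.id] at e0 e1 e2 e3 e4
  subst e0 e2 e3 e4
  revert e1
  cases h <;> cases h' <;> simp

lemma measurable_weight_rank (δ : Dart) : Measurable fun D : Data => (D.weight δ, D.rank δ) :=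
  δ.1.measurable_place.comp ((measurable_relPos δ.2).comp
    (measurable_snd.comp (measurable_pi_apply δ.1)))

lemma measurable_weight (δ : Dart) : Measurable fun D : Data => D.weight δ :=
  measurable_fst.comp (measurable_weight_rank δ)

lemma measurable_rank (δ : Dart) : Measurable fun D : Data => D.rank δ :=
  measurable_snd.comp (measurable_weight_rank δ)

lemma measurableSet_present (δ : Dart) : MeasurableSet {D : Data | δ.2 < (D δ.1).1} :=
  measurableSet_lt measurable_const (measurable_fst.comp (measurable_pi_apply δ.1))

lemma measurableSet_mem_darts (X : ℕ → ℝ) (δ : Dart) : MeasurableSet {D : Data | δ ∈ D.darts X} :=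
  (MeasurableSet.const _).inter ((measurableSet_present δ).inter
    (measurableSet_lt (measurable_weight δ) measurable_const))

lemma measurableSet_isWinner (X : ℕ → ℝ) (δ : Dart) :
    MeasurableSet {D : Data | IsWinner D X δ} := by
  have : {D : Data | IsWinner D X δ} = {D | δ ∈ D.darts X} ∩
      ⋂ δ' : Dart, ({D | δ' ∈ D.darts X}ᶜ ∪ {_D | δ' = δ} ∪ {D | D.rank δ < D.rank δ'}) := by
    ext D
    simp only [IsWinner, Set.mem_ofPred_eq, Set.mem_inter_iff, Set.mem_iInter, Set.mem_union,
      Set.mem_compl_iff]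
    refine and_congr_right fun _ => forall_congr' fun δ' => ?_
    tauto
  rw [this]
  refine (measurableSet_mem_darts X δ).inter (MeasurableSet.iInter fun δ' => ?_)
  exact ((measurableSet_mem_darts X δ').compl.union (.const _)).union
    (measurableSet_lt (measurable_rank δ) (measurable_rank δ'))

lemma measurable_minHash (X : ℕ → ℝ) : Measurable fun D => minHash D X := by
  refine measurable_to_countable' fun v => ?_
  have : (fun D => minHash D X) ⁻¹' {v} =
      (⋃ (δ : Dart) (_ : Dart.id δ = v), {D | IsWinner D X δ}) ∪
        ({_D | v = 0} ∩ ⋂ δ : Dart, {D | IsWinner D X δ}ᶜ) := by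
    ext D
    simp only [Set.mem_preimage, Set.mem_singleton_iff, Set.mem_union, Set.mem_iUnion,
      Set.mem_inter_iff, Set.mem_iInter, Set.mem_compl_iff, Set.mem_ofPred_eq, exists_prop]
    by_cases h : ∃ δ, IsWinner D X δ
    · obtain ⟨δ, hδ⟩ := h
      rw [hδ.minHash_eq]
      constructor
      · exact fun h => .inl ⟨δ, h, hδ⟩
      · rintro (⟨δ', h1, h2⟩ | ⟨-, h⟩)
        exacts [by rw [hδ.unique h2, h1], absurd hδ (h δ)]
    · rw [minHash, dif_neg h]
      push Not at h
      constructor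
      · exact fun hv => .inr ⟨hv.symm, h⟩
      · rintro (⟨δ', -, h2⟩ | ⟨hv, -⟩)
        exacts [absurd h2 (h δ'), hv.symm]
  rw [this]
  refine MeasurableSet.union ?_ (MeasurableSet.inter (.const _) ?_)
  · exact MeasurableSet.iUnion fun δ => MeasurableSet.iUnion fun _ => measurableSet_isWinner X δ
  · exact MeasurableSet.iInter fun δ => (measurableSet_isWinner X δ).compl

/-- The properties of the data that hold almost surely. -/
structure Data.Regular (D : Data) : Prop where
  mem_Ico : ∀ c l, (D c).2 l ∈ Set.Ico (0 : ℝ) 1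
  rank_ne : ∀ δ δ', δ ≠ δ' → D.rank δ ≠ D.rank δ'

lemma Data.Regular.weight_nonneg {D : Data} (h : D.Regular) (δ : Dart) : 0 ≤ D.weight δ :=
  δ.1.weight_zero_nonneg.trans (weight_zero_le (h.mem_Ico _ _).1 (h.mem_Ico _ _).1)

lemma Data.Regular.rank_nonneg {D : Data} (h : D.Regular) (δ : Dart) : 0 ≤ D.rank δ := by
  refine le_trans ?_ (rank_zero_le (h.mem_Ico _ _).1 (h.mem_Ico _ _).1)
  have : (1 : ℝ) ≤ 2 ^ δ.1.scale := one_le_pow₀ one_le_two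
  unfold Cell.rank Cell.long Cell.short
  split_ifs
  · positivity
  · linarith

lemma Data.Regular.weight_zero_le {D : Data} (h : D.Regular) (δ : Dart) :
    δ.1.weight 0 0 ≤ D.weight δ :=
  DartMinHash.weight_zero_le (h.mem_Ico _ _).1 (h.mem_Ico _ _).1

lemma Data.Regular.rank_zero_le {D : Data} (h : D.Regular) (δ : Dart) :
    δ.1.rank 0 0 ≤ D.rank δ :=
  DartMinHash.rank_zero_le (h.mem_Ico _ _).1 (h.mem_Ico _ _).1

/-- The weights are nonnegative and vanish outside of `{0, ..., d - 1}`. -/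
structure IsWeight (d : ℕ) (X : ℕ → ℝ) : Prop where
  nonneg : ∀ i, 0 ≤ X i
  eq_zero : ∀ i, d ≤ i → X i = 0

lemma IsWeight.le_sum {d X} (h : IsWeight d X) (i : ℕ) : X i ≤ ∑ i ∈ Finset.range d, X i := by
  by_cases hi : i < d
  · exact Finset.single_le_sum (f := X) (fun i _ => h.nonneg i) (Finset.mem_range.2 hi)
  · rw [h.eq_zero i (not_lt.1 hi)]
    exact Finset.sum_nonneg fun i _ => h.nonneg i

lemma IsWeight.lt_of_pos {d X} (h : IsWeight d X) {i : ℕ} (hi : 0 < X i) : i < d := by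
  by_contra h'
  exact hi.ne' (h.eq_zero i (not_lt.1 h'))

/-- Only finitely many darts compete with a given one, since they lie in finitely many cells. -/
lemma exists_isWinner {D : Data} {d : ℕ} {X : ℕ → ℝ} (hD : D.Regular) (hX : IsWeight d X)
    {δ₀ : Dart} (h₀ : δ₀ ∈ D.darts X) : ∃ δ, IsWinner D X δ ∧ D.rank δ ≤ D.rank δ₀ := by
  have hfin : {δ | δ ∈ D.darts X ∧ D.rank δ ≤ D.rank δ₀}.Finite := by
    refine ((finite_cells d (∑ i ∈ Finset.range d, X i) (D.rank δ₀ + 1)).biUnion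
      fun c _ => (Set.finite_Iio (D c).1).image fun m => (c, m)).subset ?_
    rintro ⟨c, m⟩ ⟨⟨hv, hm, hw⟩, hr⟩
    refine Set.mem_biUnion (x := c) ⟨?_, hv, ?_, ?_⟩ ⟨m, hm, rfl⟩
    · exact hX.lt_of_pos ((hD.weight_nonneg _).trans_lt hw)
    · exact ((hD.weight_zero_le (c, m)).trans_lt hw).trans_le (hX.le_sum _)
    · linarith [hD.rank_zero_le (c, m)]
  obtain ⟨δ, ⟨h1, h2⟩, h3⟩ := hfin.exists_minimalFor D.rank _ ⟨δ₀, h₀, le_rfl⟩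
  refine ⟨δ, ⟨h1, fun δ' h' hne => lt_of_le_of_ne ?_ (hD.rank_ne _ _ hne.symm)⟩, h2⟩
  by_cases hle : D.rank δ' ≤ D.rank δ₀
  · rcases le_total (D.rank δ) (D.rank δ') with h | h
    exacts [h, h3 ⟨h', hle⟩ h]
  · linarith

end

/-! ### The collision probability -/

section
variable {Ω : Type*} [MeasurableSpace Ω] {P : Measure Ω} {u : List ℕ → Ω → ℝ}

/-- The rank of a dart is an affine function of one random number. -/
lemma rank_affine (δ : Dart) : ∃ a b : ℝ, b ≠ 0 ∧
    ∃ e, ∀ D : Data, D.rank δ = a + b * (D δ.1).2 [δ.2, e] := by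
  obtain ⟨⟨i, h, b, q⟩, m⟩ := δ
  cases h
  · refine ⟨2 ^ b - 1, 2 ^ b, by positivity, 0, fun D => ?_⟩
    simp [Data.rank, Cell.rank, Cell.long]
  · refine ⟨q / 2 ^ b, 1 / 2 ^ b, by positivity, 1, fun D => ?_⟩
    simp only [Data.rank, Cell.rank, Cell.short, if_true]
    ring

variable [IsProbabilityMeasure P]

lemma ae_affine_ne (hu : IsFullyRandom u P) {key key' : List ℕ} (hne : key ≠ key') (a a' b : ℝ)
    {b' : ℝ} (hb' : b' ≠ 0) : ∀ᵐ ω ∂P, a + b * u key ω ≠ a' + b' * u key' ω := by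
  have h2 := (indepFun_iff_map_prod_eq_prod_map_map (hu.measurable key).aemeasurable
    (hu.measurable key').aemeasurable).1 (hu.indep.indepFun hne)
  rw [map_uniform hu, map_uniform hu] at h2
  have hS : MeasurableSet {p : ℝ × ℝ | a + b * p.1 = a' + b' * p.2} :=
    measurableSet_eq_fun (by fun_prop) (by fun_prop)
  have h0 : P.map (fun ω => (u key ω, u key' ω)) {p : ℝ × ℝ | a + b * p.1 = a' + b' * p.2} = 0 := by
    rw [h2, Measure.measure_prod_null hS]
    refine .of_forall fun x => Set.Subsingleton.measure_zero (fun y hy z hz => ?_) _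
    have hy' : a + b * x = a' + b' * y := hy
    have hz' : a + b * x = a' + b' * z := hz
    exact mul_left_cancel₀ hb' (by linarith)
  rw [Measure.map_apply ((hu.measurable _).prodMk (hu.measurable _)) hS] at h0
  exact measure_eq_zero_iff_ae_notMem.1 h0

lemma ae_regular (hu : IsFullyRandom u P) (k : ℕ) :
    ∀ᵐ ω ∂P, ∀ j, (dataOf (fun key => u key ω) k j).Regular := by
  have hne : ∀ᵐ ω ∂P, ∀ j, ∀ δ δ' : Dart, δ ≠ δ' →
      (dataOf (fun key => u key ω) k j).rank δ ≠ (dataOf (fun key => u key ω) k j).rank δ' := by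
    refine ae_all_iff.2 fun j => ae_all_iff.2 fun δ => ae_all_iff.2 fun δ' =>
      Filter.eventually_imp_distrib_left.2 fun h => ?_
    obtain ⟨a, b, -, e, hr⟩ := rank_affine δ
    obtain ⟨a', b', hb', e', hr'⟩ := rank_affine δ'
    have hk : δ.1.key ++ (j + 1) :: [δ.2, e] ≠ δ'.1.key ++ (j + 1) :: [δ'.2, e'] := by
      intro hk
      obtain ⟨h1, h2⟩ := List.append_inj hk rfl
      simp only [List.cons.injEq] at h2
      exact h (Prod.ext (Cell.key_injective h1) h2.2.1)
    filter_upwards [ae_affine_ne hu hk a a' b hb'] with ω hω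
    rwa [hr, hr']
  filter_upwards [hne, ae_mem_Ico hu] with ω h1 h2 j
  exact ⟨fun c l => h2 _, h1 j⟩

lemma measurableSet_void {G : ℕ → Set (ℝ × ℝ)} (hG : ∀ i, MeasurableSet (G i)) :
    MeasurableSet {D : Data | Void D G} := by
  simp only [Void, Set.ofPred_forall]
  refine MeasurableSet.iInter fun δ => MeasurableSet.iInter fun _ => ?_
  have : {D : Data | δ.2 < (D δ.1).1 → (D.weight δ, D.rank δ) ∉ G δ.1.elem} =
      {D : Data | δ.2 < (D δ.1).1}ᶜ ∪ (fun D : Data => (D.weight δ, D.rank δ)) ⁻¹' (G δ.1.elem)ᶜ := by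
    ext D
    simp only [Set.mem_ofPred_eq, Set.mem_union, Set.mem_compl_iff, Set.mem_preimage,
      imp_iff_not_or]
  have h2 := (measurableSet_present δ).compl.union (measurable_weight_rank δ (hG δ.1.elem).compl)
  rwa [← this] at h2

/-- The points of rank less than `t` whose weight lies between the weights `X` and `Y`. -/
def band (X Y : ℕ → ℝ) (t : ℝ) (i : ℕ) : Set (ℝ × ℝ) := Set.Ico (X i) (Y i) ×ˢ Set.Ico 0 t

lemma measurableSet_band (X Y : ℕ → ℝ) (t : ℝ) (i : ℕ) : MeasurableSet (band X Y t i) :=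
  measurableSet_Ico.prod measurableSet_Ico

lemma volume_band {X Y : ℕ → ℝ} {i : ℕ} (h : X i ≤ Y i) {t : ℝ} (ht : 0 ≤ t) :
    volume.real (band X Y t i) = (Y i - X i) * t := by
  rw [band, measureReal_def, Measure.volume_eq_prod, Measure.prod_prod, Real.volume_Ico,
    Real.volume_Ico, ENNReal.toReal_mul, ENNReal.toReal_ofReal (by linarith),
    ENNReal.toReal_ofReal (by linarith), sub_zero]

lemma volume_band_ne_top (X Y : ℕ → ℝ) (t : ℝ) (i : ℕ) : volume (band X Y t i) ≠ ∞ := by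
  rw [band, Measure.volume_eq_prod, Measure.prod_prod]
  simp [ENNReal.mul_eq_top]

lemma prob_void_bands (hu : IsFullyRandom u P) {k : ℕ} (hk : 1 ≤ k) {j : ℕ} (hj : j < k) {d : ℕ}
    {X Y : ℕ → ℝ} (hX : IsWeight d X) (hY : IsWeight d Y) (hXY : ∀ i, X i ≤ Y i) {s t : ℝ}
    (hs : 0 ≤ s) (ht : 0 ≤ t) :
    P {ω | Void (dataOf (fun key => u key ω) k j) fun i => band 0 X s i ∪ band X Y t i} =
      ENNReal.ofReal (Real.exp (-(((∑ i ∈ Finset.range d, X i) * s +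
        ((∑ i ∈ Finset.range d, Y i) - ∑ i ∈ Finset.range d, X i) * t) / k))) := by
  rw [prob_void hu hk hj (d := d) (x := ∑ i ∈ Finset.range d, Y i) (t := max s t)
    fun i => (measurableSet_band _ _ _ _).union (measurableSet_band _ _ _ _)]
  · rw [← Finset.sum_sub_distrib, Finset.sum_mul, Finset.sum_mul, ← Finset.sum_add_distrib]
    congr 4
    refine Finset.sum_congr rfl fun i _ => ?_
    rw [measureReal_union (Set.disjoint_left.2 fun p hp hp' => hp.1.2.not_ge hp'.1.1)
      (measurableSet_band _ _ _ _) (volume_band_ne_top _ _ _ _) (volume_band_ne_top _ _ _ _),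
      volume_band (hX.nonneg i) hs, volume_band (hXY i) ht]
    simp
  · intro i hi
    simp [band, hX.eq_zero i hi, hY.eq_zero i hi]
  · intro i
    have := hY.le_sum i
    refine Set.union_subset ?_ ?_
    · exact Set.prod_mono (Set.Ico_subset_Ico le_rfl ((hXY i).trans this))
        (Set.Ico_subset_Ico le_rfl (le_max_left _ _))
    · exact Set.prod_mono (Set.Ico_subset_Ico (hX.nonneg i) this)
        (Set.Ico_subset_Ico le_rfl (le_max_right _ _))

/-- The number of darts below the weights `X` and of rank less than `t` has a Poisson distribution.
Only the probability of the value zero is needed. -/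
lemma prob_void_below (hu : IsFullyRandom u P) {k : ℕ} (hk : 1 ≤ k) {j : ℕ} (hj : j < k) {d : ℕ}
    {X : ℕ → ℝ} (hX : IsWeight d X) {t : ℝ} (ht : 0 ≤ t) :
    P {ω | Void (dataOf (fun key => u key ω) k j) (band 0 X t)} =
      ENNReal.ofReal (Real.exp (-((∑ i ∈ Finset.range d, X i) * t / k))) := by
  have h := prob_void_bands hu hk hj hX hX (fun _ => le_rfl) ht le_rfl
  have e : (fun i => band 0 X t i ∪ band X X 0 i) = band 0 X t := by
    funext i
    simp [band]
  simpa [e] using h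

lemma mem_darts_of_mem_band {D : Data} {X : ℕ → ℝ} {t : ℝ} {δ : Dart} (h1 : δ.1.Valid)
    (h2 : δ.2 < (D δ.1).1) (h3 : (D.weight δ, D.rank δ) ∈ band 0 X t δ.1.elem) : δ ∈ D.darts X :=
  ⟨h1, h2, h3.1.2⟩

lemma ae_exists_dart (hu : IsFullyRandom u P) {k : ℕ} (hk : 1 ≤ k) {j : ℕ} (hj : j < k) {d : ℕ}
    {X : ℕ → ℝ} (hX : IsWeight d X) (hX0 : 0 < ∑ i ∈ Finset.range d, X i) :
    ∀ᵐ ω ∂P, ∃ δ, δ ∈ (dataOf (fun key => u key ω) k j).darts X := by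
  rw [ae_iff]
  have hk' : (0 : ℝ) < k := by exact_mod_cast hk
  refine le_antisymm (ge_of_tendsto' (x := Filter.atTop) (f := fun n : ℕ => ENNReal.ofReal
    (Real.exp (-((∑ i ∈ Finset.range d, X i) * n / k)))) ?_ fun n => ?_) zero_le
  · rw [← ENNReal.ofReal_zero]
    refine ENNReal.tendsto_ofReal (Real.tendsto_exp_neg_atTop_nhds_zero.comp ?_)
    exact (tendsto_natCast_atTop_atTop.const_mul_atTop hX0).atTop_div_const hk'
  · rw [← prob_void_below hu hk hj hX n.cast_nonneg]
    refine measure_mono fun ω hω δ h1 h2 h3 => hω ⟨δ, mem_darts_of_mem_band h1 h2 h3⟩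

/-- The hashes of `X` and `Y` collide if, among the darts below the larger weights, the one of least
rank lies below the smaller weights, and they differ otherwise. -/
lemma prob_minHash_eq (hu : IsFullyRandom u P) {k : ℕ} (hk : 1 ≤ k) {j : ℕ} (hj : j < k) {d : ℕ}
    {X Y : ℕ → ℝ} (hX : IsWeight d X) (hX0 : 0 < ∑ i ∈ Finset.range d, X i)
    (hY : IsWeight d Y) (hY0 : 0 < ∑ i ∈ Finset.range d, Y i) :
    P.real {ω | minHash (dataOf (fun key => u key ω) k j) X =
      minHash (dataOf (fun key => u key ω) k j) Y} =
    (∑ i ∈ Finset.range d, min (X i) (Y i)) / ∑ i ∈ Finset.range d, max (X i) (Y i) := by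
  have hk' : (0 : ℝ) < k := by exact_mod_cast hk
  set m : ℕ → ℝ := fun i => min (X i) (Y i) with hm
  set M : ℕ → ℝ := fun i => max (X i) (Y i) with hM
  have hmw : IsWeight d m := ⟨fun i => le_min (hX.nonneg i) (hY.nonneg i), fun i hi => by
    simp [hm, hX.eq_zero i hi, hY.eq_zero i hi]⟩
  have hMw : IsWeight d M := ⟨fun i => le_max_of_le_left (hX.nonneg i), fun i hi => by
    simp [hM, hX.eq_zero i hi, hY.eq_zero i hi]⟩
  have hmM : ∀ i, m i ≤ M i := fun i => min_le_max
  set α := (∑ i ∈ Finset.range d, m i) / k with hα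
  set β := ((∑ i ∈ Finset.range d, M i) - ∑ i ∈ Finset.range d, m i) / k with hβ
  have hα0 : 0 ≤ α := div_nonneg (Finset.sum_nonneg fun i _ => hmw.nonneg i) hk'.le
  have hβ0 : 0 ≤ β := div_nonneg (sub_nonneg.2 (Finset.sum_le_sum fun i _ => hmM i)) hk'.le
  have hM0 : 0 < ∑ i ∈ Finset.range d, M i :=
    hX0.trans_le (Finset.sum_le_sum fun i _ => le_max_left _ _)
  have hαβ : α + β = (∑ i ∈ Finset.range d, M i) / k := by rw [hα, hβ]; ring
  have hαβ0 : 0 < α + β := by rw [hαβ]; positivity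
  let D : Ω → Data := fun ω => dataOf (fun key => u key ω) k j
  have hD : Measurable D := measurable_dataOf hu.measurable k j
  let good : Ω → Prop := fun ω => (D ω).Regular ∧ (∃ δ, δ ∈ (D ω).darts X) ∧
    ∃ δ, δ ∈ (D ω).darts Y
  have hgood : ∀ᵐ ω ∂P, good ω := by
    filter_upwards [ae_regular hu k, ae_exists_dart hu hk hj hX hX0,
      ae_exists_dart hu hk hj hY hY0] with ω h1 h2 h3 using ⟨h1 j, h2, h3⟩
  let A : ℝ → Set Ω := fun s => {ω | Void (D ω) (band 0 m s)}
  let B : ℝ → Set Ω := fun t => {ω | Void (D ω) (band m M t)}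
  have mA : ∀ s, MeasurableSet (A s) := fun s => hD (measurableSet_void (measurableSet_band _ _ _))
  have mB : ∀ t, MeasurableSet (B t) := fun t => hD (measurableSet_void (measurableSet_band _ _ _))
  have anti : ∀ (Z W : ℕ → ℝ), Antitone fun s => {ω | Void (D ω) (band Z W s)} :=
    fun Z W s t hst ω hω δ h1 h2 h3 => hω δ h1 h2 ⟨h3.1, h3.2.1, h3.2.2.trans_le hst⟩
  have hAB : ∀ s t, 0 ≤ s → 0 ≤ t → P.real (A s ∩ B t) = Real.exp (-(α * s + β * t)) := by
    intro s t hs ht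
    have h := prob_void_bands hu hk hj hmw hMw hmM hs ht
    have e : A s ∩ B t = {ω | Void (D ω) fun i => band 0 m s i ∪ band m M t i} := by
      ext ω
      constructor
      · rintro ⟨h1, h2⟩ δ h3 h4 (h5 | h5)
        exacts [h1 δ h3 h4 h5, h2 δ h3 h4 h5]
      · exact fun h => ⟨fun δ h3 h4 h5 => h δ h3 h4 (.inl h5),
          fun δ h3 h4 h5 => h δ h3 h4 (.inr h5)⟩
    rw [e, measureReal_def, h, ENNReal.toReal_ofReal (Real.exp_pos _).le]
    congr 1
    rw [hα, hβ]
    ring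
  have hBA : ∀ t s, 0 ≤ t → 0 ≤ s → P.real (B t ∩ A s) = Real.exp (-(β * t + α * s)) := by
    intro t s ht hs
    rw [Set.inter_comm, hAB s t hs ht, add_comm]
  -- If a dart below the minima comes first, then it wins for both `X` and `Y`.
  have hE1 := race (E := {ω | good ω → minHash (D ω) X = minHash (D ω) Y}) hα0 hαβ0 mA mB
    (anti _ _) hAB <| by
      rintro t ω ⟨hB, hA⟩ ⟨hr, -, -⟩
      have hA' : ¬ Void (D ω) (band 0 m t) := hA
      simp only [Void, not_forall, not_not] at hA'
      obtain ⟨δ₀, v1, v2, v3⟩ := hA'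
      obtain ⟨δ, w, hw⟩ := exists_isWinner hr hX (δ₀ := δ₀)
        ⟨v1, v2, v3.1.2.trans_le (min_le_left _ _)⟩
      obtain ⟨δ', w', hw'⟩ := exists_isWinner hr hY (δ₀ := δ₀)
        ⟨v1, v2, v3.1.2.trans_le (min_le_right _ _)⟩
      have low : ∀ δ : Dart, δ.1.Valid → δ.2 < (D ω δ.1).1 → (D ω).weight δ < M δ.1.elem →
          (D ω).rank δ ≤ (D ω).rank δ₀ → (D ω).weight δ < m δ.1.elem := by
        intro δ h1 h2 h3 h4
        by_contra h5
        exact hB δ h1 h2 ⟨⟨not_lt.1 h5, h3⟩, hr.rank_nonneg δ, h4.trans_lt v3.2.2⟩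
      have hδ : δ ∈ (D ω).darts Y := ⟨w.1.1, w.1.2.1, (low δ w.1.1 w.1.2.1
        (w.1.2.2.trans_le (le_max_left _ _)) hw).trans_le (min_le_right _ _)⟩
      have hδ' : δ' ∈ (D ω).darts X := ⟨w'.1.1, w'.1.2.1, (low δ' w'.1.1 w'.1.2.1
        (w'.1.2.2.trans_le (le_max_right _ _)) hw').trans_le (min_le_left _ _)⟩
      have : δ = δ' := by
        by_contra hne
        exact lt_asymm (w.2 _ hδ' (Ne.symm hne)) (w'.2 _ hδ hne)
      rw [w.minHash_eq, w'.minHash_eq, this]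
  -- If a dart between the minima and the maxima comes first, then the winners cannot agree: a common
  -- winner would lie below the minima.
  have hE2 := race (E := {ω | good ω → minHash (D ω) X ≠ minHash (D ω) Y}) hβ0
    (by rwa [add_comm]) mB mA (anti _ _) hBA <| by
      rintro t ω ⟨hA, hB⟩ ⟨hr, ⟨δX, hδX⟩, ⟨δY, hδY⟩⟩ heq
      obtain ⟨δ, w, -⟩ := exists_isWinner hr hX hδX
      obtain ⟨δ', w', -⟩ := exists_isWinner hr hY hδY
      rw [w.minHash_eq, w'.minHash_eq] at heq
      obtain rfl := Dart.id_injective heq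
      have hlow : (D ω).weight δ < m δ.1.elem := lt_min w.1.2.2 w'.1.2.2
      have hB' : ¬ Void (D ω) (band m M t) := hB
      simp only [Void, not_forall, not_not] at hB'
      obtain ⟨δ₀, v1, v2, v3⟩ := hB'
      have hrank : (D ω).rank δ ≤ (D ω).rank δ₀ := by
        by_cases h : δ₀ = δ
        · rw [h]
        rcases lt_max_iff.1 v3.1.2 with h1 | h1
        · exact (w.2 _ ⟨v1, v2, h1⟩ h).le
        · exact (w'.2 _ ⟨v1, v2, h1⟩ h).le
      exact hA δ w.1.1 w.1.2.1 ⟨⟨hr.weight_nonneg δ, hlow⟩, hr.rank_nonneg δ,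
        hrank.trans_lt v3.2.2⟩
  have hms : MeasurableSet {ω | minHash (D ω) X = minHash (D ω) Y} :=
    measurableSet_eq_fun ((measurable_minHash X).comp hD) ((measurable_minHash Y).comp hD)
  have c1 : P.real {ω | good ω → minHash (D ω) X = minHash (D ω) Y} =
      P.real {ω | minHash (D ω) X = minHash (D ω) Y} := by
    refine measureReal_congr ?_
    filter_upwards [hgood] with ω hω
    exact propext ⟨fun h => h hω, fun h _ => h⟩
  have c2 : P.real {ω | good ω → minHash (D ω) X ≠ minHash (D ω) Y} =
      P.real {ω | minHash (D ω) X = minHash (D ω) Y}ᶜ := by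
    refine measureReal_congr ?_
    filter_upwards [hgood] with ω hω
    exact propext ⟨fun h => h hω, fun h _ => h⟩
  rw [c1] at hE1
  rw [c2, probReal_compl_eq_one_sub hms, add_comm] at hE2
  have hsum : α / (α + β) + β / (α + β) = 1 := by rw [← add_div, div_self hαβ0.ne']
  -- The two lower bounds add up to one, so both are sharp.
  have hfin : P.real {ω | minHash (D ω) X = minHash (D ω) Y} = α / (α + β) := by linarith
  rw [hαβ, hα, div_div_div_cancel_right₀ hk'.ne'] at hfin
  exact hfin

end

/-! ### The expected cost of a round -/

section
variable {Ω : Type*} [MeasurableSpace Ω] {P : Measure Ω} {u : List ℕ → Ω → ℝ}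

/-- The value of `bandsCost` when there are no darts. -/
noncomputable def bandsSize (b₀ : ℕ) (o l : ℝ) : ℕ :=
  1 + ∑ b ∈ Finset.Ico b₀ (bandEnd o), (1 + ⌈l * 2 ^ b⌉₊)

/-- The value of `elemCost` when there are no darts. -/
noncomputable def elemSize (x t : ℝ) : ℕ := bandsSize 1 x t + bandsSize 0 t (min x 1)

/-- The number of scales is logarithmic in `o`, and the cells of all scales together have about the
area `l * o`. -/
lemma bandsSize_le {b₀ : ℕ} (hb₀ : b₀ ≤ 1) {o l : ℝ} (ho : 0 ≤ o) (hl : 0 ≤ l) :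
    (bandsSize b₀ o l : ℝ) ≤
      1 + (3 * Real.log (o + 1) + 2 * (1 - b₀)) + l * (2 * o + 1 - b₀) := by
  have hb₀' : (b₀ : ℝ) ≤ 1 := by exact_mod_cast hb₀
  have hlog : 0 ≤ Real.log (o + 1) := Real.log_nonneg (by linarith)
  unfold bandsSize
  rcases Nat.lt_or_ge b₀ (bandEnd o) with hlt | hge
  · obtain ⟨B, hB⟩ : ∃ B, bandEnd o = B + 1 := ⟨bandEnd o - 1, by omega⟩
    have h2 : (2 : ℝ) ^ B - 1 < o := lt_bandEnd_iff.1 (by omega)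
    have h3 : (B : ℝ) * Real.log 2 ≤ Real.log (o + 1) := by
      rw [← Real.log_pow]
      exact Real.log_le_log (by positivity) (by linarith)
    have hl2 : (2 : ℝ) / 3 ≤ Real.log 2 := by linarith [Real.log_two_gt_d9]
    have h4 : (B : ℝ) * (2 / 3) ≤ B * Real.log 2 := by gcongr
    have h5 : ∀ b ∈ Finset.Ico b₀ (B + 1), ((1 + ⌈l * 2 ^ b⌉₊ : ℕ) : ℝ) ≤ 2 + l * 2 ^ b := by
      intro b _
      have := Nat.ceil_lt_add_one (a := l * 2 ^ b) (by positivity)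
      push_cast
      linarith
    have h6 : ∑ b ∈ Finset.Ico b₀ (B + 1), (2 : ℝ) ^ b = 2 ^ (B + 1) - 2 ^ b₀ := by
      rw [geom_sum_Ico (by norm_num) (by omega)]
      norm_num
    have h7 : (2 : ℝ) ^ b₀ = 1 + b₀ := by interval_cases b₀ <;> norm_num
    have h8 := Finset.sum_le_sum h5
    rw [Finset.sum_add_distrib (f := fun _ => (2 : ℝ)), ← Finset.mul_sum, h6, Finset.sum_const,
      Nat.card_Ico, h7, nsmul_eq_mul, Nat.cast_sub (by omega)] at h8
    rw [hB]
    push_cast at h8 ⊢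
    have h9 : l * (2 ^ (B + 1) - (1 + b₀)) ≤ l * (2 * o + 1 - b₀) := by
      refine mul_le_mul_of_nonneg_left ?_ hl
      rw [pow_succ]
      linarith
    linarith
  · rw [Finset.Ico_eq_empty (by omega)]
    have : 0 ≤ l * (2 * o + 1 - b₀) := mul_nonneg hl (by linarith)
    simp only [Finset.sum_empty, add_zero, Nat.cast_one]
    linarith

/-- The number of tiles that meet a rectangle exceeds its area only by logarithmic terms. -/
lemma elemSize_le {x t : ℝ} (hx : 0 ≤ x) (ht : 0 ≤ t) :
    (elemSize x t : ℝ) ≤ 5 + 3 * Real.log (x + 1) + 3 * Real.log (t + 1) + 4 * (x * t) := by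
  have h1 := bandsSize_le (b₀ := 1) le_rfl hx ht
  have h2 := bandsSize_le (b₀ := 0) zero_le_one ht (le_min hx zero_le_one)
  have h3 : min x 1 * (2 * t) ≤ x * (2 * t) := by gcongr; exact min_le_left _ _
  have h4 := min_le_right x 1
  unfold elemSize
  push_cast at *
  nlinarith

lemma two_le_add_one_div {S : ℝ} (hS : 0 < S) : 2 ≤ S + 1 / S := by
  have : S * (1 / S) = 1 := by field_simp
  have h3 : 0 < 1 / S := by positivity
  nlinarith [sq_nonneg (S - 1 / S)]

/-- The size of round `s`, summed over the elements. The weight of an element enters only through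
its share of the total weight, so that the sum involves no factor `log T`. -/
lemma sum_elemSize_le {n : ℕ} {w : ℕ → ℝ} {S T : ℝ} (hw : ∀ e < n, 0 ≤ w e)
    (hS : ∑ e ∈ Finset.range n, w e = S) (hS0 : 0 < S) (hT : 0 ≤ T) (s : ℕ) :
    ∑ e ∈ Finset.range n, (elemSize (T * w e) (2 ^ s / S) : ℝ) ≤
      2 ^ s * (8 * n + 6 * (n * Real.log (S + 1 / S)) + 7 * T) := by
  set g := S + 1 / S with hg
  have hs : (s : ℝ) ≤ 2 ^ s := by exact_mod_cast s.lt_two_pow_self.le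
  have h1s : (1 : ℝ) ≤ 2 ^ s := one_le_pow₀ one_le_two
  have hg2 : 2 ≤ g := two_le_add_one_div hS0
  have hlg : Real.log (S + 1) + Real.log (1 / S + 1) ≤ 2 * Real.log g := by
    rw [← Real.log_mul (by positivity) (by positivity), ← Real.log_rpow (by linarith)]
    refine Real.log_le_log (by positivity) ?_
    have : (S + 1) * (1 / S + 1) = 2 + g := by rw [hg]; field_simp; ring
    rw [this]
    norm_num
    nlinarith
  have hlog2 : Real.log (2 ^ s / S + 1) ≤ s + Real.log (1 / S + 1) := by
    have h1 : Real.log (2 ^ s / S + 1) ≤ Real.log (2 ^ s * (1 / S + 1)) := by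
      refine Real.log_le_log (by positivity) ?_
      have : (2 : ℝ) ^ s * (1 / S + 1) = 2 ^ s / S + 2 ^ s := by ring
      linarith
    rw [Real.log_mul (by positivity) (by positivity), Real.log_pow] at h1
    have : (s : ℝ) * Real.log 2 ≤ s * 1 := by
      gcongr
      linarith [Real.log_two_lt_d9]
    linarith
  have hterm : ∀ e ∈ Finset.range n, (elemSize (T * w e) (2 ^ s / S) : ℝ) ≤
      (5 + 6 * Real.log g + 3 * s) + w e * (3 * T / S + 4 * T * (2 ^ s / S)) := by
    intro e he
    have hw0 := hw e (Finset.mem_range.1 he)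
    have h1 := elemSize_le (x := T * w e) (t := 2 ^ s / S) (by positivity) (by positivity)
    have h2 : Real.log (T * w e + 1) ≤ Real.log (S + 1) + T * w e / S := by
      have h3 : Real.log (T * w e + 1) ≤ Real.log ((S + 1) * (1 + T * w e / S)) := by
        refine Real.log_le_log (by positivity) ?_
        have : (S + 1) * (1 + T * w e / S) = S + 1 + T * w e + T * w e / S := by field_simp; ring
        have h4 : 0 ≤ T * w e / S := by positivity
        linarith
      rw [Real.log_mul (by positivity) (by positivity)] at h3
      have h4 : Real.log (1 + T * w e / S) ≤ T * w e / S := by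
        have := Real.log_le_sub_one_of_pos (x := 1 + T * w e / S) (by positivity)
        linarith
      linarith
    have h5 : w e * (3 * T / S + 4 * T * (2 ^ s / S)) =
      3 * (T * w e / S) + 4 * (T * w e * (2 ^ s / S)) := by ring
    linarith
  refine (Finset.sum_le_sum hterm).trans ?_
  rw [Finset.sum_add_distrib, ← Finset.sum_mul, hS, Finset.sum_const, Finset.card_range,
    nsmul_eq_mul]
  have e1 : S * (3 * T / S + 4 * T * (2 ^ s / S)) = 3 * T + 4 * T * 2 ^ s := by field_simp
  rw [e1]
  have hlg0 : 0 ≤ Real.log g := Real.log_nonneg (by linarith)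
  have e2 : (5 + 6 * Real.log g + 3 * s) ≤ 2 ^ s * (8 + 6 * Real.log g) := by nlinarith
  have e3 : 3 * T ≤ 2 ^ s * (3 * T) := by nlinarith
  have e4 := mul_le_mul_of_nonneg_left e2 n.cast_nonneg (α := ℝ)
  nlinarith

lemma measurable_bandsCost (hu : ∀ key, Measurable (u key)) (i : ℕ) (h : Bool) (b₀ : ℕ) (o l : ℝ) :
    Measurable fun ω => bandsCost (fun key => u key ω) i h b₀ o l := by
  unfold bandsCost bandCost
  exact measurable_const.add <| Finset.measurable_fun_sum _ fun b _ => measurable_const.add <|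
    Finset.measurable_fun_sum _ fun q _ => measurable_const.add (measurable_total hu _)

lemma measurable_roundCost (hu : ∀ key, Measurable (u key)) (k n : ℕ) (ids : ℕ → ℕ) (X : ℕ → ℝ)
    (t : ℝ) : Measurable fun ω => roundCost (fun key => u key ω) k n ids X t := by
  unfold roundCost elemCost
  exact measurable_const.add <| Finset.measurable_fun_sum _ fun e _ =>
    (measurable_bandsCost hu _ _ _ _ _).add (measurable_bandsCost hu _ _ _ _ _)

section
variable {μ : Measure Ω} {ε : ℝ≥0∞}

/-- The measure `μ` is going to be the restriction of `P` to the event that a round takes place. -/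
lemma lintegral_bandsCost_le (hu : ∀ key, Measurable (u key))
    (h : ∀ c, ∫⁻ ω, ((1 + total (fun key => u key ω) c : ℕ) : ℝ≥0∞) ∂μ ≤ ε)
    (h1 : μ Set.univ ≤ ε) (i : ℕ) (b : Bool) (b₀ : ℕ) (o l : ℝ) :
    ∫⁻ ω, (bandsCost (fun key => u key ω) i b b₀ o l : ℝ≥0∞) ∂μ ≤ bandsSize b₀ o l * ε := by
  have mt : ∀ c, Measurable fun ω => ((1 + total (fun key => u key ω) c : ℕ) : ℝ≥0∞) :=
    fun c => measurable_from_top.comp (measurable_const.add (measurable_total hu c))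
  simp only [bandsCost, bandCost, bandsSize, Nat.cast_add, Nat.cast_one, Nat.cast_sum] at mt h ⊢
  rw [lintegral_add_left measurable_const, lintegral_const, one_mul, add_mul, one_mul,
    lintegral_finsetSum, Finset.sum_mul]
  swap
  · exact fun b _ => measurable_const.add (Finset.measurable_fun_sum _ fun q _ => mt _)
  refine add_le_add h1 (Finset.sum_le_sum fun b _ => ?_)
  rw [lintegral_add_left measurable_const, lintegral_const, one_mul, add_mul, one_mul,
    lintegral_finsetSum _ fun q _ => mt _]
  refine add_le_add h1 ((Finset.sum_le_sum fun q _ => h _).trans ?_)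
  simp

lemma lintegral_roundCost_le (hu : ∀ key, Measurable (u key))
    (h : ∀ c, ∫⁻ ω, ((1 + total (fun key => u key ω) c : ℕ) : ℝ≥0∞) ∂μ ≤ ε)
    (h1 : μ Set.univ ≤ ε) (k n : ℕ) (ids : ℕ → ℕ) (X : ℕ → ℝ) (t : ℝ) :
    ∫⁻ ω, (roundCost (fun key => u key ω) k n ids X t : ℝ≥0∞) ∂μ ≤
      (1 + k + ∑ e ∈ Finset.range n, elemSize (X (ids e)) t : ℕ) * ε := by
  have mb : ∀ i b b₀ o l,
      Measurable fun ω => (bandsCost (fun key => u key ω) i b b₀ o l : ℝ≥0∞) :=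
    fun i b b₀ o l => measurable_from_top.comp (measurable_bandsCost hu i b b₀ o l)
  simp only [roundCost, elemCost, elemSize, Nat.cast_add, Nat.cast_one, Nat.cast_sum]
  rw [lintegral_add_left measurable_const, lintegral_const, lintegral_finsetSum,
    add_mul _ (∑ e ∈ _, _) ε, Finset.sum_mul]
  swap
  · exact fun e _ => (mb _ _ _ _ _).add (mb _ _ _ _ _)
  refine add_le_add (mul_le_mul_right h1 _) (Finset.sum_le_sum fun e _ => ?_)
  rw [lintegral_add_left (mb _ _ _ _ _), add_mul]
  exact add_le_add (lintegral_bandsCost_le hu h h1 _ _ _ _ _)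
    (lintegral_bandsCost_le hu h h1 _ _ _ _ _)

end

lemma lintegral_total_sq_le (hu : IsFullyRandom u P) (c : Cell) :
    ∫⁻ ω, ((1 + total (fun key => u key ω) c : ℕ) : ℝ≥0∞) ^ 2 ∂P ≤ ENNReal.ofReal 27 := by
  have mt := measurable_total hu.measurable c
  have h : ∫⁻ ω, ((1 + total (fun key => u key ω) c : ℕ) : ℝ≥0∞) ^ 2 ∂P =
      ∫⁻ n, ((1 + n : ℕ) : ℝ≥0∞) ^ 2 ∂(P.map fun ω => total (fun key => u key ω) c) := by
    rw [lintegral_map measurable_from_top mt]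
  rw [h, lintegral_countable']
  have hsum : HasSum (fun n : ℕ => Real.exp (-1) * (4 ^ n / n.factorial))
      (Real.exp (-1) * Real.exp 4) := by
    have := (NormedSpace.expSeries_div_hasSum_exp (4 : ℝ)).mul_left (Real.exp (-1))
    rwa [← Real.exp_eq_exp_ℝ] at this
  calc ∑' n, ((1 + n : ℕ) : ℝ≥0∞) ^ 2 * P.map (fun ω => total (fun key => u key ω) c) {n}
      ≤ ∑' n : ℕ, ENNReal.ofReal (Real.exp (-1) * (4 ^ n / n.factorial)) := by
        refine ENNReal.tsum_le_tsum fun n => ?_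
        have e : P.map (fun ω => total (fun key => u key ω) c) {n} =
            ENNReal.ofReal (Real.exp (-1) / (n.factorial : ℝ)) := by
          rw [Measure.map_apply mt (measurableSet_singleton n)]
          exact prob_total hu c n
        have h4 : (1 + n) ^ 2 ≤ 4 ^ n := by
          have : 1 + n ≤ 2 ^ n := by have := n.lt_two_pow_self; omega
          calc (1 + n) ^ 2 ≤ (2 ^ n) ^ 2 := by gcongr
            _ = 4 ^ n := by rw [← pow_mul, mul_comm, pow_mul]; norm_num
        rw [e, ← ENNReal.ofReal_natCast, ← ENNReal.ofReal_pow (by positivity),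
          ← ENNReal.ofReal_mul (by positivity)]
        refine ENNReal.ofReal_le_ofReal ?_
        have h4' : ((1 + n : ℕ) : ℝ) ^ 2 ≤ 4 ^ n := by exact_mod_cast h4
        calc ((1 + n : ℕ) : ℝ) ^ 2 * (Real.exp (-1) / n.factorial)
            ≤ 4 ^ n * (Real.exp (-1) / n.factorial) := by gcongr
          _ = _ := by ring
    _ ≤ ENNReal.ofReal 27 := by
        rw [← ENNReal.ofReal_tsum_of_nonneg (fun n => by positivity) hsum.summable, hsum.tsum_eq,
          ← Real.exp_add]
        refine ENNReal.ofReal_le_ofReal ?_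
        have : Real.exp (-1 + 4) = Real.exp 1 ^ 3 := by rw [← Real.exp_nat_mul]; norm_num
        rw [this]
        calc Real.exp 1 ^ 3 ≤ 3 ^ 3 := by
              gcongr
              linarith [Real.exp_one_lt_d9]
          _ = 27 := by norm_num

/-- The number of darts in a cell is small on average even under the condition of an unlikely event:
it has a bounded second moment. -/
lemma setLIntegral_total_le (hu : IsFullyRandom u P) (c : Cell) {F : Set Ω} {ε : ℝ}
    (hε : 0 < ε) (hPF : P F ≤ ENNReal.ofReal (3 * ε ^ 2)) :
    ∫⁻ ω in F, ((1 + total (fun key => u key ω) c : ℕ) : ℝ≥0∞) ∂P ≤ ENNReal.ofReal (30 * ε) := by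
  have mt : Measurable fun ω => ((1 + total (fun key => u key ω) c : ℕ) : ℝ≥0∞) :=
    measurable_from_top.comp (measurable_const.add (measurable_total hu.measurable c))
  -- `a ≤ 1 / ε + ε * a ^ 2` for every `a`
  have hpt : ∀ ω, ((1 + total (fun key => u key ω) c : ℕ) : ℝ≥0∞) ≤ ENNReal.ofReal ε⁻¹ +
      ENNReal.ofReal ε * ((1 + total (fun key => u key ω) c : ℕ) : ℝ≥0∞) ^ 2 := by
    intro ω
    set a : ℕ := 1 + total (fun key => u key ω) c
    rw [← ENNReal.ofReal_natCast, ← ENNReal.ofReal_pow (by positivity),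
      ← ENNReal.ofReal_mul (by positivity), ← ENNReal.ofReal_add (by positivity) (by positivity)]
    refine ENNReal.ofReal_le_ofReal ?_
    have h1 : 0 ≤ ε⁻¹ * ((ε * a - 1 / 2) ^ 2 + 3 / 4) := by positivity
    have h2 : ε⁻¹ * ((ε * a - 1 / 2) ^ 2 + 3 / 4) = ε⁻¹ + ε * (a : ℝ) ^ 2 - a := by
      field_simp; ring
    linarith
  refine (lintegral_mono hpt).trans ?_
  rw [lintegral_add_left measurable_const, setLIntegral_const,
    lintegral_const_mul _ (mt.pow_const 2)]
  refine (add_le_add (mul_le_mul_right hPF _) (mul_le_mul_right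
    ((setLIntegral_le_lintegral _ _).trans (lintegral_total_sq_le hu c)) _)).trans ?_
  rw [← ENNReal.ofReal_mul (by positivity), ← ENNReal.ofReal_mul (by positivity),
    ← ENNReal.ofReal_add (by positivity) (by positivity)]
  refine ENNReal.ofReal_le_ofReal (le_of_eq ?_)
  field_simp
  ring

end

/-! ### The expected running time -/

section

/-- Some mark has no dart below the weights `X` of rank less than `t`. -/
def Fails (v : List ℕ → ℝ) (k : ℕ) (X : ℕ → ℝ) (t : ℝ) : Prop :=
  ∃ j < k, Void (dataOf v k j) (band 0 X t)

lemma mem_dartsIn_cellsBelow {v : List ℕ → ℝ} {k j : ℕ} (hv : (dataOf v k j).Regular) {X : ℕ → ℝ}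
    {t : ℝ} {δ : Dart} (hδ : δ ∈ (dataOf v k j).darts X) (ht : (dataOf v k j).rank δ < t) :
    δ ∈ dartsIn v k X (cellsBelow X t) j :=
  ⟨⟨hδ.1, (hv.weight_zero_le δ).trans_lt hδ.2.2, (hv.rank_zero_le δ).trans_lt ht⟩, hδ.2⟩

lemma success_of_not_fails {v : List ℕ → ℝ} {k : ℕ} (hv : ∀ j, (dataOf v k j).Regular) {X : ℕ → ℝ}
    {t : ℝ} (h : ¬ Fails v k X t) : Success v k X t := by
  intro j hj
  have h' : ¬ Void (dataOf v k j) (band 0 X t) := fun h' => h ⟨j, hj, h'⟩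
  simp only [Void, not_forall, not_not] at h'
  obtain ⟨δ, h1, h2, h3⟩ := h'
  exact ⟨δ, mem_dartsIn_cellsBelow (hv j) (mem_darts_of_mem_band h1 h2 h3) h3.2.2, h3.2.2⟩

lemma exists_success {v : List ℕ → ℝ} {k : ℕ} (hv : ∀ j, (dataOf v k j).Regular) {X : ℕ → ℝ}
    {S : ℝ} (hS : 0 < S) (h : ∀ j < k, ∃ δ, δ ∈ (dataOf v k j).darts X) :
    ∃ r : ℕ, Success v k X (2 ^ r / S) := by
  have : Nonempty Dart := ⟨(⟨0, true, 0, 0⟩, 0)⟩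
  choose! δ hδ using h
  have hr : ∀ j, ∃ r : ℕ, (dataOf v k j).rank (δ j) * S < 2 ^ r := fun j =>
    pow_unbounded_of_one_lt _ one_lt_two
  choose r hr using hr
  refine ⟨(Finset.range k).sup r, fun j hj => ?_⟩
  have hlt : (dataOf v k j).rank (δ j) < 2 ^ (Finset.range k).sup r / S := by
    rw [lt_div_iff₀ hS]
    exact (hr j).trans_le (pow_le_pow_right₀ one_le_two (Finset.le_sup (Finset.mem_range.2 hj)))
  exact ⟨δ j, mem_dartsIn_cellsBelow (hv j) (hδ j hj) hlt, hlt⟩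

/-- If the least rank recorded is not the cap, then it is the rank of the winner. -/
lemma IsBest.eq_minHash {v : List ℕ → ℝ} {k j : ℕ} (hv : (dataOf v k j).Regular) {X : ℕ → ℝ}
    {t y : ℝ} {o : Fin 5 → ℕ} (h : IsBest (dataOf v k j) t (dartsIn v k X (cellsBelow X t) j) y o)
    (hs : ∃ δ ∈ dartsIn v k X (cellsBelow X t) j, (dataOf v k j).rank δ < t) :
    o = minHash (dataOf v k j) X := by
  obtain ⟨-, h2, rfl | ⟨δ, hδ, rfl, hlt, rfl⟩⟩ := h
  · obtain ⟨δ, hδ, hlt⟩ := hs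
    exact absurd (h2 δ hδ) (not_le.2 hlt)
  · refine (IsWinner.minHash_eq ⟨⟨hδ.1.1, hδ.2⟩, fun δ' hδ' hne => ?_⟩).symm
    by_cases h' : (dataOf v k j).rank δ' < t
    · exact lt_of_le_of_ne (h2 _ (mem_dartsIn_cellsBelow hv hδ' h')) (hv.rank_ne _ _ hne.symm)
    · exact hlt.trans_le (not_lt.1 h')

variable {Ω : Type*} [MeasurableSpace Ω] {P : Measure Ω} {u : List ℕ → Ω → ℝ}

lemma measurableSet_fails (hu : ∀ key, Measurable (u key)) (k : ℕ) (X : ℕ → ℝ) (t : ℝ) :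
    MeasurableSet {ω | Fails (fun key => u key ω) k X t} := by
  have : {ω | Fails (fun key => u key ω) k X t} =
      ⋃ j ∈ Finset.range k, {ω | Void (dataOf (fun key => u key ω) k j) (band 0 X t)} := by
    ext ω
    simp [Fails]
  rw [this]
  exact Finset.measurableSet_biUnion _ fun j _ =>
    measurable_dataOf hu k j (measurableSet_void (measurableSet_band _ _ _))

variable [IsProbabilityMeasure P]

/-- A union bound over the marks; the factor `k` is absorbed by the term `log k` of the scale factor. -/
lemma prob_fails_le (hu : IsFullyRandom u P) {k : ℕ} (hk : 1 ≤ k) {d : ℕ} {X : ℕ → ℝ}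
    (hX : IsWeight d X) {S : ℝ} (hS : 0 < S)
    (hXS : ∑ i ∈ Finset.range d, X i = scaleFactor k * S) (s : ℕ) :
    P {ω | Fails (fun key => u key ω) k X (2 ^ s / S)} ≤ ENNReal.ofReal (Real.exp (-2 ^ s)) := by
  have hk' : (0 : ℝ) < k := by exact_mod_cast hk
  have e : {ω | Fails (fun key => u key ω) k X (2 ^ s / S)} =
      ⋃ j ∈ Finset.range k, {ω | Void (dataOf (fun key => u key ω) k j) (band 0 X (2 ^ s / S))} := by
    ext ω
    simp [Fails]
  rw [e]
  refine (measure_biUnion_finset_le _ _).trans ?_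
  rw [Finset.sum_congr rfl fun j hj =>
    prob_void_below hu hk (Finset.mem_range.1 hj) hX (by positivity), Finset.sum_const,
    Finset.card_range, nsmul_eq_mul, ← ENNReal.ofReal_natCast, ← ENNReal.ofReal_mul hk'.le]
  refine ENNReal.ofReal_le_ofReal ?_
  have e2 : (∑ i ∈ Finset.range d, X i) * (2 ^ s / S) / k = 2 ^ s * Real.log k + 2 ^ s := by
    rw [hXS, scaleFactor]; field_simp; ring
  have h1s : (1 : ℝ) ≤ 2 ^ s := one_le_pow₀ one_le_two
  have hlog : 0 ≤ Real.log k := Real.log_nonneg (by exact_mod_cast hk)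
  rw [e2]
  calc (k : ℝ) * Real.exp (-(2 ^ s * Real.log k + 2 ^ s))
      ≤ k * Real.exp (-(Real.log k + 2 ^ s)) := by gcongr; nlinarith
    _ = Real.exp (-2 ^ s) := by
        rw [neg_add, Real.exp_add, Real.exp_neg, Real.exp_log hk', ← mul_assoc,
          mul_inv_cancel₀ hk'.ne', one_mul]

/-- The event that round `s` may take place: its predecessor fails. -/
def reaches (u : List ℕ → Ω → ℝ) (k : ℕ) (X : ℕ → ℝ) (S : ℝ) : ℕ → Set Ω
  | 0 => Set.univ
  | s + 1 => {ω | Fails (fun key => u key ω) k X (2 ^ s / S)}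

lemma measurableSet_reaches (hu : ∀ key, Measurable (u key)) (k : ℕ) (X : ℕ → ℝ) (S : ℝ) (s : ℕ) :
    MeasurableSet (reaches u k X S s) := by
  cases s
  exacts [.univ, measurableSet_fails hu k X _]

lemma prob_reaches_le (hu : IsFullyRandom u P) {k : ℕ} (hk : 1 ≤ k) {d : ℕ} {X : ℕ → ℝ}
    (hX : IsWeight d X) {S : ℝ} (hS : 0 < S)
    (hXS : ∑ i ∈ Finset.range d, X i = scaleFactor k * S) (s : ℕ) :
    P (reaches u k X S s) ≤ ENNReal.ofReal (3 * Real.exp (-(2 ^ s / 4)) ^ 2) := by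
  rw [← Real.exp_nat_mul]
  cases s with
  | zero =>
    rw [reaches, measure_univ, ← ENNReal.ofReal_one]
    refine ENNReal.ofReal_le_ofReal ?_
    have := Real.add_one_le_exp ((2 : ℕ) * (-((2 : ℝ) ^ 0 / 4)))
    norm_num at *
    linarith
  | succ s =>
    refine (prob_fails_le hu hk hX hS hXS s).trans (ENNReal.ofReal_le_ofReal ?_)
    have : ((2 : ℕ) : ℝ) * -(2 ^ (s + 1) / 4) = -2 ^ s := by push_cast; ring
    rw [this]
    linarith [Real.exp_pos (-2 ^ s)]

lemma exp_neg_le {y : ℝ} (hy : 0 < y) : Real.exp (-y) ≤ 2 / y ^ 2 := by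
  rw [Real.exp_neg, inv_eq_one_div, div_le_div_iff₀ (Real.exp_pos _) (by positivity)]
  linarith [Real.quadratic_le_exp_of_nonneg hy.le]

/-- The rounds double in size, but the probability that they are reached decreases much faster. -/
lemma lintegral_rounds_le (hu : IsFullyRandom u P) {k : ℕ} (hk : 1 ≤ k) {d : ℕ} {X : ℕ → ℝ}
    (hX : IsWeight d X) {S : ℝ} (hS : 0 < S)
    (hXS : ∑ i ∈ Finset.range d, X i = scaleFactor k * S) {n : ℕ} {ids : ℕ → ℕ} {w : ℕ → ℝ}
    (hw : ∀ e < n, 0 ≤ w e) (hwS : ∑ e ∈ Finset.range n, w e = S)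
    (hXw : ∀ e < n, X (ids e) = scaleFactor k * w e) :
    ∫⁻ ω, ∑' s : ℕ, (reaches u k X S s).indicator
      (fun ω => (440 * roundCost (fun key => u key ω) k n ids X (2 ^ s / S) : ℕ) : Ω → ℝ≥0∞) ω ∂P ≤
      ENNReal.ofReal (844800 * (2 * k + 8 * n + 6 * (n * Real.log (S + 1 / S)) +
        7 * scaleFactor k)) := by
  have hk1 : (1 : ℝ) ≤ k := by exact_mod_cast hk
  have hlk : 0 ≤ Real.log k := Real.log_nonneg hk1
  have hT : 0 ≤ scaleFactor k := by unfold scaleFactor; positivity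
  have hg : 0 ≤ Real.log (S + 1 / S) :=
    Real.log_nonneg (one_le_two.trans (two_le_add_one_div hS))
  set W : ℝ := 2 * k + 8 * n + 6 * (n * Real.log (S + 1 / S)) + 7 * scaleFactor k with hW
  have hW0 : 0 ≤ W := by positivity
  have mr : ∀ s : ℕ, Measurable fun ω =>
      ((440 * roundCost (fun key => u key ω) k n ids X (2 ^ s / S) : ℕ) : ℝ≥0∞) := fun s =>
    measurable_from_top.comp ((measurable_roundCost hu.measurable k n ids X _).const_mul 440)
  rw [lintegral_tsum fun s => ((mr s).indicator
    (measurableSet_reaches hu.measurable k X S s)).aemeasurable]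
  have hs : ∀ s : ℕ, ∫⁻ ω, (reaches u k X S s).indicator
      (fun ω => (440 * roundCost (fun key => u key ω) k n ids X (2 ^ s / S) : ℕ) : Ω → ℝ≥0∞) ω ∂P ≤
      ENNReal.ofReal (422400 * W * (1 / 2) ^ s) := by
    intro s
    have h1s : (1 : ℝ) ≤ 2 ^ s := one_le_pow₀ one_le_two
    rw [lintegral_indicator (measurableSet_reaches hu.measurable k X S s)]
    push_cast
    rw [lintegral_const_mul]
    swap
    · exact measurable_from_top.comp (measurable_roundCost hu.measurable k n ids X _)
    have hcell := fun c => setLIntegral_total_le hu c (Real.exp_pos (-(2 ^ s / 4)))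
      (prob_reaches_le hu hk hX hS hXS s)
    have huniv : (P.restrict (reaches u k X S s)) Set.univ ≤
        ENNReal.ofReal (30 * Real.exp (-(2 ^ s / 4))) := by
      refine le_trans ?_ (hcell ⟨0, true, 0, 0⟩)
      rw [← lintegral_one]
      exact lintegral_mono fun ω => by simp
    refine (mul_le_mul_right (lintegral_roundCost_le hu.measurable hcell huniv k n ids X _)
      _).trans ?_
    rw [← ENNReal.ofReal_natCast, ← ENNReal.ofReal_mul (by positivity),
      ← ENNReal.ofReal_ofNat, ← ENNReal.ofReal_mul (by positivity)]
    refine ENNReal.ofReal_le_ofReal ?_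
    have hsize := sum_elemSize_le hw hwS hS hT s
    rw [Finset.sum_congr rfl fun e he => by rw [← hXw e (Finset.mem_range.1 he)]] at hsize
    have hle : ((1 + k + ∑ e ∈ Finset.range n, elemSize (X (ids e)) (2 ^ s / S) : ℕ) : ℝ) ≤
        2 ^ s * W := by
      push_cast
      have : 1 + (k : ℝ) ≤ 2 ^ s * (2 * k) := by nlinarith
      rw [hW]
      linarith
    have hexp := exp_neg_le (y := 2 ^ s / 4) (by positivity)
    -- `exp (-y) ≤ 2 / y ^ 2` at `y = 2 ^ s / 4` beats the factor `2 ^ s` of the size.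
    calc 440 * (((1 + k + ∑ e ∈ Finset.range n, elemSize (X (ids e)) (2 ^ s / S) : ℕ) : ℝ) *
          (30 * Real.exp (-(2 ^ s / 4))))
        ≤ 440 * (2 ^ s * W * (30 * (2 / (2 ^ s / 4) ^ 2))) := by gcongr
      _ = 422400 * W * (1 / 2) ^ s := by
          rw [one_div, inv_pow]
          field_simp
          ring
  refine (ENNReal.tsum_le_tsum hs).trans ?_
  rw [← ENNReal.ofReal_tsum_of_nonneg (fun s => by positivity)
    (summable_geometric_two.mul_left _), tsum_mul_left, tsum_geometric_two]
  refine ENNReal.ofReal_le_ofReal (le_of_eq ?_)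
  ring

end

/-! ### The hash functions -/

section

/-- The program halts with the minhashes. Its cost is bounded round by round, where a round is
charged on the event that it may take place. -/
lemma runs_mainProg_minHash {Ω : Type*} {u : List ℕ → Ω → ℝ} {ω : Ω} {k n : ℕ} {ids : ℕ → ℕ}
    {X : ℕ → ℝ} {S : ℝ} {s : State} (hu : ∀ key, u key ω < 1)
    (hreg : ∀ j, (dataOf (fun key => u key ω) k j).Regular)
    (hd : ∀ j < k, ∃ δ, δ ∈ (dataOf (fun key => u key ω) k j).darts X)
    (hs : Loaded k n ids X (scaleFactor k) s) (hX : ∀ i, 0 < X i → ∃ e < n, i = ids e)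
    (hS : ∑ e ∈ Finset.range n, s.rarr 0 e = S) (hS0 : 0 < S)
    (hst : ∀ j, s.narr 7 j ≤ s.nvar 8) :
    Runs (fun key => u key ω) mainProg s fun s' cost =>
      (∀ j < k, out s' j = minHash (dataOf (fun key => u key ω) k j) X) ∧
      (cost : ℝ≥0∞) ≤ (50 * (1 + n) : ℕ) + ∑' m : ℕ, (reaches u k X S m).indicator
        (fun ω => (440 * roundCost (fun key => u key ω) k n ids X (2 ^ m / S) : ℕ) :
          Ω → ℝ≥0∞) ω := by
  classical
  have hex := exists_success hreg hS0 hd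
  have hr := Nat.find_spec hex
  refine (runs_mainProg hu hs hX hS hst hr fun m hm => Nat.find_min hex hm).mono
    fun s' c ⟨h1, h2⟩ => ⟨fun j hj => (h1 j hj).eq_minHash (hreg j) (hr j hj), ?_⟩
  have h2' : (c : ℝ≥0∞) ≤ ((50 * (1 + n) + ∑ m ∈ Finset.range (Nat.find hex + 1),
      440 * roundCost (fun key => u key ω) k n ids X (2 ^ m / S) : ℕ) : ℝ≥0∞) := by
    exact_mod_cast h2
  refine h2'.trans ?_
  rw [Nat.cast_add, Nat.cast_sum]
  refine add_le_add le_rfl (le_trans (Finset.sum_le_sum fun m hm => ?_)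
    (ENNReal.sum_le_tsum (Finset.range (Nat.find hex + 1))))
  rw [Set.indicator_of_mem]
  cases m with
  | zero => exact Set.mem_univ _
  | succ m =>
    have hm' := Nat.find_min hex (m := m) (by have := Finset.mem_range.1 hm; omega)
    by_contra hF
    exact hm' (success_of_not_fails hreg hF)

variable {d : ℕ}

/-- The weights as the program scales them, as a function on the natural numbers. -/
noncomputable def scaled (k : ℕ) (x : WeightedSet d) (i : ℕ) : ℝ :=
  if h : i < d then scaleFactor k * x.1 ⟨i, h⟩ else 0

lemma scaled_val (k : ℕ) (x : WeightedSet d) (i : Fin d) :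
    scaled k x i = scaleFactor k * x.1 i := by
  simp [scaled]

lemma scaleFactor_pos {k : ℕ} (hk : 1 ≤ k) : 0 < scaleFactor k := by
  have hk1 : (1 : ℝ) ≤ k := by exact_mod_cast hk
  have hlk : 0 ≤ Real.log k := Real.log_nonneg hk1
  unfold scaleFactor
  positivity

lemma isWeight_scaled {k : ℕ} (hk : 1 ≤ k) (x : WeightedSet d) : IsWeight d (scaled k x) where
  nonneg i := by
    unfold scaled
    split_ifs
    · exact mul_nonneg (scaleFactor_pos hk).le (NNReal.coe_nonneg _)
    · exact le_rfl
  eq_zero i hi := dif_neg (not_lt.2 hi)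

lemma l1norm_pos (x : WeightedSet d) : 0 < l1norm x := by
  obtain ⟨i, hi⟩ := Function.ne_iff.1 x.2
  exact Finset.sum_pos' (fun i _ => NNReal.coe_nonneg _)
    ⟨i, Finset.mem_univ i, NNReal.coe_pos.2 (pos_iff_ne_zero.2 hi)⟩

lemma sum_scaled (k : ℕ) (x : WeightedSet d) :
    ∑ i ∈ Finset.range d, scaled k x i = scaleFactor k * l1norm x := by
  rw [Finset.sum_range, l1norm, Finset.mul_sum]
  exact Finset.sum_congr rfl fun i _ => scaled_val k x i

lemma sum_scaled_pos {k : ℕ} (hk : 1 ≤ k) (x : WeightedSet d) :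
    0 < ∑ i ∈ Finset.range d, scaled k x i := by
  rw [sum_scaled]
  exact mul_pos (scaleFactor_pos hk) (l1norm_pos x)

/-- The weighted Jaccard similarity is invariant under scaling. -/
lemma jaccard_eq {k : ℕ} (hk : 1 ≤ k) (x y : WeightedSet d) :
    (∑ i ∈ Finset.range d, min (scaled k x i) (scaled k y i)) /
      ∑ i ∈ Finset.range d, max (scaled k x i) (scaled k y i) = jaccard x y := by
  have hT := scaleFactor_pos hk
  simp only [Finset.sum_range, scaled_val, ← mul_min_of_nonneg _ _ hT.le,
    ← mul_max_of_nonneg _ _ hT.le, ← Finset.mul_sum]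
  rw [mul_div_mul_left _ _ hT.ne', jaccard]

lemma loaded_input (k : ℕ) (x : WeightedSet d) (L : List (Fin d)) :
    Loaded k L.length (fun e => (L.map Fin.val).getD e 0) (scaled k x) (scaleFactor k)
      (input k x L) where
  k_eq := rfl
  n_eq := rfl
  ids_eq e _ := by simp [input, List.map_eq_flatMap]
  weights e he := by simp [input, he, scaled_val]

lemma sum_weights {x : WeightedSet d} {L : List (Fin d)} (hL : IsListing x L) (k : ℕ) :
    ∑ e ∈ Finset.range L.length, (input k x L).rarr 0 e = l1norm x := by
  have h1 : ∑ e ∈ Finset.range L.length, (input k x L).rarr 0 e =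
      (L.map fun i => (x.1 i : ℝ)).sum := by
    rw [← Fin.sum_univ_getElem, Finset.sum_range]
    refine Fintype.sum_equiv (finCongr (by simp)) _ _ fun e => ?_
    simp [input]
  rw [h1, ← List.sum_toFinset _ hL.1]
  refine Finset.sum_subset (Finset.subset_univ _) fun i _ hi => ?_
  have : x.1 i = 0 := by
    by_contra h
    exact hi (List.mem_toFinset.2 ((hL.2 i).2 h))
  simp [this]

lemma length_eq_hammingNorm {x : WeightedSet d} {L : List (Fin d)} (hL : IsListing x L) :
    L.length = hammingNorm x.1 := by
  rw [← List.toFinset_card_of_nodup hL.1, hammingNorm]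
  congr 1
  ext i
  simp [hL.2 i]

lemma exists_index {k : ℕ} {x : WeightedSet d} {L : List (Fin d)} (hL : IsListing x L) (i : ℕ)
    (hi : 0 < scaled k x i) : ∃ e < L.length, i = (L.map Fin.val).getD e 0 := by
  unfold scaled at hi
  split_ifs at hi with h
  · have hne : x.1 ⟨i, h⟩ ≠ 0 := by
      intro h0
      simp [h0] at hi
    obtain ⟨e, he, hie⟩ := List.mem_iff_getElem.1 ((hL.2 _).2 hne)
    exact ⟨e, he, by simp [he, hie]⟩
  · exact absurd hi (lt_irrefl _)

/-- The lower order terms are absorbed, since `S + 1 / S ≥ 2` and there is at least one element. -/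
lemma total_cost_le {k n : ℕ} (hk : 1 ≤ k) (hn : 1 ≤ n) {S : ℝ} (hS : 0 < S) :
    (50 * (1 + n) : ℕ) + 844800 * (2 * k + 8 * n + 6 * (n * Real.log (S + 1 / S)) +
      7 * scaleFactor k) ≤ 34000000 * (k * Real.log k + n * Real.log (S + 1 / S)) := by
  have hn1 : (1 : ℝ) ≤ n := by exact_mod_cast hn
  have hk1 : (1 : ℝ) ≤ k := by exact_mod_cast hk
  have hg2 : 2 ≤ S + 1 / S := two_le_add_one_div hS
  have hl2 : (1 : ℝ) / 2 ≤ Real.log 2 := by linarith [Real.log_two_gt_d9]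
  have hlg : 1 / 2 ≤ Real.log (S + 1 / S) := hl2.trans (Real.log_le_log (by norm_num) hg2)
  have h1 : (n : ℝ) * (1 / 2) ≤ n * Real.log (S + 1 / S) := by gcongr
  have hlk : 0 ≤ Real.log k := Real.log_nonneg hk1
  have h2 : (k : ℝ) ≤ 2 * (k * Real.log k) + 2 * (n * Real.log (S + 1 / S)) := by
    rcases hk.eq_or_lt with rfl | hk2
    · rw [Nat.cast_one, Real.log_one]
      linarith
    · have hk2' : (2 : ℝ) ≤ k := by exact_mod_cast hk2
      have h3 : (k : ℝ) * (1 / 2) ≤ k * Real.log k := by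
        gcongr
        exact hl2.trans (Real.log_le_log (by norm_num) hk2')
      linarith
  have h4 : 0 ≤ (k : ℝ) * Real.log k := by positivity
  rw [scaleFactor, mul_add, mul_one]
  push_cast
  linarith

end

end DartMinHash

open RealRAM MinHash DartMinHash in
theorem theorem1 :
    ∃ (p : RealRAM.Prog) (w : ℕ) (C : ℝ),
      ∀ (k : ℕ), 1 ≤ k → ∀ (d : ℕ)
        (Ω : Type*) [MeasurableSpace Ω] (P : Measure Ω) [IsProbabilityMeasure P]
        (u : List ℕ → Ω → ℝ), MinHash.IsFullyRandom u P →
        ∃ h : Fin k → MinHash.WeightedSet d → Ω → (Fin w → ℕ),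
          (∀ j x, Measurable (h j x)) ∧
          -- the `k` random hash functions `x ↦ h j x` are independent
          iIndepFun (fun (j : Fin k) (ω : Ω) (x : MinHash.WeightedSet d) => h j x ω) P ∧
          -- each of them is a weighted minhash
          (∀ j x y, P.real {ω | h j x ω = h j y ω} = MinHash.jaccard x y) ∧
          ∀ (x : MinHash.WeightedSet d) (L : List (Fin d)), MinHash.IsListing x L →
            -- the program outputs the `k` values of `x`
            (∀ᵐ ω ∂P, MinHash.Outputs (fun key => u key ω) p (MinHash.input k x L)
              (fun j => h j x ω)) ∧
            -- its expected running time
            ∫⁻ ω, RealRAM.time (fun key => u key ω) p (MinHash.input k x L) ∂P ≤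
              ENNReal.ofReal (C * (k * Real.log k + hammingNorm x.1 *
                Real.log (MinHash.l1norm x + 1 / MinHash.l1norm x))) := by
  refine ⟨mainProg, 5, 34000000, fun k hk d Ω _ P _ u hu =>
    ⟨fun j x ω => minHash (dataOf (fun key => u key ω) k j) (scaled k x), ?_, ?_, ?_, ?_⟩⟩
  · exact fun j x => (measurable_minHash _).comp (measurable_dataOf hu.measurable k j)
  · exact (indep_data hu hk).comp (fun j D x => minHash D (scaled k x)) fun j =>
      measurable_pi_iff.2 fun x => measurable_minHash _
  · intro j x y
    rw [prob_minHash_eq hu hk j.2 (isWeight_scaled hk x) (sum_scaled_pos hk x)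
      (isWeight_scaled hk y) (sum_scaled_pos hk y), jaccard_eq hk]
  · intro x L hL
    have hruns : ∀ᵐ ω ∂P, Runs (fun key => u key ω) mainProg (input k x L) fun s' cost =>
        (∀ j < k, out s' j = minHash (dataOf (fun key => u key ω) k j) (scaled k x)) ∧
        (cost : ℝ≥0∞) ≤ (50 * (1 + L.length) : ℕ) +
          ∑' m : ℕ, (reaches u k (scaled k x) (l1norm x) m).indicator (fun ω =>
            (440 * roundCost (fun key => u key ω) k L.length
              (fun e => (L.map Fin.val).getD e 0) (scaled k x)
              (2 ^ m / l1norm x) : ℕ) : Ω → ℝ≥0∞) ω := by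
      filter_upwards [ae_mem_Ico hu, ae_regular hu k,
        ae_all_iff.2 fun j => Filter.eventually_imp_distrib_left.2 fun hj : j < k =>
          ae_exists_dart hu hk hj (isWeight_scaled hk x) (sum_scaled_pos hk x)] with ω h1 h2 h3
      exact runs_mainProg_minHash (fun key => (h1 key).2) h2 h3 (loaded_input k x L)
        (exists_index hL) (sum_weights hL k) (l1norm_pos x) fun j => le_rfl
    constructor
    · filter_upwards [hruns] with ω ⟨s', c, he, ho, _⟩
      exact ⟨s', c, he, fun j a => congrFun (ho j j.2) a⟩
    · have htime : ∫⁻ ω, time (fun key => u key ω) mainProg (input k x L) ∂P ≤ _ :=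
        lintegral_mono_ae (hruns.mono fun ω ⟨s', c, he, _, hc⟩ => (time_le he).trans hc)
      refine htime.trans ?_
      rw [lintegral_add_left measurable_const, lintegral_const, measure_univ, mul_one]
      have hw : ∀ e, (input k x L).rarr 0 e = (L.map (fun i => (x.1 i : ℝ))).getD e 0 :=
        fun e => rfl
      refine (add_le_add le_rfl (lintegral_rounds_le hu hk (isWeight_scaled hk x) (l1norm_pos x)
        (sum_scaled k x) (w := (input k x L).rarr 0) (fun e he => ?_) (sum_weights hL k)
        fun e he => ((loaded_input k x L).weights e he).symm)).trans ?_
      · rw [hw]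
        simp [he]
      · have hn : 1 ≤ L.length := by
          obtain ⟨i, hi⟩ := Function.ne_iff.1 x.2
          exact List.length_pos_of_mem ((hL.2 i).2 hi)
        rw [← length_eq_hammingNorm hL, ← ENNReal.ofReal_natCast, ← ENNReal.ofReal_add]
        · exact ENNReal.ofReal_le_ofReal (total_cost_le hk hn (l1norm_pos x))
        · positivity
        · have hlog : 0 ≤ Real.log (l1norm x + 1 / l1norm x) :=
            Real.log_nonneg (one_le_two.trans (two_le_add_one_div (l1norm_pos x)))
          have hlk : 0 ≤ Real.log k := Real.log_nonneg (by exact_mod_cast hk)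
          have hT := scaleFactor_pos hk
          positivity
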